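/- **Setting.** Let $f(x)=\frac1N\sum_{i=1}^N f_i(x)$ on $\mathbb R^m$, with $f_i(x)=\mathbb E[F_i(x;\xi_i)]$, each $f_i$ differentiable with $L$-Lipschitz gradient ($L>0$). Let $W=[w_{ij}]\in\mathbb R^{N\times N}$ be symmetric, doubly stochastic, primitive and positive definite, with mixing rate $\lambda=\|W-\frac1N\mathbf 1\mathbf 1^{\mathsf T}\|<1$. Local Exact-Diffusion (LED) with step size $\alpha>0$, $\beta=1/\tau$ and $\tau\ge1$ local steps starts from deterministic $x_i^0$ and either $y_i^0=x_i^0-\sum_j w_{ij}x_j^0$ or $y_i^0=0$, and for $r=0,1,2,\dots$ and each node $i$ performs $$\phi_{i,0}^r=x_i^r,\qquad \phi_{i,t+1}^r=\phi_{i,t}^r-\alpha\nabla F_i(\phi_{i,t}^r;\xi_{i,t}^r)-\beta y_i^r\quad(0\le t<\tau),$$ $$x_i^{r+1}=\sum_j w_{ij}\phi_{j,\tau}^r,\qquad y_i^{r+1}=y_i^r+\phi_{i,\tau}^r-x_i^{r+1}.$$ The samples $\xi_{i,t}^r$ are mutually independent, $\xi_{i,t}^r$ being distributed as $\xi_i$,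 and, conditionally on all iterates up to step $t$ of round $r$, the noise $\nabla F_i(\phi_{i,t}^r;\xi_{i,t}^r)-\nabla f_i(\phi_{i,t}^r)$ has mean $0$ and second moment at most $\sigma^2$. Write $\bar x^r=\frac1N\sum_i x_i^r$, $\varsigma_0^2=\frac1N\sum_i\|\nabla f_i(\bar x^0)-\nabla f(\bar x^0)\|^2$ and $\chi_0^2=\frac1N\sum_i\|x_i^0-\bar x^0\|^2$ (so $\chi_0=0$ when all nodes start from the same point). **Corollary 2 (convergence rates in the stochastic case).** For every number $R\ge1$ of rounds there is a step size $\alpha>0$, not depending on the realization of the samples, such that the following holds. 1. *Nonconvex.* If $f$ is bounded below, with $f^\star=\inf f$, then $$\frac1R\sum_{r=0}^{R-1}\mathcal E_r\le C\Big(\frac{\sigma^2}{N\tau R}\Big)^{1/2}+C\,\frac{1}{(1-\lambda)^{1/3}}\Big(\frac{\sigma}{\sqrt\tau R}\Big)^{2/3}+C\,\frac{\frac1{1-\lambda}+\varsigma_0^2}{R},$$ where $\mathcal E_r=\mathbb E\big[\|\nabla f(\bar x^r)\|^2+\frac1\tau\sum_{t=0}^{\tau-1}\|\frac1N\sum_{i}\nabla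 f_i(\phi_{i,t}^r)\|^2\big]$ and $C$ depends only on $L$ and on upper bounds for $f(\bar x^0)-f^\star$ and $\chi_0^2$. 2. *Convex.* If every $f_i$ is convex and $x^\star$ minimizes $f$, the same bound holds with $\mathcal E_r=\mathbb E[f(\bar x^r)-f(x^\star)]$, where $C$ depends only on $L$ and on upper bounds for $\|\bar x^0-x^\star\|^2$ and $\chi_0^2$. 3. *Strongly convex.* If every $f_i$ is $\mu$-strongly convex, $0<\mu\le L$, and $x^\star$ minimizes $f$, put $a_0=\|\bar x^0-x^\star\|^2+\varsigma_0^2+\chi_0^2$ and $\ell=\log\big(2+N\tau R\,a_0/\sigma^2\big)$ (with $\ell=\log 2$ if $\sigma=0$). Then $$\mathbb E\|\bar x^R-x^\star\|^2\le C\,\ell\,\frac{\sigma^2}{\tau NR}+C\,\ell^2\,\frac{\sigma^2}{(1-\lambda)\tau R^2}+C\exp\big(-c(1-\lambda)R\big)\,a_0,$$ where $C,c>0$ depend only on $\mu$ and $L$. All the expectations above are finite. -/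

import Mathlib

open MeasureTheory ProbabilityTheory

universe u v

noncomputable section

namespace LED

/-- The Euclidean space `ℝ^m`. -/
abbrev Vec (m : ℕ) : Type := EuclideanSpace ℝ (Fin m)

/-- The network average `(1/N) ∑ᵢ xᵢ`. -/
def avg {N m : ℕ} (x : Fin N → Vec m) : Vec m := (1 / (N : ℝ)) • ∑ i, x i

/-- The weight matrix is symmetric, doubly stochastic, primitive and positive definite. -/
structure WeightAssumption {N : ℕ} (W : Matrix (Fin N) (Fin N) ℝ) : Prop where
  symm : W.IsSymm
  doublyStochastic : W ∈ doublyStochastic ℝ (Fin N)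
  primitive : W.IsPrimitive
  posDef : W.PosDef

/-- The mixing rate `λ = ‖W - (1/N) 𝟏 𝟏ᵀ‖` (spectral norm). -/
def mixingRate {N : ℕ} (W : Matrix (Fin N) (Fin N) ℝ) : ℝ :=
  ‖Matrix.toEuclideanCLM (𝕜 := ℝ) (W - (1 / (N : ℝ)) • Matrix.of (fun _ _ : Fin N => (1 : ℝ)))‖

/-- A stochastic optimization problem over `N` nodes in `ℝ^m`: node `i` has data with values in
`Ξ i` and law `law i`, and the loss `F i x s` at the point `x` and the datum `s`. The expectation
`𝔼 F i (x; ξᵢ)` and the gradient of `F i` in `x` exist; the gradient is jointly measurable. -/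
structure Problem (N m : ℕ) where
  Ξ : Fin N → Type u
  mΞ : ∀ i, MeasurableSpace (Ξ i)
  law : ∀ i, Measure (Ξ i)
  F : ∀ i, Vec m → Ξ i → ℝ
  prob : ∀ i, IsProbabilityMeasure (law i)
  integrable : ∀ i x, Integrable (F i x) (law i)
  differentiable : ∀ i s, Differentiable ℝ (fun x => F i x s)
  measurable_gradient :
    ∀ i, Measurable (fun q : Vec m × Ξ i => gradient (fun x => F i x q.2) q.1)

attribute [instance] Problem.mΞ Problem.prob

namespace Problem

variable {N m : ℕ} (p : Problem.{u} N m)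

/-- The stochastic gradient `∇Fᵢ(x; s)`. -/
def stochGrad (i : Fin N) (x : Vec m) (s : p.Ξ i) : Vec m := gradient (fun z => p.F i z s) x

/-- The local objective `fᵢ(x) = 𝔼 Fᵢ(x; ξᵢ)`. -/
def localCost (i : Fin N) (x : Vec m) : ℝ := ∫ s, p.F i x s ∂(p.law i)

/-- The global objective `f(x) = (1/N) ∑ᵢ fᵢ(x)`. -/
def cost (x : Vec m) : ℝ := (1 / (N : ℝ)) * ∑ i, p.localCost i x

/-- Each `fᵢ` is differentiable with `L`-Lipschitz gradient. -/
def Smooth (L : ℝ) : Prop :=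
  ∀ i, Differentiable ℝ (p.localCost i) ∧
    ∀ y z, ‖gradient (p.localCost i) y - gradient (p.localCost i) z‖ ≤ L * ‖y - z‖

/-- `ς₀² = (1/N) ∑ᵢ ‖∇fᵢ(x̄⁰) - ∇f(x̄⁰)‖²`. -/
def heterogeneitySq (x₀ : Fin N → Vec m) : ℝ :=
  (1 / (N : ℝ)) * ∑ i, ‖gradient (p.localCost i) (avg x₀) - gradient p.cost (avg x₀)‖ ^ 2

end Problem

/-- The initial disagreement `χ₀² = (1/N) ∑ᵢ ‖xᵢ⁰ - x̄⁰‖²`; it vanishes when all nodes start from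
the same point. -/
def disagreementSq {N m : ℕ} (x₀ : Fin N → Vec m) : ℝ :=
  (1 / (N : ℝ)) * ∑ i, ‖x₀ i - avg x₀‖ ^ 2

/-- The input of Local Exact-Diffusion. -/
structure Input (N m : ℕ) where
  W : Matrix (Fin N) (Fin N) ℝ
  α : ℝ
  β : ℝ
  τ : ℕ
  x₀ : Fin N → Vec m
  y₀ : Fin N → Vec m

/-- The two admissible initializations of the dual variable: `y⁰ = (I - W) x⁰` or `y⁰ = 0`. -/
def InitialDual {N m : ℕ} (W : Matrix (Fin N) (Fin N) ℝ) (x₀ y₀ : Fin N → Vec m) : Prop :=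
  (∀ i, y₀ i = x₀ i - ∑ j, W i j • x₀ j) ∨ (∀ i, y₀ i = 0)

/-- The local updates of one node, started at `x` with dual variable `y`, where `g t` is the
stochastic gradient map of step `t`: `φ₀ = x`, `φ_{t+1} = φ_t - α g_t(φ_t) - β y`. -/
def localUpdate {m : ℕ} (α β : ℝ) (g : ℕ → Vec m → Vec m) (x y : Vec m) : ℕ → Vec m
  | 0 => x
  | t + 1 => localUpdate α β g x y t - α • g t (localUpdate α β g x y t) - β • y

namespace Input

variable {N m : ℕ} (A : Input N m) (p : Problem.{u} N m)

/-- The pair `(x^r, y^r)` of Local Exact-Diffusion when the data used by node `i` in local step `t`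
of round `r` is `d r t i`. -/
def state (d : ℕ → ℕ → (i : Fin N) → p.Ξ i) : ℕ → (Fin N → Vec m) × (Fin N → Vec m)
  | 0 => (A.x₀, A.y₀)
  | r + 1 =>
    let x := (state d r).1
    let y := (state d r).2
    let φ : Fin N → Vec m := fun i =>
      localUpdate A.α A.β (fun t z => p.stochGrad i z (d r t i)) (x i) (y i) A.τ
    let x' : Fin N → Vec m := fun i => ∑ j, A.W i j • φ j
    (x', fun i => y i + φ i - x' i)

variable {Ω : Type v} (ξ : ℕ → ℕ → (i : Fin N) → Ω → p.Ξ i)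

/-- The random iterate `x^r = (x_1^r, …, x_N^r)`. -/
def x (r : ℕ) (ω : Ω) : Fin N → Vec m := (A.state p (fun r t i => ξ r t i ω) r).1

/-- The random dual iterate `y^r`. -/
def y (r : ℕ) (ω : Ω) : Fin N → Vec m := (A.state p (fun r t i => ξ r t i ω) r).2

/-- The random local iterate `φ_{i,t}^r`. -/
def phi (r t : ℕ) (i : Fin N) (ω : Ω) : Vec m :=
  localUpdate A.α A.β (fun t z => p.stochGrad i z (ξ r t i ω)) (A.x p ξ r ω i) (A.y p ξ r ω i) t

/-- The average iterate `x̄^r`. -/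
def xbar (r : ℕ) (ω : Ω) : Vec m := avg (A.x p ξ r ω)

/-- The gradient noise `∇Fᵢ(φ_{i,t}^r; ξ_{i,t}^r) - ∇fᵢ(φ_{i,t}^r)`. -/
def noise (r t : ℕ) (i : Fin N) (ω : Ω) : Vec m :=
  p.stochGrad i (A.phi p ξ r t i ω) (ξ r t i ω) - gradient (p.localCost i) (A.phi p ξ r t i ω)

/-- The σ-algebra generated by all the iterates `φ_{j,t'}^{r'}`, `t' ≤ τ`, of all the nodes, up to
and including step `t` of round `r`. (Note that `x_j^r = φ_{j,0}^r`.) -/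
@[reducible] def history (r t : ℕ) : MeasurableSpace Ω :=
  ⨆ (k : ℕ × ℕ) (_ : k.2 ≤ A.τ ∧ (k.1 < r ∨ k.1 = r ∧ k.2 ≤ t)) (j : Fin N),
    MeasurableSpace.comap (A.phi p ξ k.1 k.2 j) inferInstance

variable [MeasurableSpace Ω] (P : Measure Ω)

/-- The stochastic gradients are unbiased with variance at most `σ²`, conditionally on the past
iterates, and the samples `ξ_{i,t}^r` are independent of each other, `ξ_{i,t}^r` being distributed
as the data of node `i`. -/
structure NoiseAssumption (σ : ℝ) : Prop where
  measurable : ∀ r, ∀ t < A.τ, ∀ i, Measurable (ξ r t i)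
  map_eq : ∀ r, ∀ t < A.τ, ∀ i, P.map (ξ r t i) = p.law i
  indep : iIndepFun (β := fun k : ℕ × Fin A.τ × Fin N => p.Ξ k.2.2)
    (fun k => ξ k.1 k.2.1 k.2.2) P
  memLp : ∀ r, ∀ t < A.τ, ∀ i, MemLp (A.noise p ξ r t i) 2 P
  unbiased : ∀ r, ∀ t < A.τ, ∀ i, P[A.noise p ξ r t i | A.history p ξ r t] =ᵐ[P] 0
  variance : ∀ r, ∀ t < A.τ, ∀ i,
    P[fun ω => ‖A.noise p ξ r t i ω‖ ^ 2 | A.history p ξ r t] ≤ᵐ[P] fun _ => σ ^ 2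

/-- The stationarity measure of round `r` before taking the expectation:
`‖∇f(x̄^r)‖² + (1/τ) ∑_t ‖(1/N) ∑ᵢ ∇fᵢ(φ_{i,t}^r)‖²`. -/
def stationarity (r : ℕ) (ω : Ω) : ℝ :=
  ‖gradient p.cost (A.xbar p ξ r ω)‖ ^ 2 + (1 / (A.τ : ℝ)) * ∑ t ∈ Finset.range A.τ,
    ‖avg (fun i => gradient (p.localCost i) (A.phi p ξ r t i ω))‖ ^ 2

end Input

/-- The common right-hand side of the nonconvex and convex rates, with `l` the mixing rate and `s`
the squared heterogeneity `ς₀²`. -/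
def sublinearRate (C σ l s : ℝ) (N τ R : ℕ) : ℝ :=
  C * (σ ^ 2 / (N * τ * R)) ^ (1 / 2 : ℝ)
    + C * (1 / (1 - l) ^ (1 / 3 : ℝ) * (σ / (√(τ : ℝ) * R)) ^ (2 / 3 : ℝ))
    + C * ((1 / (1 - l) + s) / R)

end LED

end

/-! All random vectors of the algorithm are square integrable, so a run is a deterministic sequence
in the Hilbert space `L²(P)`, in which unbiased noise is orthogonal noise. The analysis takes place
in an abstract real Hilbert space (`Trajectory`); probability enters only to verify the axioms of
that structure (`Input.NoiseAssumption.trajectory`).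

Put `γ = α τ` and `d = 1 - λ`. Since `β = 1/τ`, a round subtracts the dual variable exactly once,
and since `W` preserves sums, the dual variables cancel in the network average. The average
therefore performs a gradient step of size `γ` with averaged gradients taken at the local iterates
and noise of variance `γ² σ² / (N τ)`.

For the network error, expand in an eigenbasis of `W`. With `D` the local gradients at the average
iterate and `z = y + γ D`, the pair of coefficients `(e, z)` of a nonconstant mode with eigenvalue
`w` is sent by a round to `(w (e - z), w z + (1 - w) e)`, up to drift, noise and the change of `D`.
This linear map has eigenvalues `w ± i √(w (1 - w))` of modulus `√w`. The norm `‖e‖² + dualWeight w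
* ‖z‖²` exhibits the contraction (`mode_contraction`), and as `w ≤ λ`, the network error shrinks by
`1 - d/4` per round (`networkError_succ_le`). Absorbing `γ D` into the dual variable is what makes
data heterogeneity disappear except through the initial value of `z`. The local iterates stay near
the average because their common drift along a round is governed by the same `z` (`spread_le`).

If `γ L ≤ d/100`, the coupled inequalities close: the expected cost in the nonconvex case, or the
squared distance to a minimizer in the convex cases, plus a multiple of `γ L / d` times the network
error is a Lyapunov function. Summing its decrease bounds the averages by terms of the orders `1/(γ
R)`, `γ σ²/(N τ)` and `γ² σ²/(τ d)`, besides initial terms. Under strong convexity it decays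
geometrically with rate `γ μ / 2`. The choice of `γ` balances these contributions. -/

namespace LED

/-! ### Smooth and convex functions on a Hilbert space -/

section Calculus

variable {E : Type*} [NormedAddCommGroup E] [InnerProductSpace ℝ E] [CompleteSpace E]

theorem hasDerivAt_comp_segment {f : E → ℝ} (hf : Differentiable ℝ f) (x v : E) (t : ℝ) :
    HasDerivAt (fun s : ℝ => f (x + s • v)) (inner ℝ (gradient f (x + t • v)) v) t := by
  have h1 : HasDerivAt (fun s : ℝ => x + s • v) v t := by
    simpa using ((hasDerivAt_id t).smul_const v).const_add x
  have h2 := (hf (x + t • v)).hasFDerivAt.comp_hasDerivAt t h1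
  rwa [inner_gradient_left]

/-- The descent lemma. -/
theorem descent_lemma {f : E → ℝ} {L : ℝ} (hf : Differentiable ℝ f)
    (hL : ∀ y z, ‖gradient f y - gradient f z‖ ≤ L * ‖y - z‖) (x y : E) :
    f y ≤ f x + inner ℝ (gradient f x) (y - x) + L / 2 * ‖y - x‖ ^ 2 := by
  set v := y - x
  have hd : ∀ t : ℝ, HasDerivAt
      (fun s : ℝ => f (x + s • v) - s * inner ℝ (gradient f x) v - L / 2 * ‖v‖ ^ 2 * s ^ 2)
      (inner ℝ (gradient f (x + t • v)) v - inner ℝ (gradient f x) v - L * ‖v‖ ^ 2 * t) t := by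
    intro t
    have h := ((hasDerivAt_comp_segment hf x v t).sub
      ((hasDerivAt_id t).mul_const (inner ℝ (gradient f x) v))).sub
      ((hasDerivAt_pow 2 t).const_mul (L / 2 * ‖v‖ ^ 2))
    refine h.congr_deriv ?_
    simp
    ring
  have hanti : AntitoneOn
      (fun s : ℝ => f (x + s • v) - s * inner ℝ (gradient f x) v - L / 2 * ‖v‖ ^ 2 * s ^ 2)
      (Set.Icc 0 1) := by
    apply antitoneOn_of_deriv_nonpos (convex_Icc 0 1)
    · exact fun t _ => (hd t).continuousAt.continuousWithinAt
    · exact fun t _ => (hd t).differentiableAt.differentiableWithinAt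
    · intro t ht
      rw [interior_Icc] at ht
      rw [(hd t).deriv, ← inner_sub_left]
      have h1 := real_inner_le_norm (gradient f (x + t • v) - gradient f x) v
      have h2 := hL (x + t • v) x
      rw [add_sub_cancel_left, norm_smul, Real.norm_of_nonneg ht.1.le] at h2
      nlinarith [mul_le_mul_of_nonneg_right h2 (norm_nonneg v)]
  have h := hanti (Set.left_mem_Icc.2 zero_le_one) (Set.right_mem_Icc.2 zero_le_one) zero_le_one
  simp only [one_smul, zero_smul, add_zero] at h
  have hv : x + v = y := by simp [v]
  rw [hv] at h
  linarith

/-- The first-order characterization of convexity. -/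
theorem convex_gradient_ineq {f : E → ℝ} (hf : Differentiable ℝ f)
    (hc : ConvexOn ℝ Set.univ f) (x y : E) :
    f x + inner ℝ (gradient f x) (y - x) ≤ f y := by
  have hd := hasDerivAt_comp_segment hf x (y - x) 0
  have hconv : ConvexOn ℝ Set.univ (fun s : ℝ => f (x + s • (y - x))) := by
    have h := hc.comp_affineMap (AffineMap.lineMap x y : ℝ →ᵃ[ℝ] E)
    rw [Set.preimage_univ] at h
    refine h.congr ?_
    intro s _
    simp [AffineMap.lineMap_apply, add_comm]
  have h := hconv.le_slope_of_hasDerivAt (Set.mem_univ 0) (Set.mem_univ 1) zero_lt_one hd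
  rw [slope_def_field, zero_smul, add_zero, one_smul, sub_zero, div_one,
    add_sub_cancel] at h
  linarith

/-- A gradient step of length `1/L` lowers `f` by at least `‖∇f‖² / (2L)`, and it cannot go below
`c`. -/
theorem norm_gradient_sq_le {f : E → ℝ} {L c : ℝ} (hL0 : 0 < L) (hf : Differentiable ℝ f)
    (hL : ∀ y z, ‖gradient f y - gradient f z‖ ≤ L * ‖y - z‖) (hc : ∀ x, c ≤ f x) (x : E) :
    ‖gradient f x‖ ^ 2 ≤ 2 * L * (f x - c) := by
  have h := descent_lemma hf hL x (x - (1 / L) • gradient f x)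
  have h2 := hc (x - (1 / L) • gradient f x)
  have h3 : x - (1 / L) • gradient f x - x = -((1 / L) • gradient f x) := by abel
  rw [h3, inner_neg_right, inner_smul_right, real_inner_self_eq_norm_sq, norm_neg, norm_smul,
    Real.norm_of_nonneg (by positivity), mul_pow] at h
  have h4 : L / 2 * ((1 / L) ^ 2 * ‖gradient f x‖ ^ 2) = 1 / L * ‖gradient f x‖ ^ 2 / 2 := by
    field_simp
  have h5 : 1 / L * ‖gradient f x‖ ^ 2 ≤ 2 * (f x - c) := by linarith
  calc ‖gradient f x‖ ^ 2 = L * (1 / L * ‖gradient f x‖ ^ 2) := by field_simp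
    _ ≤ L * (2 * (f x - c)) := by gcongr
    _ = _ := by ring

end Calculus

/-- Compare the minimal value with the value at `t x + (1 - t) x⋆`, divide by `t`, and let `t` tend
to `0`. -/
theorem StrongConvexOn.quadratic_growth {E : Type*} [NormedAddCommGroup E]
    [InnerProductSpace ℝ E] {f : E → ℝ} {μ : ℝ}
    (hc : StrongConvexOn Set.univ μ f) {xs : E} (hmin : ∀ x, f xs ≤ f x) (x : E) :
    μ / 2 * ‖x - xs‖ ^ 2 ≤ f x - f xs := by
  have key : ∀ t : ℝ, 0 < t → t < 1 → (1 - t) * (μ / 2 * ‖x - xs‖ ^ 2) ≤ f x - f xs := by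
    intro t h0 h1
    have h := hc.2 (Set.mem_univ x) (Set.mem_univ xs) h0.le (sub_nonneg.2 h1.le) (by ring)
    have h2 := hmin (t • x + (1 - t) • xs)
    simp only [smul_eq_mul] at h
    have h3 : t * ((1 - t) * (μ / 2 * ‖x - xs‖ ^ 2)) ≤ t * (f x - f xs) := by nlinarith
    exact le_of_mul_le_mul_left h3 h0
  have hlim : Filter.Tendsto (fun t : ℝ => (1 - t) * (μ / 2 * ‖x - xs‖ ^ 2))
      (nhdsWithin 0 (Set.Ioi 0)) (nhds ((1 - 0) * (μ / 2 * ‖x - xs‖ ^ 2))) := by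
    apply Filter.Tendsto.mono_left _ nhdsWithin_le_nhds
    exact Continuous.tendsto (by fun_prop) 0
  rw [sub_zero, one_mul] at hlim
  refine le_of_tendsto hlim ?_
  filter_upwards [Ioo_mem_nhdsGT (zero_lt_one' ℝ)] with t ht using key t ht.1 ht.2

theorem norm_sum_sq_le {E : Type*} [NormedAddCommGroup E] [NormedSpace ℝ E]
    {ι : Type*} (s : Finset ι) (a : ι → E) :
    ‖∑ i ∈ s, a i‖ ^ 2 ≤ s.card * ∑ i ∈ s, ‖a i‖ ^ 2 :=
  (pow_le_pow_left₀ (norm_nonneg _) (norm_sum_le _ _) 2).trans (sq_sum_le_card_mul_sum_sq)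

/-! ### Regularity of the averaged cost -/

namespace Problem

variable {N m : ℕ} {p : Problem.{u} N m}

theorem hasGradientAt_cost {L : ℝ} (hp : p.Smooth L) (x : Vec m) :
    HasGradientAt p.cost (avg fun i => gradient (p.localCost i) x) x := by
  have h : HasFDerivAt (fun x => (1 / (N : ℝ)) * ∑ i, p.localCost i x)
      ((1 / (N : ℝ)) • ∑ i, fderiv ℝ (p.localCost i) x) x :=
    (HasFDerivAt.fun_sum fun i _ => ((hp i).1 x).hasFDerivAt).const_mul _
  rw [hasGradientAt_iff_hasFDerivAt]
  refine h.congr_fderiv ?_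
  rw [avg.eq_def, map_smul, map_sum]
  simp_rw [toDual_gradient]

theorem gradient_cost {L : ℝ} (hp : p.Smooth L) (x : Vec m) :
    gradient p.cost x = avg fun i => gradient (p.localCost i) x :=
  (hasGradientAt_cost hp x).gradient

theorem differentiable_cost {L : ℝ} (hp : p.Smooth L) : Differentiable ℝ p.cost :=
  fun x => (hasGradientAt_cost hp x).differentiableAt

theorem lipschitz_gradient_cost {L : ℝ} (hN : 0 < N) (hp : p.Smooth L) (y z : Vec m) :
    ‖gradient p.cost y - gradient p.cost z‖ ≤ L * ‖y - z‖ := by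
  have hN' : (0 : ℝ) < N := by exact_mod_cast hN
  rw [gradient_cost hp, gradient_cost hp, avg.eq_def, avg.eq_def, ← smul_sub, ← Finset.sum_sub_distrib, norm_smul,
    Real.norm_of_nonneg (by positivity)]
  calc 1 / (N : ℝ) * ‖∑ i, (gradient (p.localCost i) y - gradient (p.localCost i) z)‖
      ≤ 1 / (N : ℝ) * ∑ _i : Fin N, L * ‖y - z‖ := by
        gcongr
        exact norm_sum_le_of_le _ fun i _ => (hp i).2 y z
    _ = L * ‖y - z‖ := by
        rw [Finset.sum_const, Finset.card_univ, Fintype.card_fin, nsmul_eq_mul]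
        field_simp

theorem strongConvexOn_cost {μ : ℝ} (hN : 0 < N)
    (hc : ∀ i, StrongConvexOn Set.univ μ (p.localCost i)) : StrongConvexOn Set.univ μ p.cost := by
  have hN' : (0 : ℝ) < N := by exact_mod_cast hN
  refine ⟨convex_univ, fun x _ y _ a b ha hb hab => ?_⟩
  have h : ∑ i, p.localCost i (a • x + b • y) ≤ ∑ i, (a • p.localCost i x + b • p.localCost i y -
      a * b * (μ / 2 * ‖x - y‖ ^ 2)) :=
    Finset.sum_le_sum fun i _ => (hc i).2 (Set.mem_univ x) (Set.mem_univ y) ha hb hab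
  rw [Finset.sum_sub_distrib, Finset.sum_add_distrib, ← Finset.smul_sum, ← Finset.smul_sum,
    Finset.sum_const, Finset.card_univ, Fintype.card_fin, nsmul_eq_mul] at h
  have h2 := mul_le_mul_of_nonneg_left h (show (0 : ℝ) ≤ 1 / N by positivity)
  simp only [cost, smul_eq_mul] at h2 ⊢
  refine h2.trans (le_of_eq ?_)
  field_simp

theorem convexOn_localCost {μ : ℝ} (hμ : 0 < μ)
    (hc : ∀ i, StrongConvexOn Set.univ μ (p.localCost i)) (i : Fin N) :
    ConvexOn ℝ Set.univ (p.localCost i) :=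
  strongConvexOn_zero.1 ((hc i).mono hμ.le)

end Problem

/-! ### Spectral gap of the weight matrix -/

section Spectral

variable {N : ℕ}

/-- For a symmetric doubly stochastic matrix, the Dirichlet form controls the spectral gap. -/
theorem sum_mul_sq_sub_eq {A : Matrix (Fin N) (Fin N) ℝ} (hA : A ∈ doublyStochastic ℝ (Fin N))
    {c : ℝ} {x : Fin N → ℝ} (hx : A.mulVec x = c • x) :
    ∑ i, ∑ j, A i j * (x i - x j) ^ 2 = 2 * (1 - c) * ∑ i, x i ^ 2 := by
  have h1 : ∑ i, ∑ j, A i j * x i ^ 2 = ∑ i, x i ^ 2 := by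
    simp_rw [← Finset.sum_mul, sum_row_of_mem_doublyStochastic hA, one_mul]
  have h2 : ∑ i, ∑ j, A i j * x j ^ 2 = ∑ i, x i ^ 2 := by
    rw [Finset.sum_comm]
    simp_rw [← Finset.sum_mul, sum_col_of_mem_doublyStochastic hA, one_mul]
  have h3 : ∑ i, ∑ j, A i j * (x i * x j) = c * ∑ i, x i ^ 2 := by
    rw [Finset.mul_sum]
    refine Finset.sum_congr rfl fun i _ => ?_
    have h := congrFun hx i
    simp only [Matrix.mulVec, dotProduct, Pi.smul_apply, smul_eq_mul] at h
    calc ∑ j, A i j * (x i * x j) = x i * ∑ j, A i j * x j := by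
          rw [Finset.mul_sum]
          exact Finset.sum_congr rfl fun j _ => by ring
      _ = c * x i ^ 2 := by rw [h]; ring
  calc ∑ i, ∑ j, A i j * (x i - x j) ^ 2
      = ∑ i, ∑ j, A i j * x i ^ 2 + ∑ i, ∑ j, A i j * x j ^ 2
          - 2 * ∑ i, ∑ j, A i j * (x i * x j) := by
        rw [Finset.mul_sum, ← Finset.sum_add_distrib, ← Finset.sum_sub_distrib]
        refine Finset.sum_congr rfl fun i _ => ?_
        rw [Finset.mul_sum, ← Finset.sum_add_distrib, ← Finset.sum_sub_distrib]
        exact Finset.sum_congr rfl fun j _ => by ring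
    _ = _ := by rw [h1, h2, h3]; ring

theorem pow_mulVec_eq {A : Matrix (Fin N) (Fin N) ℝ} {c : ℝ} {x : Fin N → ℝ}
    (hx : A.mulVec x = c • x) (n : ℕ) : (A ^ n).mulVec x = c ^ n • x := by
  induction n with
  | zero => simp
  | succ n ih => rw [pow_succ, ← Matrix.mulVec_mulVec, hx, Matrix.mulVec_smul, ih, smul_smul,
      pow_succ']

/-- Perron–Frobenius for primitive doubly stochastic matrices: an eigenvector
is constant, or its eigenvalue is less than one and its entries sum to zero. -/
theorem WeightAssumption.eigenvector_cases {W : Matrix (Fin N) (Fin N) ℝ}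
    (hW : WeightAssumption W) {c : ℝ} {x : Fin N → ℝ}
    (hx : W.mulVec x = c • x) :
    (∀ i j, x i = x j) ∨ (c < 1 ∧ ∑ i, x i = 0) := by
  by_cases hconst : ∀ i j, x i = x j
  · exact Or.inl hconst
  refine Or.inr ?_
  push Not at hconst
  obtain ⟨i₀, j₀, hij⟩ := hconst
  obtain ⟨n, hn, hpos⟩ := hW.primitive.2
  have hds : W ^ n ∈ _root_.doublyStochastic ℝ (Fin N) := pow_mem hW.doublyStochastic n
  have h := sum_mul_sq_sub_eq hds (pow_mulVec_eq hx n)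
  have hlt : 0 < ∑ i, ∑ j, (W ^ n) i j * (x i - x j) ^ 2 := by
    refine Finset.sum_pos' (fun i _ => Finset.sum_nonneg fun j _ =>
      mul_nonneg (hpos i j).le (sq_nonneg _)) ⟨i₀, Finset.mem_univ _, ?_⟩
    refine Finset.sum_pos' (fun j _ => mul_nonneg (hpos _ j).le (sq_nonneg _))
      ⟨j₀, Finset.mem_univ _, ?_⟩
    exact mul_pos (hpos _ _) (sq_pos_of_ne_zero (sub_ne_zero.2 hij))
  -- The positive power of `W` gives the nonconstant `x` a strictly positive Dirichlet form, which
  -- equals `2 (1 - cⁿ) ‖x‖²`.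
  have hc1 : c < 1 := by
    by_contra hge
    have h1 : 1 ≤ c ^ n := one_le_pow₀ (not_lt.1 hge)
    have h2 : 0 ≤ ∑ i, x i ^ 2 := Finset.sum_nonneg fun i _ => sq_nonneg _
    rw [h] at hlt
    nlinarith
  refine ⟨hc1, ?_⟩
  -- Column sums equal to one give `∑ x = c ∑ x`, and `c ≠ 1`.
  have h1 : ∑ i, (W.mulVec x) i = ∑ i, x i :=
    sum_mulVec_of_mem_doublyStochastic hW.doublyStochastic
  rw [hx] at h1
  simp only [Pi.smul_apply, smul_eq_mul, ← Finset.mul_sum] at h1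
  have h2 : (c - 1) * ∑ i, x i = 0 := by linarith
  rcases mul_eq_zero.1 h2 with h3 | h3
  · linarith
  · exact h3

/-- An orthonormal eigenbasis `b` of `W` with nonnegative eigenvalues `w`; each basis vector is
either constant or orthogonal to the constants with an eigenvalue at most `l`. -/
structure ModalBasis (W : Matrix (Fin N) (Fin N) ℝ) (l : ℝ) (b : Fin N → Fin N → ℝ)
    (w : Fin N → ℝ) : Prop where
  orthonormal : ∀ i j, ∑ k, b k i * b k j = if i = j then 1 else 0
  eigen : ∀ k j, ∑ i, b k i * W i j = w k * b k j
  nonneg : ∀ k, 0 ≤ w k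
  cases : ∀ k, (∀ i j, b k i = b k j) ∨ (w k ≤ l ∧ ∑ i, b k i = 0)

theorem averaging_mulVec (x : Fin N → ℝ) (i : Fin N) :
    (((1 / (N : ℝ)) • Matrix.of (fun _ _ : Fin N => (1 : ℝ))).mulVec x) i
      = 1 / (N : ℝ) * ∑ j, x j := by
  simp [Matrix.mulVec, dotProduct, Finset.mul_sum]

theorem WeightAssumption.exists_modalBasis {W : Matrix (Fin N) (Fin N) ℝ} (hN : 0 < N)
    (hW : WeightAssumption W) :
    mixingRate W < 1 ∧ ∃ b w, ModalBasis W (mixingRate W) b w := by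
  have hN' : (N : ℝ) ≠ 0 := by positivity
  have hH : W.IsHermitian := hW.posDef.isHermitian
  set v := hH.eigenvectorBasis
  set w := hH.eigenvalues
  have hv : ∀ k, W.mulVec (v k) = w k • (v k : Fin N → ℝ) := hH.mulVec_eigenvectorBasis
  have hw : ∀ k, 0 ≤ w k := fun k => (hW.posDef.eigenvalues_pos k).le
  have hcases := fun k => hW.eigenvector_cases (hv k)
  set T := Matrix.toEuclideanCLM (𝕜 := ℝ)
    (W - (1 / (N : ℝ)) • Matrix.of (fun _ _ : Fin N => (1 : ℝ))) with hT
  have hTv : ∀ k, T (v k) = if ∀ i j, v k i = v k j then 0 else w k • v k := by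
    intro k
    ext i
    rw [hT, Matrix.ofLp_toEuclideanCLM, Matrix.sub_mulVec, hv, Pi.sub_apply, averaging_mulVec]
    split_ifs with h
    · have h1 : ∀ j, v k j = v k i := fun j => h j i
      have h2 := congrFun (hv k) i
      simp only [Matrix.mulVec, dotProduct, h1, ← Finset.sum_mul,
        sum_row_of_mem_doublyStochastic hW.doublyStochastic, one_mul] at h2
      rw [← h2]
      simp [h1, hN']
    · rw [((hcases k).resolve_left h).2]
      simp
  have hWsymm : ∀ i j, W i j = W j i := fun i j => hW.symm.apply j i
  have hTsymm : ∀ x y, inner ℝ x (T y) = inner ℝ (T x) y := by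
    intro x y
    rw [hT, Matrix.inner_toEuclideanCLM, real_inner_comm, Matrix.inner_toEuclideanCLM]
    simp only [dotProduct, Matrix.mulVec, Finset.mul_sum]
    rw [Finset.sum_comm]
    refine Finset.sum_congr rfl fun i _ => Finset.sum_congr rfl fun j _ => ?_
    simp [hWsymm i j]
    ring
  -- `ρ` is the largest eigenvalue with a nonconstant eigenvector in the basis, or `0` when there is
  -- none, as for `N = 1`.
  obtain ⟨ρ, hρ0, hρ1, hρ⟩ : ∃ ρ : ℝ, 0 ≤ ρ ∧ ρ < 1 ∧
      ∀ k, (¬ ∀ i j, v k i = v k j) → w k ≤ ρ := by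
    by_cases hne : (Finset.univ.filter fun k => ¬ ∀ i j, v k i = v k j).Nonempty
    · obtain ⟨k, hk, hmax⟩ := Finset.exists_max_image _ w hne
      refine ⟨w k, hw k, ((hcases k).resolve_left (Finset.mem_filter.1 hk).2).1, ?_⟩
      exact fun j hj => hmax j (Finset.mem_filter.2 ⟨Finset.mem_univ _, hj⟩)
    · rw [Finset.not_nonempty_iff_eq_empty, Finset.filter_eq_empty_iff] at hne
      exact ⟨0, le_rfl, zero_lt_one, fun k hk => absurd hk (hne (Finset.mem_univ k))⟩
  have hnorm : ‖T‖ ≤ ρ := by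
    -- Compare coefficients in the eigenbasis: as `T` is symmetric, it multiplies each coefficient
    -- by `0` or by some `w k ≤ ρ`.
    refine T.opNorm_le_bound hρ0 fun x => ?_
    rw [← abs_of_nonneg (norm_nonneg (T x)), ← abs_of_nonneg (mul_nonneg hρ0 (norm_nonneg x)),
      ← sq_le_sq, mul_pow, ← v.sum_sq_norm_inner_right (T x), ← v.sum_sq_norm_inner_right x,
      Finset.mul_sum]
    refine Finset.sum_le_sum fun k _ => ?_
    rw [hTsymm, hTv]
    split_ifs with h
    · simp
      positivity
    · rw [inner_smul_left, norm_mul, mul_pow]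
      refine mul_le_mul_of_nonneg_right ?_ (sq_nonneg _)
      simpa using pow_le_pow_left₀ (hw k) (hρ k h) 2
  refine ⟨hnorm.trans_lt hρ1, fun k i => v k i, w, ⟨?_, ?_, hw, ?_⟩⟩
  · intro i j
    -- The relation to prove sums over the index of the basis vector, so it is Parseval's identity
    -- for two coordinate vectors.
    have h := v.sum_inner_mul_inner (EuclideanSpace.single i (1 : ℝ)) (EuclideanSpace.single j 1)
    simpa [EuclideanSpace.inner_single_left, EuclideanSpace.inner_single_right, Pi.single_apply,
      eq_comm] using h
  · intro k j
    have h := congrFun (hv k) j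
    simp only [Matrix.mulVec, dotProduct, Pi.smul_apply, smul_eq_mul] at h
    rw [← h]
    exact Finset.sum_congr rfl fun i _ => by rw [hWsymm i j, mul_comm]
  · intro k
    by_cases h : ∀ i j, v k i = v k j
    · exact Or.inl h
    refine Or.inr ⟨?_, ((hcases k).resolve_left h).2⟩
    -- Conversely, a nonconstant unit eigenvector of `W` is one of `T` with the same eigenvalue, so
    -- this eigenvalue is at most the mixing rate.
    have h1 := T.le_opNorm (v k)
    rw [hTv, if_neg h, norm_smul, v.orthonormal.1, mul_one, mul_one,
      Real.norm_of_nonneg (hw k)] at h1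
    exact h1

end Spectral

/-! ### Contraction of a single mode, and modal decomposition of vector families -/

section Hilbert

variable {ℋ : Type*} [NormedAddCommGroup ℋ] [InnerProductSpace ℝ ℋ] {N : ℕ}

theorem norm_add_sq_le_two (a b : ℋ) : ‖a + b‖ ^ 2 ≤ 2 * ‖a‖ ^ 2 + 2 * ‖b‖ ^ 2 := by
  have h := parallelogram_law_with_norm ℝ a b
  nlinarith [norm_nonneg (a - b)]

theorem norm_sub_sq_le_two (a b : ℋ) : ‖a - b‖ ^ 2 ≤ 2 * ‖a‖ ^ 2 + 2 * ‖b‖ ^ 2 := by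
  simpa [sub_eq_add_neg] using norm_add_sq_le_two a (-b)

/-- Young's inequality for a perturbation `b` and a noise `s` orthogonal to `a`. -/
theorem norm_add_add_sq_le {a b s : ℋ} (h : inner ℝ a s = 0) {η : ℝ} (hη : 0 < η) :
    ‖a + b + s‖ ^ 2 ≤ (1 + η) * ‖a‖ ^ 2 + (2 + 1 / η) * ‖b‖ ^ 2 + 2 * ‖s‖ ^ 2 := by
  have h1 : ‖a + b + s‖ ^ 2 =
      ‖a‖ ^ 2 + ‖b‖ ^ 2 + ‖s‖ ^ 2 + 2 * inner ℝ a b + 2 * inner ℝ b s := by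
    rw [norm_add_sq_real, norm_add_sq_real, inner_add_left, h]
    ring
  have h2 : 2 * inner ℝ b s ≤ ‖b‖ ^ 2 + ‖s‖ ^ 2 := by
    have := real_inner_le_norm b s
    nlinarith [sq_nonneg (‖b‖ - ‖s‖)]
  have h3 : 2 * inner ℝ a b ≤ η * ‖a‖ ^ 2 + 1 / η * ‖b‖ ^ 2 := by
    have h4 := real_inner_le_norm a b
    have h5 : η * ‖a‖ ^ 2 + 1 / η * ‖b‖ ^ 2 - 2 * (‖a‖ * ‖b‖) = 1 / η * (η * ‖a‖ - ‖b‖) ^ 2 := by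
      field_simp
      ring
    have h6 : 0 ≤ 1 / η * (η * ‖a‖ - ‖b‖) ^ 2 := by positivity
    linarith
  rw [h1]
  linarith

/-- The weight of the dual error in the Lyapunov function of a mode with eigenvalue `w`. -/
noncomputable def dualWeight (w : ℝ) : ℝ := (1 + 3 * w) / (4 * (1 - w))

/-- The value `w / (1 - w)` would cancel the cross term in `mode_contraction` but would lose control
of the dual error at `w = 0`. Since `(1 + 3w)/4 = w + (1 - w)/4`, the weight used here exceeds it by
exactly `1/4`. -/
theorem dualWeight_mul {w : ℝ} (h : w < 1) : dualWeight w * (1 - w) = (1 + 3 * w) / 4 := by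
  have : 1 - w ≠ 0 := by linarith
  unfold dualWeight
  field_simp

theorem quarter_le_dualWeight {w : ℝ} (h0 : 0 ≤ w) (h : w < 1) : 1 / 4 ≤ dualWeight w := by
  have h1 : 0 < 1 - w := by linarith
  unfold dualWeight
  rw [div_le_div_iff₀ (by norm_num) (by linarith)]
  nlinarith

theorem dualWeight_le {w d : ℝ} (hd : 0 < d) (h : w ≤ 1 - d) : dualWeight w ≤ 1 / d := by
  unfold dualWeight
  rw [div_le_div_iff₀ (by linarith) hd]
  nlinarith

/-- The linear part of the primal-dual recursion contracts the Lyapunov function of a mode. -/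
theorem mode_contraction {w : ℝ} (h0 : 0 ≤ w) (h : w < 1) (e z : ℋ) :
    ‖w • (e - z)‖ ^ 2 + dualWeight w * ‖w • z + (1 - w) • e‖ ^ 2
      ≤ (1 + w) / 2 * (‖e‖ ^ 2 + dualWeight w * ‖z‖ ^ 2) := by
  have hq := dualWeight_mul h
  set q := dualWeight w
  rw [norm_smul, mul_pow, Real.norm_of_nonneg h0, norm_sub_sq_real, norm_add_sq_real, norm_smul,
    norm_smul, inner_smul_left, inner_smul_right, Real.norm_of_nonneg h0,
    Real.norm_of_nonneg (by linarith : 0 ≤ 1 - w), real_inner_comm e z]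
  simp only [conj_trivial]
  have hc : inner ℝ e z ≤ (‖e‖ ^ 2 + ‖z‖ ^ 2) / 2 := by
    have := real_inner_le_norm e z
    nlinarith [sq_nonneg (‖e‖ - ‖z‖)]
  set c : ℝ := inner ℝ e z
  set E := ‖e‖ ^ 2 with hE
  set Z := ‖z‖ ^ 2 with hZ
  have hE0 : 0 ≤ E := sq_nonneg _
  have hZ0 : 0 ≤ Z := sq_nonneg _
  have key : w ^ 2 * (E - 2 * c + Z) + q * ((w * ‖z‖) ^ 2 + 2 * (w * ((1 - w) * c)) +
      ((1 - w) * ‖e‖) ^ 2) = w ^ 2 * (E + Z) + q * w ^ 2 * Z + (q * (1 - w)) * (1 - w) * E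
        + 2 * w * ((q * (1 - w)) - w) * c := by
    rw [mul_pow, mul_pow, ← hE, ← hZ]
    ring
  rw [key, hq]
  -- What remains of the cross term is nonnegative, so only an upper bound for `⟨e, z⟩` is needed.
  have hcoef : 2 * w * ((1 + 3 * w) / 4 - w) = w * (1 - w) / 2 := by ring
  rw [hcoef]
  have h1 : w * (1 - w) / 2 * c ≤ w * (1 - w) / 2 * ((E + Z) / 2) := by
    apply mul_le_mul_of_nonneg_left hc
    nlinarith
  have hZc : w ^ 2 + q * w ^ 2 + w * (1 - w) / 4 ≤ (1 + w) / 2 * q := by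
    have h2 : ((1 + w) / 2 * q - (w ^ 2 + q * w ^ 2 + w * (1 - w) / 4)) * (1 - w)
        = (1 - w) * (1 + 3 * w) / 8 := by
      have : ((1 + w) / 2 * q - (w ^ 2 + q * w ^ 2 + w * (1 - w) / 4)) * (1 - w)
        = (1 + w) / 2 * (q * (1 - w)) - (w ^ 2 * (1 - w) + (q * (1 - w)) * w ^ 2
          + w * (1 - w) / 4 * (1 - w)) := by ring
      rw [this, hq]
      ring
    have h3 : 0 ≤ (1 - w) * (1 + 3 * w) / 8 := by
      have := mul_nonneg (sub_nonneg.2 h.le) (by linarith : 0 ≤ 1 + 3 * w)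
      linarith
    rw [← h2] at h3
    have := nonneg_of_mul_nonneg_left h3 (by linarith)
    linarith
  have h4 := mul_le_mul_of_nonneg_right hZc hZ0
  have hEc : w ^ 2 + (1 + 3 * w) / 4 * (1 - w) + w * (1 - w) / 4 ≤ (1 + w) / 2 := by nlinarith
  have h5 := mul_le_mul_of_nonneg_right hEc hE0
  linarith

/-- One round of the primal-dual recursion of a mode, with drift `G`, noise `S` and dual
perturbation `δ`. -/
theorem mode_step {w d α : ℝ} (h0 : 0 ≤ w) (hd : 0 < d) (hw : w ≤ 1 - d) {e z G S δ : ℋ}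
    (he : inner ℝ e S = 0) (hz : inner ℝ z S = 0) :
    ‖w • (e - z - α • (G + S))‖ ^ 2
        + dualWeight w * ‖w • z + (1 - w) • e - (α * (1 - w)) • (G + S) + δ‖ ^ 2
      ≤ (1 - d / 4) * (‖e‖ ^ 2 + dualWeight w * ‖z‖ ^ 2)
        + 12 / d * (α ^ 2 * ‖G‖ ^ 2 + ‖δ‖ ^ 2 / d) + 2 * α ^ 2 * ‖S‖ ^ 2 := by
  have hw1 : w < 1 := by linarith
  have hd1 : d ≤ 1 := by linarith
  have hq0 : 0 ≤ dualWeight w := by linarith [quarter_le_dualWeight h0 hw1]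
  have hqd := dualWeight_le hd hw
  have hq := dualWeight_mul hw1
  have hc := mode_contraction h0 hw1 e z
  set q := dualWeight w
  have e1 : w • (e - z - α • (G + S)) = w • (e - z) + (-(α * w)) • G + (-(α * w)) • S := by
    module
  have e2 : w • z + (1 - w) • e - (α * (1 - w)) • (G + S) + δ
      = (w • z + (1 - w) • e) + ((-(α * (1 - w))) • G + δ) + (-(α * (1 - w))) • S := by module
  -- The noise is orthogonal to the state at the start of the round but not to the drift, which
  -- reacts to it within the round. The choice `η = d/4` uses up half of the available gap `d/2`,
  -- because `(1 + d/4)(1 - d/2) ≤ 1 - d/4`.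
  have b1 := norm_add_add_sq_le (a := w • (e - z)) (b := (-(α * w)) • G) (s := (-(α * w)) • S)
    (by rw [inner_smul_left, inner_smul_right, inner_sub_left, he, hz]; simp)
    (show 0 < d / 4 by linarith)
  have b2 := norm_add_add_sq_le (a := w • z + (1 - w) • e) (b := (-(α * (1 - w))) • G + δ)
    (s := (-(α * (1 - w))) • S)
    (by rw [inner_smul_right, inner_add_left, inner_smul_left, inner_smul_left, he, hz]; simp)
    (show 0 < d / 4 by linarith)
  rw [e1, e2]
  have b3 := norm_add_sq_le_two ((-(α * (1 - w))) • G) δ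
  have hns : ∀ (c : ℝ) (v : ℋ), ‖c • v‖ ^ 2 = c ^ 2 * ‖v‖ ^ 2 := fun c v => by
    rw [norm_smul, mul_pow, Real.norm_eq_abs, sq_abs]
  rw [hns (-(α * w)), hns (-(α * w))] at b1
  rw [hns (-(α * (1 - w)))] at b2 b3
  set A1 := ‖w • (e - z)‖ ^ 2
  set A2 := ‖w • z + (1 - w) • e‖ ^ 2
  set B2 := ‖(-(α * (1 - w))) • G + δ‖ ^ 2
  set V := ‖e‖ ^ 2 + q * ‖z‖ ^ 2 with hV
  have hV0 : 0 ≤ V := by positivity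
  have hη : 2 + 1 / (d / 4) ≤ 6 / d := by
    have : 6 / d - (2 + 1 / (d / 4)) = 2 * (1 - d) / d := by field_simp; ring
    have : 0 ≤ 2 * (1 - d) / d := div_nonneg (by linarith) hd.le
    linarith
  -- The factor `1 - w` in front of `G` compensates the size `1/(1 - w)` of the dual weight; only
  -- `δ`, which has no such factor, pays an extra `1/d`.
  have hBsum : (-(α * w)) ^ 2 * ‖G‖ ^ 2 + q * B2 ≤ 2 * (α ^ 2 * ‖G‖ ^ 2 + ‖δ‖ ^ 2 / d) := by
    have h1 : q * B2 ≤ q * (2 * ((-(α * (1 - w))) ^ 2 * ‖G‖ ^ 2) + 2 * ‖δ‖ ^ 2) :=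
      mul_le_mul_of_nonneg_left b3 hq0
    have h2 : q * ‖δ‖ ^ 2 ≤ 1 / d * ‖δ‖ ^ 2 := mul_le_mul_of_nonneg_right hqd (sq_nonneg _)
    have h3 : q * (2 * ((-(α * (1 - w))) ^ 2 * ‖G‖ ^ 2) + 2 * ‖δ‖ ^ 2) =
      2 * (q * (1 - w)) * (1 - w) * (α ^ 2 * ‖G‖ ^ 2) + 2 * (q * ‖δ‖ ^ 2) := by ring
    have h4 : (w ^ 2 + 2 * ((1 + 3 * w) / 4) * (1 - w)) * (α ^ 2 * ‖G‖ ^ 2)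
        ≤ 2 * (α ^ 2 * ‖G‖ ^ 2) := by
      apply mul_le_mul_of_nonneg_right _ (by positivity)
      nlinarith only [h0, hw1]
    have h5 : 1 / d * ‖δ‖ ^ 2 = ‖δ‖ ^ 2 / d := by ring
    have h6 : (-(α * w)) ^ 2 * ‖G‖ ^ 2 = w ^ 2 * (α ^ 2 * ‖G‖ ^ 2) := by ring
    rw [h3, hq] at h1
    linarith
  -- For the same reason the noise enters without any power of `1/d`.
  have hSsum : (-(α * w)) ^ 2 * ‖S‖ ^ 2 + q * ((-(α * (1 - w))) ^ 2 * ‖S‖ ^ 2)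
      ≤ α ^ 2 * ‖S‖ ^ 2 := by
    have h3 : (-(α * w)) ^ 2 * ‖S‖ ^ 2 + q * ((-(α * (1 - w))) ^ 2 * ‖S‖ ^ 2) =
      (w ^ 2 + (q * (1 - w)) * (1 - w)) * (α ^ 2 * ‖S‖ ^ 2) := by ring
    rw [h3, hq]
    have h4 : w ^ 2 + (1 + 3 * w) / 4 * (1 - w) ≤ 1 := by nlinarith only [h0, hw1]
    simpa using mul_le_mul_of_nonneg_right h4 (by positivity : 0 ≤ α ^ 2 * ‖S‖ ^ 2)
  have hAsum : (1 + d / 4) * (A1 + q * A2) ≤ (1 - d / 4) * V := by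
    have h1 : (1 + d / 4) * (A1 + q * A2) ≤ (1 + d / 4) * ((1 + w) / 2 * V) :=
      mul_le_mul_of_nonneg_left hc (by linarith)
    have h2 : (1 + d / 4) * ((1 + w) / 2) ≤ 1 - d / 4 := by nlinarith only [hd, hw, h0]
    have h3 := mul_le_mul_of_nonneg_right h2 hV0
    linarith
  have hBs0 : 0 ≤ (-(α * w)) ^ 2 * ‖G‖ ^ 2 + q * B2 := by positivity
  have hBfin : (2 + 1 / (d / 4)) * ((-(α * w)) ^ 2 * ‖G‖ ^ 2 + q * B2)
      ≤ 6 / d * (2 * (α ^ 2 * ‖G‖ ^ 2 + ‖δ‖ ^ 2 / d)) :=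
    mul_le_mul hη hBsum hBs0 (by positivity)
  have hb2q := mul_le_mul_of_nonneg_left b2 hq0
  have h12 : 6 / d * (2 * (α ^ 2 * ‖G‖ ^ 2 + ‖δ‖ ^ 2 / d))
      = 12 / d * (α ^ 2 * ‖G‖ ^ 2 + ‖δ‖ ^ 2 / d) := by ring
  rw [h12] at hBfin
  linarith

/-- Pythagoras: the number of terms enters once, whereas it would enter twice without orthogonality.
This is the source of the gains `1/N` and `1/τ` in the variance. -/
theorem norm_sum_sq_le_of_orthogonal {ι : Type*} {s : Finset ι} {a : ι → ℋ} {c : ℝ}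
    (horth : ∀ i ∈ s, ∀ j ∈ s, i ≠ j → inner ℝ (a i) (a j) = 0) (hc : ∀ i ∈ s, ‖a i‖ ^ 2 ≤ c) :
    ‖∑ i ∈ s, a i‖ ^ 2 ≤ s.card * c := by
  rw [← real_inner_self_eq_norm_sq, sum_inner]
  calc ∑ i ∈ s, inner ℝ (a i) (∑ j ∈ s, a j) = ∑ i ∈ s, ‖a i‖ ^ 2 := by
        refine Finset.sum_congr rfl fun i hi => ?_
        rw [inner_sum, Finset.sum_eq_single_of_mem i hi fun j hj hji => horth i hi j hj hji.symm,
          real_inner_self_eq_norm_sq]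
    _ ≤ ∑ _i ∈ s, c := Finset.sum_le_sum hc
    _ = s.card * c := by rw [Finset.sum_const, nsmul_eq_mul]

/-- The average of a finite family. -/
noncomputable def mean (a : Fin N → ℋ) : ℋ := (1 / (N : ℝ)) • ∑ i, a i

theorem sum_eq_smul_mean (hN : 0 < N) (a : Fin N → ℋ) : ∑ i, a i = (N : ℝ) • mean a := by
  have : (N : ℝ) ≠ 0 := by positivity
  rw [mean, smul_smul, mul_one_div_cancel this, one_smul]

theorem norm_mean_sq_le (a : Fin N → ℋ) : ‖mean a‖ ^ 2 ≤ 1 / (N : ℝ) * ∑ i, ‖a i‖ ^ 2 := by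
  rcases Nat.eq_zero_or_pos N with rfl | hN
  · simp [mean]
  have hN' : (0 : ℝ) < N := by exact_mod_cast hN
  have h := norm_sum_sq_le Finset.univ a
  rw [Finset.card_univ, Fintype.card_fin] at h
  rw [mean, norm_smul, Real.norm_of_nonneg (by positivity), mul_pow]
  calc (1 / (N : ℝ)) ^ 2 * ‖∑ i, a i‖ ^ 2 ≤ (1 / (N : ℝ)) ^ 2 * (N * ∑ i, ‖a i‖ ^ 2) := by gcongr
    _ = _ := by field_simp

theorem sum_sub_mean (hN : 0 < N) (a : Fin N → ℋ) : ∑ i, (a i - mean a) = 0 := by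
  rw [Finset.sum_sub_distrib, Finset.sum_const, Finset.card_univ, Fintype.card_fin,
    ← Nat.cast_smul_eq_nsmul ℝ, sum_eq_smul_mean hN, sub_self]

/-- The coefficients of a vector-valued family in a real basis. -/
noncomputable def modal (b : Fin N → Fin N → ℝ) (a : Fin N → ℋ) (k : Fin N) : ℋ :=
  ∑ i, b k i • a i

theorem modal_add (b : Fin N → Fin N → ℝ) (a c : Fin N → ℋ) (k : Fin N) :
    modal b (fun i => a i + c i) k = modal b a k + modal b c k := by
  simp [modal, Finset.sum_add_distrib]

theorem modal_sub (b : Fin N → Fin N → ℝ) (a c : Fin N → ℋ) (k : Fin N) :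
    modal b (fun i => a i - c i) k = modal b a k - modal b c k := by
  simp [modal, smul_sub, Finset.sum_sub_distrib]

theorem modal_smul (b : Fin N → Fin N → ℝ) (c : ℝ) (a : Fin N → ℋ) (k : Fin N) :
    modal b (fun i => c • a i) k = c • modal b a k := by
  simp [modal, Finset.smul_sum, smul_comm c]

theorem modal_const {b : Fin N → Fin N → ℝ} {k : Fin N} (hk : ∑ i, b k i = 0) (c : ℋ) :
    modal b (fun _ => c) k = 0 := by
  simp [modal, ← Finset.sum_smul, hk]

/-- The modes that are orthogonal to the consensus direction. -/
noncomputable def disagreementModes (l : ℝ) (b : Fin N → Fin N → ℝ) (w : Fin N → ℝ) :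
    Finset (Fin N) :=
  by classical exact Finset.univ.filter fun k => w k ≤ l ∧ ∑ i, b k i = 0

theorem mem_disagreementModes {l : ℝ} {b : Fin N → Fin N → ℝ} {w : Fin N → ℝ} {k : Fin N} :
    k ∈ disagreementModes l b w ↔ w k ≤ l ∧ ∑ i, b k i = 0 := by
  simp [disagreementModes]

namespace ModalBasis

variable {W : Matrix (Fin N) (Fin N) ℝ} {l : ℝ} {b : Fin N → Fin N → ℝ} {w : Fin N → ℝ}

theorem parseval (hb : ModalBasis W l b w) (a : Fin N → ℋ) :
    ∑ k, ‖modal b a k‖ ^ 2 = ∑ i, ‖a i‖ ^ 2 := by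
  have h1 : ∀ k, ‖modal b a k‖ ^ 2 = ∑ i, ∑ j, (b k i * b k j) * inner ℝ (a i) (a j) := by
    intro k
    rw [← real_inner_self_eq_norm_sq, modal, sum_inner]
    refine Finset.sum_congr rfl fun i _ => ?_
    rw [inner_sum]
    refine Finset.sum_congr rfl fun j _ => ?_
    rw [inner_smul_left, inner_smul_right, conj_trivial]
    ring
  simp_rw [h1]
  rw [Finset.sum_comm]
  refine Finset.sum_congr rfl fun i _ => ?_
  rw [Finset.sum_comm]
  simp_rw [← Finset.sum_mul, hb.orthonormal]
  simp

theorem sum_disagreement_le (hb : ModalBasis W l b w) (a : Fin N → ℋ) :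
    ∑ k ∈ disagreementModes l b w, ‖modal b a k‖ ^ 2 ≤ ∑ i, ‖a i‖ ^ 2 := by
  rw [← hb.parseval]
  exact Finset.sum_le_sum_of_subset_of_nonneg (Finset.subset_univ _) fun _ _ _ => sq_nonneg _

theorem sum_disagreement_eq (hb : ModalBasis W l b w) {a : Fin N → ℋ} (ha : ∑ i, a i = 0) :
    ∑ k ∈ disagreementModes l b w, ‖modal b a k‖ ^ 2 = ∑ i, ‖a i‖ ^ 2 := by
  rw [← hb.parseval]
  refine Finset.sum_subset (Finset.subset_univ _) fun k _ hk => ?_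
  rw [mem_disagreementModes] at hk
  have hconst := (hb.cases k).resolve_right hk
  have h1 : modal b a k = b k k • ∑ i, a i := by
    rw [modal, Finset.smul_sum]
    exact Finset.sum_congr rfl fun i _ => by rw [hconst i k]
  simp [h1, ha]

theorem modal_sub_mean {k : Fin N} (hk : k ∈ disagreementModes l b w) (a : Fin N → ℋ) :
    modal b (fun i => a i - mean a) k = modal b a k := by
  rw [modal_sub, modal_const (mem_disagreementModes.1 hk).2, sub_zero]

theorem sum_disagreement_eq_sub_mean (hb : ModalBasis W l b w) (hN : 0 < N) (a : Fin N → ℋ) :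
    ∑ k ∈ disagreementModes l b w, ‖modal b a k‖ ^ 2 = ∑ i, ‖a i - mean a‖ ^ 2 := by
  rw [← hb.sum_disagreement_eq (sum_sub_mean hN a)]
  exact Finset.sum_congr rfl fun k hk => by rw [modal_sub_mean hk]

theorem modal_mul (hb : ModalBasis W l b w) (a : Fin N → ℋ) (k : Fin N) :
    modal b (fun i => ∑ j, W i j • a j) k = w k • modal b a k := by
  simp only [modal, Finset.smul_sum, smul_smul]
  rw [Finset.sum_comm]
  refine Finset.sum_congr rfl fun j _ => ?_
  rw [← Finset.sum_smul, hb.eigen]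

end ModalBasis

end Hilbert

/-! ### The algorithm in a Hilbert space: one-round estimates -/

section Trajectory

variable {ℋ : Type*} [NormedAddCommGroup ℋ] [InnerProductSpace ℝ ℋ] {N : ℕ}

/-- A run of Local Exact-Diffusion in a Hilbert space: primal and dual iterates `X`, `Y`, local
iterates `Φ`, local gradients `g` at the local iterates, noise `n`, and local gradients `D` at the
average iterate. In the application the Hilbert space consists of the square-integrable random
vectors. -/
structure Trajectory (W : Matrix (Fin N) (Fin N) ℝ) (α L σ : ℝ) (τ : ℕ) (X Y D : ℕ → Fin N → ℋ)
    (Φ g n : ℕ → ℕ → Fin N → ℋ) : Prop where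
  phi_zero : ∀ r i, Φ r 0 i = X r i
  phi_succ : ∀ r, ∀ t < τ, ∀ i,
    Φ r (t + 1) i = Φ r t i - α • (g r t i + n r t i) - (1 / (τ : ℝ)) • Y r i
  X_succ : ∀ r i, X (r + 1) i = ∑ j, W i j • Φ r τ j
  Y_succ : ∀ r i, Y (r + 1) i = Y r i + Φ r τ i - X (r + 1) i
  dist_g : ∀ r, ∀ t < τ, ∀ i, ‖g r t i - D r i‖ ≤ L * ‖Φ r t i - mean (X r)‖
  dist_D : ∀ r i, ‖D (r + 1) i - D r i‖ ≤ L * ‖mean (X (r + 1)) - mean (X r)‖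
  norm_n : ∀ r, ∀ t < τ, ∀ i, ‖n r t i‖ ^ 2 ≤ σ ^ 2
  inner_n : ∀ r, ∀ t < τ, ∀ s < τ, ∀ i j, (t, i) ≠ (s, j) → inner ℝ (n r t i) (n r s j) = 0
  inner_X : ∀ r, ∀ t < τ, ∀ i j, inner ℝ (X r j) (n r t i) = 0
  inner_Y : ∀ r, ∀ t < τ, ∀ i j, inner ℝ (Y r j) (n r t i) = 0
  inner_D : ∀ r, ∀ t < τ, ∀ i j, inner ℝ (D r j) (n r t i) = 0

/-- The Lyapunov function of the network error, with `γ` the step size of a whole round. -/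
noncomputable def networkError (l γ : ℝ) (b : Fin N → Fin N → ℝ) (w : Fin N → ℝ)
    (X Y D : Fin N → ℋ) : ℝ :=
  1 / (N : ℝ) * ∑ k ∈ disagreementModes l b w,
    (‖modal b X k‖ ^ 2 + dualWeight (w k) * ‖modal b (fun i => Y i + γ • D i) k‖ ^ 2)

/-- The mean squared distance of the local iterates of a round from the average iterate. -/
noncomputable def spread (τ : ℕ) (X : Fin N → ℋ) (Φ : ℕ → Fin N → ℋ) : ℝ :=
  1 / (τ : ℝ) * ∑ t ∈ Finset.range τ, 1 / (N : ℝ) * ∑ i, ‖Φ t i - mean X‖ ^ 2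

/-- The average over a round of the network-averaged gradients. -/
noncomputable def roundGradient (τ : ℕ) (g : ℕ → Fin N → ℋ) : ℋ :=
  (1 / (τ : ℝ)) • ∑ t ∈ Finset.range τ, mean (g t)

namespace Trajectory

variable {W : Matrix (Fin N) (Fin N) ℝ} {α L σ : ℝ} {τ : ℕ} {X Y D : ℕ → Fin N → ℋ}
  {Φ g n : ℕ → ℕ → Fin N → ℋ}

theorem phi_eq (h : Trajectory W α L σ τ X Y D Φ g n) (r : ℕ) {t : ℕ} (ht : t ≤ τ) (i : Fin N) :
    Φ r t i = X r i - α • ∑ s ∈ Finset.range t, (g r s i + n r s i) - ((t : ℝ) / τ) • Y r i := by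
  induction t with
  | zero => simp [h.phi_zero]
  | succ t ih =>
    rw [h.phi_succ r t ht i, ih (Nat.le_of_succ_le ht), Finset.sum_range_succ]
    push_cast
    rw [add_div]
    module

/-- Because `β τ = 1`, the dual variable is subtracted exactly once in a full round. -/
theorem phi_last (h : Trajectory W α L σ τ X Y D Φ g n) (hτ : 0 < τ) (r : ℕ) (i : Fin N) :
    Φ r τ i = X r i - α • ∑ s ∈ Finset.range τ, (g r s i + n r s i) - Y r i := by
  have hτ' : (τ : ℝ) ≠ 0 := by positivity
  rw [h.phi_eq r le_rfl, div_self hτ', one_smul]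

theorem sum_X_succ (h : Trajectory W α L σ τ X Y D Φ g n) (hW : W ∈ doublyStochastic ℝ (Fin N))
    (r : ℕ) : ∑ i, X (r + 1) i = ∑ i, Φ r τ i := by
  simp_rw [h.X_succ]
  rw [Finset.sum_comm]
  simp_rw [← Finset.sum_smul, sum_col_of_mem_doublyStochastic hW, one_smul]

/-- Mixing preserves the sum over the nodes, so each dual increment `Φ - W Φ` has sum zero. -/
theorem sum_Y (h : Trajectory W α L σ τ X Y D Φ g n) (hW : W ∈ doublyStochastic ℝ (Fin N))
    (h0 : ∑ i, Y 0 i = 0) (r : ℕ) : ∑ i, Y r i = 0 := by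
  induction r with
  | zero => exact h0
  | succ r ih =>
    simp_rw [h.Y_succ]
    rw [Finset.sum_sub_distrib, Finset.sum_add_distrib, ih, h.sum_X_succ hW]
    simp

/-- The average iterate performs a stochastic gradient step. -/
theorem mean_succ (h : Trajectory W α L σ τ X Y D Φ g n) (hτ : 0 < τ)
    (hW : W ∈ doublyStochastic ℝ (Fin N)) (h0 : ∑ i, Y 0 i = 0) (r : ℕ) :
    mean (X (r + 1)) - mean (X r) = -((α * τ) • roundGradient τ (g r)
      + α • ∑ t ∈ Finset.range τ, mean (n r t)) := by
  have hτ' : (τ : ℝ) ≠ 0 := by positivity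
  have h1 : ∑ i, Φ r τ i = ∑ i, X r i - α • ∑ t ∈ Finset.range τ, ∑ i, (g r t i + n r t i) := by
    simp_rw [h.phi_last hτ]
    rw [Finset.sum_sub_distrib, h.sum_Y hW h0, sub_zero, Finset.sum_sub_distrib, ← Finset.smul_sum,
      Finset.sum_comm]
  simp only [mean, h.sum_X_succ hW, h1, roundGradient, ← Finset.smul_sum, Finset.sum_add_distrib]
  rw [smul_smul, mul_one_div, mul_div_cancel_right₀ _ hτ']
  module

/-- The `τ N` noise vectors of a round are pairwise orthogonal; the factor `1/N²` from the averages
then leaves `τ σ² / N`, the linear speed-up. -/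
theorem norm_sum_mean_noise_sq_le (h : Trajectory W α L σ τ X Y D Φ g n) (hN : 0 < N) (r : ℕ) :
    ‖∑ t ∈ Finset.range τ, mean (n r t)‖ ^ 2 ≤ τ * σ ^ 2 / N := by
  have hN' : (0 : ℝ) < N := by exact_mod_cast hN
  have h1 : ∑ t ∈ Finset.range τ, mean (n r t)
      = (1 / (N : ℝ)) • ∑ q ∈ Finset.range τ ×ˢ (Finset.univ : Finset (Fin N)), n r q.1 q.2 := by
    simp only [mean]
    rw [← Finset.smul_sum, Finset.sum_product]
  have h2 : ‖∑ q ∈ Finset.range τ ×ˢ (Finset.univ : Finset (Fin N)), n r q.1 q.2‖ ^ 2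
      ≤ (Finset.range τ ×ˢ (Finset.univ : Finset (Fin N))).card * σ ^ 2 := by
    refine norm_sum_sq_le_of_orthogonal ?_ ?_
    · intro p hp q hq hpq
      simp only [Finset.mem_product, Finset.mem_range, Finset.mem_univ, and_true] at hp hq
      exact h.inner_n r _ hp _ hq _ _ hpq
    · intro p hp
      simp only [Finset.mem_product, Finset.mem_range, Finset.mem_univ, and_true] at hp
      exact h.norm_n r _ hp _
  rw [Finset.card_product, Finset.card_range, Finset.card_univ, Fintype.card_fin,
    Nat.cast_mul] at h2
  rw [h1, norm_smul, Real.norm_of_nonneg (by positivity), mul_pow]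
  calc _ ≤ (1 / (N : ℝ)) ^ 2 * (τ * N * σ ^ 2) := by gcongr
    _ = _ := by field_simp

theorem norm_sum_noise_sq_le (h : Trajectory W α L σ τ X Y D Φ g n) (r : ℕ) {t : ℕ} (ht : t ≤ τ)
    (i : Fin N) : ‖∑ s ∈ Finset.range t, n r s i‖ ^ 2 ≤ τ * σ ^ 2 := by
  have h2 : ‖∑ s ∈ Finset.range t, n r s i‖ ^ 2 ≤ (Finset.range t).card * σ ^ 2 := by
    refine norm_sum_sq_le_of_orthogonal ?_ ?_
    · intro p hp q hq hpq
      rw [Finset.mem_range] at hp hq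
      exact h.inner_n r _ (hp.trans_le ht) _ (hq.trans_le ht) _ _ fun heq => hpq (Prod.ext_iff.1 heq).1
    · intro p hp
      exact h.norm_n r _ ((Finset.mem_range.1 hp).trans_le ht) _
  rw [Finset.card_range] at h2
  refine h2.trans ?_
  gcongr

theorem norm_sum_drift_sq_le (h : Trajectory W α L σ τ X Y D Φ g n) (r : ℕ) {t : ℕ} (ht : t ≤ τ)
    (i : Fin N) :
    ‖∑ s ∈ Finset.range t, (g r s i - D r i)‖ ^ 2
      ≤ τ * (L ^ 2 * ∑ s ∈ Finset.range τ, ‖Φ r s i - mean (X r)‖ ^ 2) := by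
  have h1 := norm_sum_sq_le (Finset.range t) fun s => g r s i - D r i
  rw [Finset.card_range] at h1
  refine h1.trans ?_
  rw [Finset.mul_sum (Finset.range τ)]
  have h2 : ∑ s ∈ Finset.range t, ‖g r s i - D r i‖ ^ 2
      ≤ ∑ s ∈ Finset.range τ, L ^ 2 * ‖Φ r s i - mean (X r)‖ ^ 2 :=
    calc ∑ s ∈ Finset.range t, ‖g r s i - D r i‖ ^ 2
        ≤ ∑ s ∈ Finset.range t, L ^ 2 * ‖Φ r s i - mean (X r)‖ ^ 2 := by
          refine Finset.sum_le_sum fun s hs => ?_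
          rw [← mul_pow]
          exact pow_le_pow_left₀ (norm_nonneg _)
            (h.dist_g r s ((Finset.mem_range.1 hs).trans_le ht) i) 2
      _ ≤ _ := Finset.sum_le_sum_of_subset_of_nonneg (Finset.range_mono ht)
          fun _ _ _ => by positivity
  exact mul_le_mul (Nat.cast_le.2 ht) h2 (Finset.sum_nonneg fun _ _ => sq_nonneg _)
    (Nat.cast_nonneg _)

theorem sum_spread (hN : 0 < N) (hτ : 0 < τ) (r : ℕ) :
    ∑ i, ∑ s ∈ Finset.range τ, ‖Φ r s i - mean (X r)‖ ^ 2 = N * τ * spread τ (X r) (Φ r) := by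
  have hN' : (N : ℝ) ≠ 0 := by positivity
  have hτ' : (τ : ℝ) ≠ 0 := by positivity
  rw [spread, Finset.sum_comm, ← Finset.mul_sum]
  field_simp

theorem displacement_le (h : Trajectory W α L σ τ X Y D Φ g n) (hN : 0 < N) (hτ : 0 < τ)
    (hW : W ∈ doublyStochastic ℝ (Fin N)) (h0 : ∑ i, Y 0 i = 0) (r : ℕ) :
    ‖mean (X (r + 1)) - mean (X r)‖ ^ 2
      ≤ 2 * (α * τ) ^ 2 * ‖roundGradient τ (g r)‖ ^ 2 + 2 * (α * τ) ^ 2 * (σ ^ 2 / (N * τ)) := by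
  have hN' : (0 : ℝ) < N := by exact_mod_cast hN
  have hτ' : (0 : ℝ) < τ := by exact_mod_cast hτ
  rw [h.mean_succ hτ hW h0, norm_neg]
  refine (norm_add_sq_le_two _ _).trans ?_
  rw [norm_smul, norm_smul, mul_pow, mul_pow, Real.norm_eq_abs, Real.norm_eq_abs, sq_abs, sq_abs]
  have h1 := mul_le_mul_of_nonneg_left (h.norm_sum_mean_noise_sq_le hN r) (sq_nonneg α)
  have h2 : α ^ 2 * (τ * σ ^ 2 / N) = (α * τ) ^ 2 * (σ ^ 2 / (N * τ)) := by field_simp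
  linarith

variable {l : ℝ} {b : Fin N → Fin N → ℝ} {w : Fin N → ℝ}

/-- One round of the network error. -/
theorem networkError_succ_le (h : Trajectory W α L σ τ X Y D Φ g n) (hN : 0 < N) (hτ : 0 < τ)
    (hb : ModalBasis W l b w) (hl : l < 1) (r : ℕ) :
    networkError l (α * τ) b w (X (r + 1)) (Y (r + 1)) (D (r + 1))
      ≤ (1 - (1 - l) / 4) * networkError l (α * τ) b w (X r) (Y r) (D r)
        + 12 * (α * τ) ^ 2 * L ^ 2 / (1 - l) * spread τ (X r) (Φ r)
        + 12 * (α * τ) ^ 2 * L ^ 2 / (1 - l) ^ 2 * ‖mean (X (r + 1)) - mean (X r)‖ ^ 2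
        + 2 * (α * τ) ^ 2 * (σ ^ 2 / τ) := by
  have hN' : (0 : ℝ) < N := by exact_mod_cast hN
  have hτ' : (0 : ℝ) < τ := by exact_mod_cast hτ
  set d := 1 - l with hd
  have hd0 : 0 < d := by linarith
  set G : Fin N → ℋ := fun i => ∑ s ∈ Finset.range τ, (g r s i - D r i)
  set S : Fin N → ℋ := fun i => ∑ s ∈ Finset.range τ, n r s i
  set δ : Fin N → ℋ := fun i => (α * τ) • (D (r + 1) i - D r i)
  -- Each local gradient is `D` plus a drift. The `τ` copies of `D` join the dual variable to form
  -- `z = Y + γ D`, and only the drift `G` and the noise `S` remain as perturbations.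
  have hPhi : ∀ i, Φ r τ i
      = (X r i - (Y r i + (α * τ) • D r i)) - α • (G i + S i) := by
    intro i
    have hsum : ∑ s ∈ Finset.range τ, (g r s i + n r s i) = G i + S i + (τ : ℝ) • D r i := by
      simp only [G, S]
      rw [Finset.sum_sub_distrib, Finset.sum_const, Finset.card_range, Finset.sum_add_distrib,
        ← Nat.cast_smul_eq_nsmul ℝ]
      abel
    rw [h.phi_last hτ, hsum]
    module
  have hmPhi : ∀ k, modal b (Φ r τ) k = modal b (X r) k
      - modal b (fun i => Y r i + (α * τ) • D r i) k - α • (modal b G k + modal b S k) := by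
    intro k
    have : Φ r τ = fun i => (X r i - (Y r i + (α * τ) • D r i)) - α • (G i + S i) := funext hPhi
    rw [this, modal_sub, modal_sub, modal_smul, modal_add b G S]
  have hmX : ∀ k, modal b (X (r + 1)) k = w k • modal b (Φ r τ) k := by
    intro k
    have : X (r + 1) = fun i => ∑ j, W i j • Φ r τ j := funext (h.X_succ r)
    rw [this, hb.modal_mul]
  -- The change `δ` of `γ D` is the only term that moving the reference gradients to the new average
  -- adds to the dual recursion.
  have hmY : ∀ k, modal b (fun i => Y (r + 1) i + (α * τ) • D (r + 1) i) k
      = w k • modal b (fun i => Y r i + (α * τ) • D r i) k + (1 - w k) • modal b (X r) k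
        - (α * (1 - w k)) • (modal b G k + modal b S k) + modal b δ k := by
    intro k
    have h1 : (fun i => Y (r + 1) i + (α * τ) • D (r + 1) i)
        = fun i => ((Y r i + (α * τ) • D r i) + (Φ r τ i - X (r + 1) i)) + δ i := by
      funext i
      rw [h.Y_succ]
      simp only [δ]
      module
    rw [h1, modal_add, modal_add, modal_sub, hmX, hmPhi]
    module
  have horth : ∀ (a : Fin N → ℋ), (∀ t < τ, ∀ i j, inner ℝ (a j) (n r t i) = 0) →
      ∀ k, inner ℝ (modal b a k) (modal b S k) = 0 := by
    intro a ha k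
    simp only [modal, S]
    rw [sum_inner]
    refine Finset.sum_eq_zero fun j _ => ?_
    rw [inner_sum]
    refine Finset.sum_eq_zero fun i _ => ?_
    rw [inner_smul_left, inner_smul_right, inner_sum,
      Finset.sum_eq_zero fun t ht => ha t (Finset.mem_range.1 ht) i j]
    simp
  have hstep : ∀ k ∈ disagreementModes l b w,
      ‖modal b (X (r + 1)) k‖ ^ 2 + dualWeight (w k)
          * ‖modal b (fun i => Y (r + 1) i + (α * τ) • D (r + 1) i) k‖ ^ 2
        ≤ (1 - d / 4) * (‖modal b (X r) k‖ ^ 2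
            + dualWeight (w k) * ‖modal b (fun i => Y r i + (α * τ) • D r i) k‖ ^ 2)
          + (12 / d * α ^ 2 * ‖modal b G k‖ ^ 2 + 12 / d ^ 2 * ‖modal b δ k‖ ^ 2
          + 2 * α ^ 2 * ‖modal b S k‖ ^ 2) := by
    intro k hk
    rw [hmX, hmPhi, hmY]
    have hwk := (mem_disagreementModes.1 hk).1
    refine (mode_step (hb.nonneg k) hd0 (by rw [hd]; linarith) (horth _ (h.inner_X r) k)
      (horth _ ?_ k)).trans (le_of_eq ?_)
    · intro t ht i j
      rw [inner_add_left, inner_smul_left, h.inner_Y r t ht, h.inner_D r t ht]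
      simp
    · field_simp
      ring
  have hsum : ∑ k ∈ disagreementModes l b w, (‖modal b (X (r + 1)) k‖ ^ 2 + dualWeight (w k)
          * ‖modal b (fun i => Y (r + 1) i + (α * τ) • D (r + 1) i) k‖ ^ 2)
      ≤ (1 - d / 4) * ∑ k ∈ disagreementModes l b w, (‖modal b (X r) k‖ ^ 2
            + dualWeight (w k) * ‖modal b (fun i => Y r i + (α * τ) • D r i) k‖ ^ 2)
          + (12 / d * α ^ 2 * ∑ k ∈ disagreementModes l b w, ‖modal b G k‖ ^ 2
          + 12 / d ^ 2 * ∑ k ∈ disagreementModes l b w, ‖modal b δ k‖ ^ 2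
          + 2 * α ^ 2 * ∑ k ∈ disagreementModes l b w, ‖modal b S k‖ ^ 2) := by
    simp only [Finset.mul_sum (disagreementModes l b w), ← Finset.sum_add_distrib]
    exact Finset.sum_le_sum hstep
  have hG : ∑ k ∈ disagreementModes l b w, ‖modal b G k‖ ^ 2
      ≤ N * τ ^ 2 * L ^ 2 * spread τ (X r) (Φ r) :=
    calc _ ≤ ∑ i, ‖G i‖ ^ 2 := hb.sum_disagreement_le G
      _ ≤ ∑ i, τ * (L ^ 2 * ∑ s ∈ Finset.range τ, ‖Φ r s i - mean (X r)‖ ^ 2) :=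
        Finset.sum_le_sum fun i _ => h.norm_sum_drift_sq_le r le_rfl i
      _ = _ := by
        rw [← Finset.mul_sum, ← Finset.mul_sum, sum_spread hN hτ]
        ring
  have hδ : ∑ k ∈ disagreementModes l b w, ‖modal b δ k‖ ^ 2
      ≤ N * ((α * τ) ^ 2 * L ^ 2 * ‖mean (X (r + 1)) - mean (X r)‖ ^ 2) :=
    calc _ ≤ ∑ i, ‖δ i‖ ^ 2 := hb.sum_disagreement_le δ
      _ ≤ ∑ _i : Fin N, (α * τ) ^ 2 * L ^ 2 * ‖mean (X (r + 1)) - mean (X r)‖ ^ 2 := by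
        refine Finset.sum_le_sum fun i _ => ?_
        simp only [δ]
        rw [norm_smul, mul_pow, Real.norm_eq_abs, sq_abs, mul_assoc, ← mul_pow L]
        exact mul_le_mul_of_nonneg_left (pow_le_pow_left₀ (norm_nonneg _) (h.dist_D r i) 2)
          (sq_nonneg _)
      _ = _ := by rw [Finset.sum_const, Finset.card_univ, Fintype.card_fin, nsmul_eq_mul]
  have hS : ∑ k ∈ disagreementModes l b w, ‖modal b S k‖ ^ 2 ≤ N * (τ * σ ^ 2) :=
    calc _ ≤ ∑ i, ‖S i‖ ^ 2 := hb.sum_disagreement_le S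
      _ ≤ ∑ _i : Fin N, τ * σ ^ 2 :=
        Finset.sum_le_sum fun i _ => h.norm_sum_noise_sq_le r le_rfl i
      _ = _ := by rw [Finset.sum_const, Finset.card_univ, Fintype.card_fin, nsmul_eq_mul]
  have hG' := mul_le_mul_of_nonneg_left hG (show 0 ≤ 12 / d * α ^ 2 by positivity)
  have hδ' := mul_le_mul_of_nonneg_left hδ (show 0 ≤ 12 / d ^ 2 by positivity)
  have hS' := mul_le_mul_of_nonneg_left hS (show 0 ≤ 2 * α ^ 2 by positivity)
  have hall := mul_le_mul_of_nonneg_left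
    (hsum.trans (add_le_add_right (add_le_add (add_le_add hG' hδ') hS') _))
    (show 0 ≤ 1 / (N : ℝ) by positivity)
  unfold networkError
  refine hall.trans (le_of_eq ?_)
  field_simp
  ring

theorem spread_nonneg (τ : ℕ) (X : Fin N → ℋ) (Φ : ℕ → Fin N → ℋ) : 0 ≤ spread τ X Φ := by
  unfold spread
  positivity

theorem networkError_nonneg (hb : ModalBasis W l b w) (hl : l < 1) (γ : ℝ) (X Y D : Fin N → ℋ) :
    0 ≤ networkError l γ b w X Y D := by
  unfold networkError
  refine mul_nonneg (by positivity) (Finset.sum_nonneg fun k hk => ?_)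
  have h1 := quarter_le_dualWeight (hb.nonneg k) ((mem_disagreementModes.1 hk).1.trans_lt hl)
  have h2 : 0 ≤ dualWeight (w k) := by linarith
  positivity

/-- The local iterates stay close to the average iterate. -/
theorem spread_le (h : Trajectory W α L σ τ X Y D Φ g n) (hN : 0 < N) (hτ : 0 < τ)
    (hb : ModalBasis W l b w) (hl : l < 1) (hW : W ∈ doublyStochastic ℝ (Fin N))
    (h0 : ∑ i, Y 0 i = 0) (hα : 8 * (α * τ) ^ 2 * L ^ 2 ≤ 1) (r : ℕ) :
    spread τ (X r) (Φ r) ≤ 64 * networkError l (α * τ) b w (X r) (Y r) (D r)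
      + 8 * (α * τ) ^ 2 * ‖mean (D r)‖ ^ 2 + 8 * (α * τ) ^ 2 * (σ ^ 2 / τ) := by
  have hN' : (0 : ℝ) < N := by exact_mod_cast hN
  have hτ' : (0 : ℝ) < τ := by exact_mod_cast hτ
  set E := ∑ i, ‖X r i - mean (X r)‖ ^ 2 with hE
  set Z := ∑ i, ‖Y r i + (α * τ) • (D r i - mean (D r))‖ ^ 2 with hZ
  set p := spread τ (X r) (Φ r) with hp
  have hU : 2 * E + 2 * Z ≤ N * (8 * networkError l (α * τ) b w (X r) (Y r) (D r)) := by
    have hE' : ∑ k ∈ disagreementModes l b w, ‖modal b (X r) k‖ ^ 2 = E :=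
      hb.sum_disagreement_eq_sub_mean hN _
    have hZ' : ∑ k ∈ disagreementModes l b w,
        ‖modal b (fun i => Y r i + (α * τ) • D r i) k‖ ^ 2 = Z := by
      rw [hb.sum_disagreement_eq_sub_mean hN, hZ]
      refine Finset.sum_congr rfl fun i _ => ?_
      -- The dual variables have mean zero, so the mean of `z` is `γ` times the averaged gradient,
      -- and subtracting it leaves exactly the dual error.
      have hm : mean (fun i => Y r i + (α * τ) • D r i) = (α * τ) • mean (D r) := by
        simp only [mean, Finset.sum_add_distrib, h.sum_Y hW h0, zero_add, ← Finset.smul_sum]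
        exact smul_comm _ _ _
      rw [hm, smul_sub, add_sub_assoc]
    have h1 : 2 * E + 2 * Z ≤ 8 * ∑ k ∈ disagreementModes l b w, (‖modal b (X r) k‖ ^ 2
        + dualWeight (w k) * ‖modal b (fun i => Y r i + (α * τ) • D r i) k‖ ^ 2) := by
      rw [← hE', ← hZ', Finset.mul_sum, Finset.mul_sum, Finset.mul_sum, ← Finset.sum_add_distrib]
      refine Finset.sum_le_sum fun k hk => ?_
      have h1 := quarter_le_dualWeight (hb.nonneg k) ((mem_disagreementModes.1 hk).1.trans_lt hl)
      have h2 := mul_le_mul_of_nonneg_right h1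
        (sq_nonneg ‖modal b (fun i => Y r i + (α * τ) • D r i) k‖)
      have h3 := sq_nonneg ‖modal b (X r) k‖
      linarith
    refine h1.trans (le_of_eq ?_)
    unfold networkError
    field_simp
  have hns : ∀ (c : ℝ) (v : ℋ), ‖c • v‖ ^ 2 = c ^ 2 * ‖v‖ ^ 2 := fun c v => by
    rw [norm_smul, mul_pow, Real.norm_eq_abs, sq_abs]
  have hpt : ∀ t ∈ Finset.range τ, ∀ i, ‖Φ r t i - mean (X r)‖ ^ 2
      ≤ 4 * (2 * ‖X r i - mean (X r)‖ ^ 2 + 2 * ‖Y r i + (α * τ) • (D r i - mean (D r))‖ ^ 2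
        + α ^ 2 * (τ * (L ^ 2 * ∑ s ∈ Finset.range τ, ‖Φ r s i - mean (X r)‖ ^ 2))
        + (α * τ) ^ 2 * ‖mean (D r)‖ ^ 2 + α ^ 2 * (τ * σ ^ 2)) := by
    intro t ht i
    have ht' : t ≤ τ := (Finset.mem_range.1 ht).le
    set θ : ℝ := (t : ℝ) / τ with hθ
    have hθ0 : 0 ≤ θ := by positivity
    have hθ1 : θ ≤ 1 := by
      rw [hθ, div_le_one hτ']
      exact_mod_cast ht'
    have hθτ : (t : ℝ) = θ * τ := by rw [hθ]; field_simp
    have hθsq : θ ^ 2 ≤ 1 := pow_le_one₀ hθ0 hθ1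
    have hphi := h.phi_eq r ht' i
    rw [← hθ] at hphi
    clear_value θ
    -- After `t = θ τ` local steps the drift due to `Y` and `D` is `-θ z`. Splitting off the mean of
    -- `D` leaves the dual error, which the network error controls, and the common gradient step `θ
    -- γ` along `mean (D r)`.
    have hdec : Φ r t i - mean (X r)
        = (((X r i - mean (X r)) - θ • (Y r i + (α * τ) • (D r i - mean (D r))))
          + (-α) • ∑ s ∈ Finset.range t, (g r s i - D r i))
          + ((-(θ * (α * τ))) • mean (D r) + (-α) • ∑ s ∈ Finset.range t, n r s i) := by
      rw [hphi, Finset.sum_add_distrib, Finset.sum_sub_distrib, Finset.sum_const,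
        Finset.card_range, ← Nat.cast_smul_eq_nsmul ℝ, hθτ]
      module
    rw [hdec]
    have n1 := norm_add_sq_le_two
      (((X r i - mean (X r)) - θ • (Y r i + (α * τ) • (D r i - mean (D r))))
          + (-α) • ∑ s ∈ Finset.range t, (g r s i - D r i))
      ((-(θ * (α * τ))) • mean (D r) + (-α) • ∑ s ∈ Finset.range t, n r s i)
    have n2 := norm_add_sq_le_two
      ((X r i - mean (X r)) - θ • (Y r i + (α * τ) • (D r i - mean (D r))))
      ((-α) • ∑ s ∈ Finset.range t, (g r s i - D r i))
    have n3 := norm_add_sq_le_two ((-(θ * (α * τ))) • mean (D r))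
      ((-α) • ∑ s ∈ Finset.range t, n r s i)
    have n4 := norm_sub_sq_le_two (X r i - mean (X r))
      (θ • (Y r i + (α * τ) • (D r i - mean (D r))))
    rw [hns, neg_sq] at n2
    rw [hns, hns, neg_sq, neg_sq, mul_pow] at n3
    rw [hns] at n4
    have n5 := mul_le_mul_of_nonneg_left (h.norm_sum_drift_sq_le r ht' i) (sq_nonneg α)
    have n6 := mul_le_mul_of_nonneg_left (h.norm_sum_noise_sq_le r ht' i) (sq_nonneg α)
    have n7 := mul_le_mul_of_nonneg_right hθsq
      (sq_nonneg ‖Y r i + (α * τ) • (D r i - mean (D r))‖)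
    have n8 := mul_le_mul_of_nonneg_right hθsq
      (show 0 ≤ (α * τ) ^ 2 * ‖mean (D r)‖ ^ 2 by positivity)
    linarith
  have hsum_i : ∀ t ∈ Finset.range τ, 1 / (N : ℝ) * ∑ i, ‖Φ r t i - mean (X r)‖ ^ 2
      ≤ 4 * (8 * networkError l (α * τ) b w (X r) (Y r) (D r) + (α * τ) ^ 2 * L ^ 2 * p
        + (α * τ) ^ 2 * ‖mean (D r)‖ ^ 2 + (α * τ) ^ 2 * (σ ^ 2 / τ)) := by
    intro t ht
    have h1 := Finset.sum_le_sum fun i (_ : i ∈ Finset.univ) => hpt t ht i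
    rw [← Finset.mul_sum] at h1
    simp only [Finset.sum_add_distrib, ← Finset.mul_sum, Finset.sum_const, Finset.card_univ,
      Fintype.card_fin, nsmul_eq_mul] at h1
    rw [sum_spread hN hτ, ← hE, ← hZ, ← hp] at h1
    have h2 := mul_le_mul_of_nonneg_left (h1.trans (mul_le_mul_of_nonneg_left (add_le_add_left
      (add_le_add_left (add_le_add_left hU _) _) _) (by norm_num : (0:ℝ) ≤ 4)))
      (show 0 ≤ 1 / (N : ℝ) by positivity)
    refine h2.trans (le_of_eq ?_)
    field_simp
  have hfin : p ≤ 4 * (8 * networkError l (α * τ) b w (X r) (Y r) (D r)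
      + (α * τ) ^ 2 * L ^ 2 * p + (α * τ) ^ 2 * ‖mean (D r)‖ ^ 2 + (α * τ) ^ 2 * (σ ^ 2 / τ)) := by
    have h1 := mul_le_mul_of_nonneg_left (Finset.sum_le_sum hsum_i)
      (show 0 ≤ 1 / (τ : ℝ) by positivity)
    rw [Finset.sum_const, Finset.card_range, nsmul_eq_mul, ← mul_assoc, one_div_mul_cancel hτ'.ne',
      one_mul] at h1
    exact h1
  have hp0 : 0 ≤ p := spread_nonneg _ _ _
  -- The spread occurs on both sides of `hfin`; on the right its coefficient `4 γ² L²` is at most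
  -- `1/2`, and moving it to the left doubles the other constants.
  have h3 := mul_le_mul_of_nonneg_right hα hp0
  linarith

/-- The initial network error. -/
theorem networkError_init_le (hN : 0 < N) (hb : ModalBasis W l b w) (hl : l < 1) (γ : ℝ)
    {X Y D : Fin N → ℋ} (hY : (∀ i, Y i = X i - ∑ j, W i j • X j) ∨ ∀ i, Y i = 0) :
    networkError l γ b w X Y D ≤ 3 * (1 / (N : ℝ) * ∑ i, ‖X i - mean X‖ ^ 2)
      + 2 * γ ^ 2 / (1 - l) * (1 / (N : ℝ) * ∑ i, ‖D i - mean D‖ ^ 2) := by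
  have hN' : (0 : ℝ) < N := by exact_mod_cast hN
  set d := 1 - l with hd
  have hd0 : 0 < d := by linarith
  rw [← hb.sum_disagreement_eq_sub_mean hN, ← hb.sum_disagreement_eq_sub_mean hN]
  -- Both initializations satisfy this bound. The factor `(1 - w)²` absorbs the dual weight, so the
  -- initial disagreement appears without `1/d`.
  have hY' : ∀ k ∈ disagreementModes l b w,
      ‖modal b Y k‖ ^ 2 ≤ (1 - w k) ^ 2 * ‖modal b X k‖ ^ 2 := by
    intro k hk
    rcases hY with hY | hY
    · rw [show Y = fun i => X i - ∑ j, W i j • X j from funext hY, modal_sub, hb.modal_mul]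
      have : modal b X k - w k • modal b X k = (1 - w k) • modal b X k := by module
      rw [this, norm_smul, mul_pow, Real.norm_eq_abs, sq_abs]
    · rw [show Y = fun _ => 0 from funext hY]
      simp [modal]
      positivity
  unfold networkError
  have hk : ∀ k ∈ disagreementModes l b w,
      ‖modal b X k‖ ^ 2 + dualWeight (w k) * ‖modal b (fun i => Y i + γ • D i) k‖ ^ 2
        ≤ 3 * ‖modal b X k‖ ^ 2 + 2 * γ ^ 2 / d * ‖modal b D k‖ ^ 2 := by
    intro k hk
    have hwk := (mem_disagreementModes.1 hk).1
    have h0 := hb.nonneg k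
    have hw1 := hwk.trans_lt hl
    have hq := dualWeight_mul hw1
    have hq4 := quarter_le_dualWeight h0 hw1
    have hqd : dualWeight (w k) ≤ 1 / d := dualWeight_le hd0 (by rw [hd]; linarith)
    rw [modal_add, modal_smul]
    have h1 := norm_add_sq_le_two (modal b Y k) (γ • modal b D k)
    rw [norm_smul γ, mul_pow, Real.norm_eq_abs, sq_abs] at h1
    have h2 := mul_le_mul_of_nonneg_left (h1.trans (add_le_add_left
      (mul_le_mul_of_nonneg_left (hY' k hk) zero_le_two) _)) (by linarith : 0 ≤ dualWeight (w k))
    have h3 : dualWeight (w k) * (2 * ((1 - w k) ^ 2 * ‖modal b X k‖ ^ 2)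
        + 2 * (γ ^ 2 * ‖modal b D k‖ ^ 2))
        = 2 * ((dualWeight (w k) * (1 - w k)) * (1 - w k)) * ‖modal b X k‖ ^ 2
          + dualWeight (w k) * (2 * γ ^ 2 * ‖modal b D k‖ ^ 2) := by ring
    rw [h3, hq] at h2
    have h4 : (1 + 3 * w k) / 4 * (1 - w k) ≤ 1 := by nlinarith only [h0, hw1]
    have h5 := mul_le_mul_of_nonneg_right h4 (sq_nonneg ‖modal b X k‖)
    have h6 := mul_le_mul_of_nonneg_right hqd
      (show 0 ≤ 2 * γ ^ 2 * ‖modal b D k‖ ^ 2 by positivity)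
    have h7 : 1 / d * (2 * γ ^ 2 * ‖modal b D k‖ ^ 2) = 2 * γ ^ 2 / d * ‖modal b D k‖ ^ 2 := by
      ring
    linarith
  have hs := mul_le_mul_of_nonneg_left (Finset.sum_le_sum hk) (show 0 ≤ 1 / (N : ℝ) by positivity)
  have hs' : ∑ k ∈ disagreementModes l b w,
      (3 * ‖modal b X k‖ ^ 2 + 2 * γ ^ 2 / d * ‖modal b D k‖ ^ 2)
      = 3 * ∑ k ∈ disagreementModes l b w, ‖modal b X k‖ ^ 2
        + 2 * γ ^ 2 / d * ∑ k ∈ disagreementModes l b w, ‖modal b D k‖ ^ 2 := by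
    rw [Finset.sum_add_distrib, ← Finset.mul_sum, ← Finset.mul_sum]
  rw [hs'] at hs
  linarith

end Trajectory

end Trajectory

/-! ### Closing the coupled scalar inequalities -/

section Recursions

/-- The coupled recursion for the network error, with the spread and the displacement eliminated. -/
theorem networkError_recursion {γ L d ρ u u' p B β a s v : ℝ} (hd : 0 < d) (hd1 : d ≤ 1)
    (hρ0 : 0 ≤ ρ) (hρ1 : ρ ≤ 1 / 100) (hγL : γ * L = ρ * d)
    (hu : 0 ≤ u) (hβ : 0 ≤ β) (ha : 0 ≤ a) (hs : 0 ≤ s) (hv : 0 ≤ v)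
    (h1 : u' ≤ (1 - d / 4) * u + 12 * γ ^ 2 * L ^ 2 / d * p + 12 * γ ^ 2 * L ^ 2 / d ^ 2 * B
      + 2 * γ ^ 2 * s)
    (h2 : p ≤ 64 * u + 8 * γ ^ 2 * β + 8 * γ ^ 2 * s)
    (h3 : B ≤ 2 * γ ^ 2 * a + 2 * γ ^ 2 * v) :
    u' ≤ (1 - d / 8) * u + γ ^ 2 / 100 * (β + a + v) + 3 * γ ^ 2 * s := by
  -- Here `ρ = γ L / d` measures the step size against the spectral gap. The feedback of the spread
  -- becomes `12 ρ² d`, a small fraction of the contraction `d/4`, of which `d/8` is kept.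
  have hc : 12 * γ ^ 2 * L ^ 2 = 12 * ρ ^ 2 * d ^ 2 := by
    linear_combination 12 * (γ * L + ρ * d) * hγL
  have c1 : 12 * γ ^ 2 * L ^ 2 / d = 12 * ρ ^ 2 * d := by rw [hc]; field_simp
  have c2 : 12 * γ ^ 2 * L ^ 2 / d ^ 2 = 12 * ρ ^ 2 := by rw [hc]; field_simp
  rw [c1, c2] at h1
  have hρ2 : ρ ^ 2 ≤ 1 / 10000 := by
    calc ρ ^ 2 ≤ (1 / 100) ^ 2 := pow_le_pow_left₀ hρ0 hρ1 2
      _ = _ := by norm_num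
  have hρd : ρ ^ 2 * d ≤ 1 / 10000 := by
    calc ρ ^ 2 * d ≤ ρ ^ 2 * 1 := by gcongr
      _ ≤ _ := by linarith
  have k1 := mul_le_mul_of_nonneg_left h2 (show 0 ≤ 12 * ρ ^ 2 * d by positivity)
  have k2 := mul_le_mul_of_nonneg_left h3 (show 0 ≤ 12 * ρ ^ 2 by positivity)
  have k3 := mul_le_mul_of_nonneg_right hρ2 (show 0 ≤ d * u by positivity)
  have k4 := mul_le_mul_of_nonneg_right hρd (show 0 ≤ γ ^ 2 * β by positivity)
  have k5 := mul_le_mul_of_nonneg_right hρd (show 0 ≤ γ ^ 2 * s by positivity)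
  have k6 := mul_le_mul_of_nonneg_right hρ2 (show 0 ≤ γ ^ 2 * a by positivity)
  have k7 := mul_le_mul_of_nonneg_right hρ2 (show 0 ≤ γ ^ 2 * v by positivity)
  have p1 : 0 ≤ d * u := by positivity
  have p2 : 0 ≤ γ ^ 2 * β := by positivity
  have p3 : 0 ≤ γ ^ 2 * s := by positivity
  have p4 : 0 ≤ γ ^ 2 * a := by positivity
  have p5 : 0 ≤ γ ^ 2 * v := by positivity
  linarith

/-- The letters stand for: `F` expected cost, `u` network error, `p` spread, `B` squared
displacement of the average, `β` squared norm of the averaged gradient at the average iterate, `a`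
that of the round gradient, `A` the time average of the squared averaged local gradients, `s =
σ²/τ`, `v = σ²/(N τ)`; primes mark the next round.

The weight `256 ρ L` is chosen so that the gain `256 ρ L * (d/8) = 32 γ L²` per unit of `u` cancels
the cost `(γ L²/2) * 64` that the spread causes in the descent inequality. The gradient terms
produced on the way are absorbed by half of `γ/2 * (β + A)`. -/
theorem nonconvex_recursion {γ L d ρ F F' u u' p B β A a s v : ℝ} (hd : 0 < d) (hd1 : d ≤ 1)
    (hL : 0 < L) (hγ : 0 < γ) (hρ0 : 0 ≤ ρ) (hρ1 : ρ ≤ 1 / 100) (hγL : γ * L = ρ * d)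
    (hu : 0 ≤ u) (hβ : 0 ≤ β) (ha : 0 ≤ a) (haA : a ≤ A) (hs : 0 ≤ s) (hv : 0 ≤ v)
    (h1 : u' ≤ (1 - d / 4) * u + 12 * γ ^ 2 * L ^ 2 / d * p + 12 * γ ^ 2 * L ^ 2 / d ^ 2 * B
      + 2 * γ ^ 2 * s)
    (h2 : p ≤ 64 * u + 8 * γ ^ 2 * β + 8 * γ ^ 2 * s)
    (h3 : B ≤ 2 * γ ^ 2 * a + 2 * γ ^ 2 * v)
    (hF : F' ≤ F - γ / 2 * (β + A) + γ * L ^ 2 / 2 * p + L / 2 * B) :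
    F' + 256 * ρ * L * u' ≤ F + 256 * ρ * L * u - γ / 4 * (β + A) + 2 * L * γ ^ 2 * v
      + 800 * (ρ * L) * γ ^ 2 * s := by
  have h := networkError_recursion hd hd1 hρ0 hρ1 hγL hu hβ ha hs hv h1 h2 h3
  have hA : 0 ≤ A := ha.trans haA
  have k0 := mul_le_mul_of_nonneg_left h (show 0 ≤ 256 * ρ * L by positivity)
  have k1 := mul_le_mul_of_nonneg_left h2 (show 0 ≤ γ * L ^ 2 / 2 by positivity)
  have k2 := mul_le_mul_of_nonneg_left h3 (show 0 ≤ L / 2 by positivity)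
  -- every product with `γ * L` is rewritten by means of `ρ * d`
  have hρd : ρ * d ≤ 1 / 100 := by nlinarith
  have hρd0 : 0 ≤ ρ * d := by positivity
  have e1 : γ * L ^ 2 = ρ * d * L := by linear_combination L * hγL
  have e2 : ∀ x : ℝ, L * γ ^ 2 * x = ρ * d * (γ * x) := fun x => by
    linear_combination γ * x * hγL
  have e3 : ∀ x : ℝ, ρ * L * γ ^ 2 * x = ρ * (ρ * d * (γ * x)) := fun x => by
    linear_combination ρ * γ * x * hγL
  have e4 : ∀ x : ℝ, γ * L ^ 2 * γ ^ 2 * x = ρ * d * (ρ * d) * (γ * x) := fun x => by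
    linear_combination (γ * L + ρ * d) * γ * x * hγL
  have b1 : ∀ x : ℝ, 0 ≤ x → L * γ ^ 2 * x ≤ 1 / 100 * (γ * x) := fun x hx => by
    rw [e2]
    exact mul_le_mul_of_nonneg_right hρd (by positivity)
  have b2 : ∀ x : ℝ, 0 ≤ x → ρ * L * γ ^ 2 * x ≤ 1 / 10000 * (γ * x) := fun x hx => by
    rw [e3]
    calc ρ * (ρ * d * (γ * x)) ≤ 1 / 100 * (1 / 100 * (γ * x)) := by gcongr
      _ = _ := by ring
  have b3 : ∀ x : ℝ, 0 ≤ x → γ * L ^ 2 * γ ^ 2 * x ≤ 1 / 10000 * (γ * x) := fun x hx => by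
    rw [e4]
    calc ρ * d * (ρ * d) * (γ * x) ≤ 1 / 100 * (1 / 100) * (γ * x) := by gcongr
      _ = _ := by ring
  have b4 : ρ * L * γ ^ 2 * v ≤ 1 / 100 * (L * γ ^ 2 * v) := by
    calc ρ * L * γ ^ 2 * v = ρ * (L * γ ^ 2 * v) := by ring
      _ ≤ _ := by gcongr
  have b5 : γ * L ^ 2 * γ ^ 2 * s ≤ ρ * L * γ ^ 2 * s := by
    rw [e1]
    calc ρ * d * L * γ ^ 2 * s ≤ ρ * 1 * L * γ ^ 2 * s := by gcongr
      _ = _ := by ring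
  have b6 : γ * L ^ 2 * u = ρ * L * (d * u) := by rw [e1]; ring
  have q1 := b1 a ha
  have q2 := b2 β hβ
  have q3 := b2 a ha
  have q4 := b3 β hβ
  have q5 : γ * a ≤ γ * A := by gcongr
  have z1 : 0 ≤ γ * β := by positivity
  have z2 : 0 ≤ γ * A := by positivity
  have z3 : 0 ≤ L * γ ^ 2 * v := by positivity
  have z4 : 0 ≤ ρ * L * γ ^ 2 * s := by positivity
  linarith

/-- The letters are those of `nonconvex_recursion`, except that `x` is the squared distance to the
minimizer and `F` the expected suboptimality. Per unit of `u`, the weight `1000 ρ` gains `1000 ρ *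
(d/8) = 125 γ L`, against `64 γ L` from the spread and small contributions of the displacement. The
surplus `10 γ L` is retained because under strong convexity it makes the network part decay too. -/
theorem convex_recursion {γ L d ρ x x' F u u' p B β a s v : ℝ} (hd : 0 < d) (hd1 : d ≤ 1)
    (hL : 0 < L) (hγ : 0 < γ) (hρ0 : 0 ≤ ρ) (hρ1 : ρ ≤ 1 / 100) (hγL : γ * L = ρ * d)
    (hu : 0 ≤ u) (hβ : 0 ≤ β) (ha : 0 ≤ a) (hs : 0 ≤ s) (hv : 0 ≤ v) (hF : 0 ≤ F)
    (h1 : u' ≤ (1 - d / 4) * u + 12 * γ ^ 2 * L ^ 2 / d * p + 12 * γ ^ 2 * L ^ 2 / d ^ 2 * B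
      + 2 * γ ^ 2 * s)
    (h2 : p ≤ 64 * u + 8 * γ ^ 2 * β + 8 * γ ^ 2 * s)
    (h3 : B ≤ 2 * γ ^ 2 * a + 2 * γ ^ 2 * v)
    (hβF : β ≤ 2 * L * F) (haF : a ≤ 4 * L * F + 2 * L ^ 2 * p)
    (hx : x' ≤ x - 2 * γ * F + γ * L * p + B) :
    x' + 1000 * ρ * u' ≤ x + 1000 * ρ * u - γ * F - 10 * (γ * L) * u + 3 * γ ^ 2 * v
      + 5000 * ρ * γ ^ 2 * s := by
  have h := networkError_recursion hd hd1 hρ0 hρ1 hγL hu hβ ha hs hv h1 h2 h3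
  have hρd : ρ * d ≤ 1 / 100 := by nlinarith
  have hρd0 : 0 ≤ ρ * d := by positivity
  have hγL1 : γ * L ≤ 1 / 100 := hγL ▸ hρd
  have hγL0 : 0 < γ * L := by positivity
  have z1 : 0 ≤ γ * F := by positivity
  -- the gradient terms, multiplied by `γ ^ 2`
  have g1 : γ ^ 2 * β ≤ 1 / 50 * (γ * F) := by
    calc γ ^ 2 * β ≤ γ ^ 2 * (2 * L * F) := by gcongr
      _ = 2 * (γ * L) * (γ * F) := by ring
      _ ≤ 2 * (1 / 100) * (γ * F) := by gcongr
      _ = _ := by ring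
  have gp : γ * L * p ≤ 64 * (γ * L * u) + 8 * (γ * L) * (1 / 50 * (γ * F) + γ ^ 2 * s) := by
    calc γ * L * p ≤ γ * L * (64 * u + 8 * γ ^ 2 * β + 8 * γ ^ 2 * s) := by gcongr
      _ = 64 * (γ * L * u) + 8 * (γ * L) * (γ ^ 2 * β + γ ^ 2 * s) := by ring
      _ ≤ _ := by gcongr
  have gF : γ * L * (γ * F) ≤ 1 / 100 * (γ * F) := by gcongr
  have hLs : γ * L * (γ ^ 2 * s) ≤ ρ * (γ ^ 2 * s) := by
    rw [hγL]
    have : ρ * d ≤ ρ := by nlinarith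
    gcongr
  have hLs' : ρ * (γ ^ 2 * s) ≤ 1 / 100 * (γ ^ 2 * s) := by gcongr
  have gp' : γ * L * p ≤ 64 * (γ * L * u) + 1 / 500 * (γ * F) + 8 * (ρ * (γ ^ 2 * s)) := by
    linarith
  have g2 : γ ^ 2 * a ≤ 1 / 25 * (γ * F) + 1 / 50 * (64 * (γ * L * u) + 1 / 500 * (γ * F)
      + 8 * (ρ * (γ ^ 2 * s))) := by
    calc γ ^ 2 * a ≤ γ ^ 2 * (4 * L * F + 2 * L ^ 2 * p) := by gcongr
      _ = 4 * (γ * L * (γ * F)) + 2 * (γ * L) * (γ * L * p) := by ring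
      _ ≤ 4 * (1 / 100 * (γ * F)) + 2 * (γ * L) * (64 * (γ * L * u) + 1 / 500 * (γ * F)
            + 8 * (ρ * (γ ^ 2 * s))) := by gcongr
      _ ≤ 4 * (1 / 100 * (γ * F)) + 2 * (1 / 100) * (64 * (γ * L * u) + 1 / 500 * (γ * F)
            + 8 * (ρ * (γ ^ 2 * s))) := by gcongr
      _ = _ := by ring
  have k0 := mul_le_mul_of_nonneg_left h (show 0 ≤ 1000 * ρ by positivity)
  have hru : ρ * (d * u) = γ * L * u := by rw [hγL]; ring
  have c1 : ρ * (γ ^ 2 * β) ≤ 1 / 100 * (γ ^ 2 * β) := by gcongr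
  have c2 : ρ * (γ ^ 2 * a) ≤ 1 / 100 * (γ ^ 2 * a) := by gcongr
  have c3 : ρ * (γ ^ 2 * v) ≤ 1 / 100 * (γ ^ 2 * v) := by gcongr
  have z2 : 0 ≤ γ * L * u := by positivity
  have z3 : 0 ≤ γ ^ 2 * v := by positivity
  have z4 : 0 ≤ ρ * (γ ^ 2 * s) := by positivity
  linarith

theorem sum_le_of_descent {Ψ E : ℕ → ℝ} {c ε : ℝ} {R : ℕ}
    (h : ∀ r, Ψ (r + 1) ≤ Ψ r - c * E r + ε) :
    c * ∑ r ∈ Finset.range R, E r ≤ Ψ 0 - Ψ R + R * ε := by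
  induction R with
  | zero => simp
  | succ R ih =>
    rw [Finset.sum_range_succ]
    push_cast
    linarith [h R]

theorem le_of_geometric {Ψ : ℕ → ℝ} {q ε : ℝ} (hq0 : 0 < q) (hq1 : q ≤ 1) (hε : 0 ≤ ε)
    (h : ∀ r, Ψ (r + 1) ≤ (1 - q) * Ψ r + ε) (h0 : 0 ≤ Ψ 0) (R : ℕ) :
    Ψ R ≤ Real.exp (-(q * R)) * Ψ 0 + ε / q := by
  have h1 : ∀ R : ℕ, Ψ R ≤ (1 - q) ^ R * Ψ 0 + (1 - (1 - q) ^ R) * (ε / q) := by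
    intro R
    induction R with
    | zero => simp
    | succ R ih =>
      have h2 := mul_le_mul_of_nonneg_left ih (sub_nonneg.2 hq1)
      have h3 : ε = q * (ε / q) := by field_simp
      rw [pow_succ']
      calc Ψ (R + 1) ≤ (1 - q) * Ψ R + ε := h R
        _ ≤ (1 - q) * ((1 - q) ^ R * Ψ 0 + (1 - (1 - q) ^ R) * (ε / q)) + q * (ε / q) := by linarith
        _ = _ := by ring
  have hexp : (1 - q) ^ R ≤ Real.exp (-(q * R)) := by
    calc (1 - q) ^ R ≤ Real.exp (-q) ^ R :=
          pow_le_pow_left₀ (sub_nonneg.2 hq1) (Real.one_sub_le_exp_neg q) R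
      _ = Real.exp (-(q * R)) := by rw [← Real.exp_nat_mul]; ring_nf
  have hq2 : 0 ≤ (1 - q) ^ R := pow_nonneg (sub_nonneg.2 hq1) R
  have k1 := mul_le_mul_of_nonneg_right hexp h0
  have k2 : 0 ≤ (1 - q) ^ R * (ε / q) := by positivity
  linarith [h1 R]

end Recursions

/-! ### Lyapunov descent for the nonconvex and convex cases -/

section Rates

variable {ℋ : Type*} [NormedAddCommGroup ℋ] [InnerProductSpace ℝ ℋ] {N : ℕ}

theorem mean_sub (a c : Fin N → ℋ) : mean (fun i => a i - c i) = mean a - mean c := by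
  simp only [mean, Finset.sum_sub_distrib, smul_sub]

theorem norm_time_average_sq_le {τ : ℕ} (a : ℕ → ℋ) :
    ‖(1 / (τ : ℝ)) • ∑ t ∈ Finset.range τ, a t‖ ^ 2
      ≤ 1 / (τ : ℝ) * ∑ t ∈ Finset.range τ, ‖a t‖ ^ 2 := by
  rcases Nat.eq_zero_or_pos τ with rfl | hτ
  · simp
  have hτ' : (0 : ℝ) < τ := by exact_mod_cast hτ
  have h := norm_sum_sq_le (Finset.range τ) a
  rw [Finset.card_range] at h
  rw [norm_smul, Real.norm_of_nonneg (by positivity), mul_pow]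
  calc (1 / (τ : ℝ)) ^ 2 * ‖∑ t ∈ Finset.range τ, a t‖ ^ 2
      ≤ (1 / (τ : ℝ)) ^ 2 * (τ * ∑ t ∈ Finset.range τ, ‖a t‖ ^ 2) := by gcongr
    _ = _ := by field_simp

namespace Trajectory

variable {W : Matrix (Fin N) (Fin N) ℝ} {α L σ l : ℝ} {τ : ℕ} {X Y D : ℕ → Fin N → ℋ}
  {Φ g n : ℕ → ℕ → Fin N → ℋ} {b : Fin N → Fin N → ℝ} {w : Fin N → ℝ}

theorem norm_mean_sub_sq_le (h : Trajectory W α L σ τ X Y D Φ g n) (r : ℕ) {t : ℕ} (ht : t < τ) :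
    ‖mean (g r t) - mean (D r)‖ ^ 2
      ≤ L ^ 2 * (1 / (N : ℝ) * ∑ i, ‖Φ r t i - mean (X r)‖ ^ 2) := by
  rw [← mean_sub]
  refine (norm_mean_sq_le _).trans ?_
  rw [mul_left_comm, Finset.mul_sum _ _ (L ^ 2)]
  refine mul_le_mul_of_nonneg_left (Finset.sum_le_sum fun i _ => ?_) (by positivity)
  rw [← mul_pow]
  exact pow_le_pow_left₀ (norm_nonneg _) (h.dist_g r t ht i) 2

theorem time_average_norm_mean_sub_sq_le (h : Trajectory W α L σ τ X Y D Φ g n) (r : ℕ) :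
    1 / (τ : ℝ) * ∑ t ∈ Finset.range τ, ‖mean (g r t) - mean (D r)‖ ^ 2
      ≤ L ^ 2 * spread τ (X r) (Φ r) := by
  rw [spread, mul_left_comm, Finset.mul_sum _ _ (L ^ 2)]
  refine mul_le_mul_of_nonneg_left (Finset.sum_le_sum fun t ht => ?_) (by positivity)
  exact h.norm_mean_sub_sq_le r (Finset.mem_range.1 ht)

theorem norm_roundGradient_sq_le_average (g : ℕ → Fin N → ℋ) :
    ‖roundGradient τ g‖ ^ 2 ≤ 1 / (τ : ℝ) * ∑ t ∈ Finset.range τ, ‖mean (g t)‖ ^ 2 :=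
  norm_time_average_sq_le _

theorem roundGradient_sub (hτ : 0 < τ) (g : ℕ → Fin N → ℋ) (c : ℋ) :
    roundGradient τ g - c = (1 / (τ : ℝ)) • ∑ t ∈ Finset.range τ, (mean (g t) - c) := by
  have hτ' : (τ : ℝ) ≠ 0 := by positivity
  rw [Finset.sum_sub_distrib, Finset.sum_const, Finset.card_range, ← Nat.cast_smul_eq_nsmul ℝ,
    smul_sub, smul_smul, one_div_mul_cancel hτ', one_smul, roundGradient]

theorem norm_roundGradient_sq_le (h : Trajectory W α L σ τ X Y D Φ g n) (hτ : 0 < τ) (r : ℕ) :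
    ‖roundGradient τ (g r)‖ ^ 2
      ≤ 2 * ‖mean (D r)‖ ^ 2 + 2 * L ^ 2 * spread τ (X r) (Φ r) := by
  have h1 := norm_add_sq_le_two (mean (D r)) (roundGradient τ (g r) - mean (D r))
  rw [add_sub_cancel, roundGradient_sub hτ] at h1
  have h2 := (norm_time_average_sq_le (τ := τ) fun t => mean (g r t) - mean (D r)).trans
    (h.time_average_norm_mean_sub_sq_le r)
  linarith

theorem inner_mean_noise {a : ℋ} {r : ℕ} (ha : ∀ t < τ, ∀ i, inner ℝ a (n r t i) = 0) :
    inner ℝ a (∑ t ∈ Finset.range τ, mean (n r t)) = 0 := by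
  rw [inner_sum]
  refine Finset.sum_eq_zero fun t ht => ?_
  rw [mean, inner_smul_right, inner_sum,
    Finset.sum_eq_zero fun i _ => ha t (Finset.mem_range.1 ht) i, mul_zero]

theorem inner_mean_left {a : Fin N → ℋ} {c : ℋ} (h : ∀ j, inner ℝ (a j) c = 0) :
    inner ℝ (mean a) c = 0 := by
  rw [mean, inner_smul_left, sum_inner, Finset.sum_eq_zero fun j _ => h j, mul_zero]

/-- The summed descent inequality in the nonconvex case. -/
theorem nonconvex_sum_le (h : Trajectory W α L σ τ X Y D Φ g n) (hN : 0 < N) (hτ : 0 < τ)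
    (hb : ModalBasis W l b w) (hl0 : 0 ≤ l) (hl : l < 1) (hW : W ∈ doublyStochastic ℝ (Fin N))
    (h0 : ∑ i, Y 0 i = 0) (hL : 0 < L) (hα : 0 < α) (hαL : α * τ * L ≤ (1 - l) / 100)
    {F : ℕ → ℝ} {c : ℝ} (hc : ∀ r, c ≤ F r)
    (hF : ∀ r, F (r + 1) ≤ F r + inner ℝ (mean (D r)) (mean (X (r + 1)) - mean (X r))
      + L / 2 * ‖mean (X (r + 1)) - mean (X r)‖ ^ 2) (R : ℕ) :
    α * τ / 4 * ∑ r ∈ Finset.range R, (‖mean (D r)‖ ^ 2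
        + 1 / (τ : ℝ) * ∑ t ∈ Finset.range τ, ‖mean (g r t)‖ ^ 2)
      ≤ F 0 - c + 256 * (α * τ * L / (1 - l)) * L
          * networkError l (α * τ) b w (X 0) (Y 0) (D 0)
        + R * (2 * L * (α * τ) ^ 2 * (σ ^ 2 / (N * τ))
          + 800 * (α * τ * L / (1 - l) * L) * (α * τ) ^ 2 * (σ ^ 2 / τ)) := by
  have hN' : (0 : ℝ) < N := by exact_mod_cast hN
  have hτ' : (0 : ℝ) < τ := by exact_mod_cast hτ
  have hd0 : 0 < 1 - l := by linarith
  have hγ : 0 < α * τ := by positivity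
  set ρ := α * τ * L / (1 - l) with hρ
  have hρ0 : 0 ≤ ρ := by positivity
  have hρ1 : ρ ≤ 1 / 100 := by
    rw [hρ, div_le_iff₀ hd0]
    linarith
  have hγL : α * τ * L = ρ * (1 - l) := by rw [hρ]; field_simp
  have hα8 : 8 * (α * τ) ^ 2 * L ^ 2 ≤ 1 := by
    have h1 : α * τ * L ≤ 1 / 100 := by linarith
    have h2 := pow_le_pow_left₀ (show 0 ≤ α * τ * L by positivity) h1 2
    nlinarith
  have hdesc : ∀ r, F (r + 1) ≤ F r - α * τ / 2 * (‖mean (D r)‖ ^ 2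
        + 1 / (τ : ℝ) * ∑ t ∈ Finset.range τ, ‖mean (g r t)‖ ^ 2)
      + α * τ * L ^ 2 / 2 * spread τ (X r) (Φ r)
      + L / 2 * ‖mean (X (r + 1)) - mean (X r)‖ ^ 2 := by
    intro r
    have h1 : inner ℝ (mean (D r)) (mean (X (r + 1)) - mean (X r))
        = -(α * τ * inner ℝ (mean (D r)) (roundGradient τ (g r))) := by
      rw [h.mean_succ hτ hW h0, inner_neg_right, inner_add_right, inner_smul_right,
        inner_smul_right, inner_mean_noise fun t ht i =>
          inner_mean_left fun j => h.inner_D r t ht i j]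
      ring
    -- Polarization at every local step, averaged over the round, yields both gradient terms of the
    -- stationarity measure; the squared difference is bounded by the spread.
    have h2 : 2 * inner ℝ (mean (D r)) (roundGradient τ (g r)) = ‖mean (D r)‖ ^ 2
        + 1 / (τ : ℝ) * ∑ t ∈ Finset.range τ, ‖mean (g r t)‖ ^ 2
        - 1 / (τ : ℝ) * ∑ t ∈ Finset.range τ, ‖mean (g r t) - mean (D r)‖ ^ 2 := by
      have h3 : ∀ t, ‖mean (g r t) - mean (D r)‖ ^ 2
          = ‖mean (g r t)‖ ^ 2 + ‖mean (D r)‖ ^ 2 - 2 * inner ℝ (mean (D r)) (mean (g r t)) := by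
        intro t
        rw [norm_sub_sq_real, real_inner_comm]
        ring
      simp_rw [h3]
      rw [Finset.sum_sub_distrib, Finset.sum_add_distrib, Finset.sum_const, Finset.card_range,
        nsmul_eq_mul, ← Finset.mul_sum, roundGradient, inner_smul_right, inner_sum]
      field_simp
      ring
    have h4 := h.time_average_norm_mean_sub_sq_le r
    have h5 := mul_le_mul_of_nonneg_left h4 hγ.le
    have h6 := hF r
    rw [h1] at h6
    have h7 : α * τ * (2 * inner ℝ (mean (D r)) (roundGradient τ (g r)))
      = α * τ * (‖mean (D r)‖ ^ 2
        + 1 / (τ : ℝ) * ∑ t ∈ Finset.range τ, ‖mean (g r t)‖ ^ 2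
        - 1 / (τ : ℝ) * ∑ t ∈ Finset.range τ, ‖mean (g r t) - mean (D r)‖ ^ 2) := by rw [h2]
    linarith
  have hrec : ∀ r, F (r + 1) + 256 * ρ * L
        * networkError l (α * τ) b w (X (r + 1)) (Y (r + 1)) (D (r + 1))
      ≤ F r + 256 * ρ * L * networkError l (α * τ) b w (X r) (Y r) (D r)
        - α * τ / 4 * (‖mean (D r)‖ ^ 2
          + 1 / (τ : ℝ) * ∑ t ∈ Finset.range τ, ‖mean (g r t)‖ ^ 2)
        + (2 * L * (α * τ) ^ 2 * (σ ^ 2 / (N * τ))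
          + 800 * (ρ * L) * (α * τ) ^ 2 * (σ ^ 2 / τ)) := by
    intro r
    have := nonconvex_recursion hd0 (by linarith) hL hγ hρ0 hρ1 hγL
      (networkError_nonneg hb hl _ _ _ _) (sq_nonneg _) (sq_nonneg _)
      (norm_roundGradient_sq_le_average (g r)) (by positivity) (by positivity)
      (h.networkError_succ_le hN hτ hb hl r) (h.spread_le hN hτ hb hl hW h0 hα8 r)
      (h.displacement_le hN hτ hW h0 r) (hdesc r)
    linarith
  have hsum := sum_le_of_descent (R := R) (Ψ := fun r => F r + 256 * ρ * L
    * networkError l (α * τ) b w (X r) (Y r) (D r)) hrec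
  -- At the end of the horizon the nonnegative network error is dropped and the cost is replaced by
  -- its lower bound.
  have hlast : c ≤ F R + 256 * ρ * L * networkError l (α * τ) b w (X R) (Y R) (D R) := by
    have h1 := networkError_nonneg hb hl (α * τ) (X R) (Y R) (D R)
    have h2 : 0 ≤ 256 * ρ * L * networkError l (α * τ) b w (X R) (Y R) (D R) := by positivity
    linarith [hc R]
  linarith

/-- One round in the convex case. Here `f r i` stands for the (expected) suboptimality of the
`i`-th local cost at the average iterate. -/
theorem convex_succ_le (h : Trajectory W α L σ τ X Y D Φ g n) (hN : 0 < N) (hτ : 0 < τ)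
    (hb : ModalBasis W l b w) (hl0 : 0 ≤ l) (hl : l < 1) (hW : W ∈ doublyStochastic ℝ (Fin N))
    (h0 : ∑ i, Y 0 i = 0) (hL : 0 < L) (hα : 0 < α) (hαL : α * τ * L ≤ (1 - l) / 100)
    {f : ℕ → Fin N → ℝ} {F : ℕ → ℝ} {xs : ℋ} (hFf : ∀ r, F r = 1 / (N : ℝ) * ∑ i, f r i)
    (hF0 : ∀ r, 0 ≤ F r)
    (hf : ∀ r, ∀ t < τ, ∀ i, f r i ≤ inner ℝ (g r t i) (mean (X r) - xs)
      + L / 2 * ‖Φ r t i - mean (X r)‖ ^ 2)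
    (hβ : ∀ r, ‖mean (D r)‖ ^ 2 ≤ 2 * L * F r)
    (hxs : ∀ r, ∀ t < τ, ∀ i, inner ℝ xs (n r t i) = 0) (r : ℕ) :
    ‖mean (X (r + 1)) - xs‖ ^ 2 + 1000 * (α * τ * L / (1 - l))
        * networkError l (α * τ) b w (X (r + 1)) (Y (r + 1)) (D (r + 1))
      ≤ ‖mean (X r) - xs‖ ^ 2 + 1000 * (α * τ * L / (1 - l))
          * networkError l (α * τ) b w (X r) (Y r) (D r)
        - α * τ * F r - 10 * (α * τ * L) * networkError l (α * τ) b w (X r) (Y r) (D r)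
        + 3 * (α * τ) ^ 2 * (σ ^ 2 / (N * τ))
        + 5000 * (α * τ * L / (1 - l)) * (α * τ) ^ 2 * (σ ^ 2 / τ) := by
  have hN' : (0 : ℝ) < N := by exact_mod_cast hN
  have hτ' : (0 : ℝ) < τ := by exact_mod_cast hτ
  have hd0 : 0 < 1 - l := by linarith
  have hγ : 0 < α * τ := by positivity
  set ρ := α * τ * L / (1 - l) with hρ
  have hρ0 : 0 ≤ ρ := by positivity
  have hρ1 : ρ ≤ 1 / 100 := by
    rw [hρ, div_le_iff₀ hd0]
    linarith
  have hγL : α * τ * L = ρ * (1 - l) := by rw [hρ]; field_simp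
  have hα8 : 8 * (α * τ) ^ 2 * L ^ 2 ≤ 1 := by
    have h1 : α * τ * L ≤ 1 / 100 := by linarith
    have h2 := pow_le_pow_left₀ (show 0 ≤ α * τ * L by positivity) h1 2
    nlinarith
  have hx : ‖mean (X (r + 1)) - xs‖ ^ 2 ≤ ‖mean (X r) - xs‖ ^ 2 - 2 * (α * τ) * F r
      + α * τ * L * spread τ (X r) (Φ r) + ‖mean (X (r + 1)) - mean (X r)‖ ^ 2 := by
    have h1 : mean (X (r + 1)) - xs = (mean (X r) - xs) + (mean (X (r + 1)) - mean (X r)) := by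
      abel
    have h2 : inner ℝ (mean (X r) - xs) (mean (X (r + 1)) - mean (X r))
        = -(α * τ * inner ℝ (mean (X r) - xs) (roundGradient τ (g r))) := by
      -- The noise is orthogonal to the average iterate at the start of the round and to the
      -- minimizer, so it contributes only through the squared displacement.
      rw [h.mean_succ hτ hW h0, inner_neg_right, inner_add_right, inner_smul_right,
        inner_smul_right, inner_mean_noise fun t ht i => by
          rw [inner_sub_left, inner_mean_left fun j => h.inner_X r t ht i j, hxs r t ht i, sub_zero]]
      ring
    have h3 : F r ≤ inner ℝ (mean (X r) - xs) (roundGradient τ (g r))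
        + L / 2 * spread τ (X r) (Φ r) := by
      have ht : ∀ t ∈ Finset.range τ, F r ≤ inner ℝ (mean (X r) - xs) (mean (g r t))
          + L / 2 * (1 / (N : ℝ) * ∑ i, ‖Φ r t i - mean (X r)‖ ^ 2) := by
        intro t ht
        have h4 := mul_le_mul_of_nonneg_left (Finset.sum_le_sum fun i (_ : i ∈ Finset.univ) =>
          hf r t (Finset.mem_range.1 ht) i) (show 0 ≤ 1 / (N : ℝ) by positivity)
        rw [← hFf, Finset.sum_add_distrib, ← Finset.mul_sum, ← sum_inner] at h4
        rw [real_inner_comm, show mean (g r t) = (1 / (N : ℝ)) • ∑ i, g r t i from rfl,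
          inner_smul_left, conj_trivial]
        linarith
      have h5 := mul_le_mul_of_nonneg_left (Finset.sum_le_sum ht)
        (show 0 ≤ 1 / (τ : ℝ) by positivity)
      rw [Finset.sum_const, Finset.card_range, nsmul_eq_mul, Finset.sum_add_distrib,
        ← Finset.mul_sum _ _ (L / 2), ← inner_sum, ← mul_assoc, one_div_mul_cancel hτ'.ne',
        one_mul] at h5
      rw [spread, roundGradient, inner_smul_right]
      linarith
    rw [h1, norm_add_sq_real, h2]
    have h6 := mul_le_mul_of_nonneg_left h3 hγ.le
    linarith
  refine convex_recursion hd0 (by linarith) hL hγ hρ0 hρ1 hγL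
      (networkError_nonneg hb hl _ _ _ _) (sq_nonneg _) (sq_nonneg _)
      (by positivity) (by positivity) (hF0 r)
      (h.networkError_succ_le hN hτ hb hl r) (h.spread_le hN hτ hb hl hW h0 hα8 r)
      (h.displacement_le hN hτ hW h0 r) (hβ r) ?_ hx
  linarith [h.norm_roundGradient_sq_le hτ r, hβ r]

end Trajectory

end Rates

/-! ### Choice of the step size -/

section StepSizes

/-- The step size of the sublinear rates. -/
theorem exists_sublinear_stepSize {L d σ : ℝ} {N τ R : ℕ} (hL : 0 < L) (hd : 0 < d) (hσ : 0 ≤ σ)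
    (hN : 0 < N) (hτ : 0 < τ) (hR : 0 < R) :
    ∃ γ : ℝ, 0 < γ ∧ γ * L ≤ d / 100 ∧
      1 / (γ * R) ≤ 100 * L / (d * R) + (σ ^ 2 / (N * τ * R)) ^ (1 / 2 : ℝ)
        + 1 / d ^ (1 / 3 : ℝ) * (σ / (√(τ : ℝ) * R)) ^ (2 / 3 : ℝ) ∧
      γ * (σ ^ 2 / (N * τ)) ≤ (σ ^ 2 / (N * τ * R)) ^ (1 / 2 : ℝ) ∧
      γ ^ 2 * (σ ^ 2 / τ) / d ≤ 1 / d ^ (1 / 3 : ℝ) * (σ / (√(τ : ℝ) * R)) ^ (2 / 3 : ℝ) := by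
  have hN' : (0 : ℝ) < N := by exact_mod_cast hN
  have hτ' : (0 : ℝ) < τ := by exact_mod_cast hτ
  have hR' : (0 : ℝ) < R := by exact_mod_cast hR
  set A := (σ ^ 2 / (N * τ * R)) ^ (1 / 2 : ℝ) with hA
  set B := 1 / d ^ (1 / 3 : ℝ) * (σ / (√(τ : ℝ) * R)) ^ (2 / 3 : ℝ) with hB
  have hA0 : 0 ≤ A := by positivity
  have hB0 : 0 ≤ B := by positivity
  have hA2 : A ^ 2 = σ ^ 2 / (N * τ * R) := by
    rw [hA, ← Real.rpow_natCast, ← Real.rpow_mul (by positivity)]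
    norm_num
  have hB3 : B ^ 3 = σ ^ 2 / (d * τ * R ^ 2) := by
    rw [hB, mul_pow, div_pow, one_pow, ← Real.rpow_natCast, ← Real.rpow_mul hd.le,
      ← Real.rpow_natCast ((σ / (√(τ : ℝ) * R)) ^ (2 / 3 : ℝ)), ← Real.rpow_mul (by positivity)]
    norm_num
    rw [div_pow, mul_pow, Real.sq_sqrt hτ'.le]
    field_simp
  have hden : 0 < 100 * L / d + A * R + B * R := by positivity
  -- A smooth minimum of the three caps `d/(100 L)`, `1/(A R)` and `1/(B R)`: the products of `γ`
  -- with the summands of the denominator add up to one, so each is at most one, while `1/(γ R)` is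
  -- exactly the sum of the target terms. `A` and `B` satisfy `A² R = σ²/(N τ)` and `B³ R² = σ²/(τ
  -- d)`.
  set γ := 1 / (100 * L / d + A * R + B * R) with hγ
  have hγ0 : 0 < γ := by positivity
  have hone : γ * (100 * L / d) + γ * (A * R) + γ * (B * R) = 1 := by
    rw [← mul_add, ← mul_add, hγ, one_div_mul_cancel hden.ne']
  have p1 : 0 ≤ γ * (100 * L / d) := by positivity
  have p2 : 0 ≤ γ * (A * R) := by positivity
  have p3 : 0 ≤ γ * (B * R) := by positivity
  refine ⟨γ, hγ0, ?_, ?_, ?_, ?_⟩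
  · have h1 : γ * (100 * L / d) ≤ 1 := by linarith
    have h2 : γ * L = γ * (100 * L / d) * (d / 100) := by field_simp
    rw [h2]
    exact mul_le_of_le_one_left (by positivity) h1
  · refine le_of_eq ?_
    rw [hγ]
    field_simp
  · have h1 : σ ^ 2 / (N * τ) = A ^ 2 * R := by rw [hA2]; field_simp
    have h2 : γ * (A ^ 2 * R) = A * (γ * (A * R)) := by ring
    rw [h1, h2]
    exact mul_le_of_le_one_right hA0 (by linarith)
  · have h1 : γ ^ 2 * (σ ^ 2 / τ) / d = B * (γ * (B * R)) ^ 2 := by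
      have : B * (γ * (B * R)) ^ 2 = B ^ 3 * (γ ^ 2 * R ^ 2) := by ring
      rw [this, hB3]
      field_simp
    rw [h1]
    exact mul_le_of_le_one_right hB0 (pow_le_one₀ p3 (by linarith))

/-- From a summed descent inequality to the sublinear rate. -/
theorem average_le_sublinearRate {L d σ γ S Δ₀ u₀ χ ς c₁ c₂ c₃ Δ X l : ℝ} {N τ R : ℕ} (hL : 0 < L)
    (hl : l < 1) (hd : d = 1 - l) (hR : 0 < R) (hτ : 0 < τ)
    (hc₁ : 0 ≤ c₁) (hc₂ : 0 ≤ c₂) (hc₃ : 0 ≤ c₃) (hς : 0 ≤ ς)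
    (hΔ0 : 0 ≤ Δ) (hX0 : 0 ≤ X) (hγ : 0 < γ) (hγL : γ * L ≤ d / 100) (hσ : 0 ≤ σ)
    (hγR : 1 / (γ * R) ≤ 100 * L / (d * R) + (σ ^ 2 / (N * τ * R)) ^ (1 / 2 : ℝ)
        + 1 / d ^ (1 / 3 : ℝ) * (σ / (√(τ : ℝ) * R)) ^ (2 / 3 : ℝ))
    (hγ1 : γ * (σ ^ 2 / (N * τ)) ≤ (σ ^ 2 / (N * τ * R)) ^ (1 / 2 : ℝ))
    (hγ2 : γ ^ 2 * (σ ^ 2 / τ) / d ≤ 1 / d ^ (1 / 3 : ℝ) * (σ / (√(τ : ℝ) * R)) ^ (2 / 3 : ℝ))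
    (hS : γ * S ≤ Δ₀ + c₁ * (γ / d) * u₀
      + R * (c₂ * γ ^ 2 * (σ ^ 2 / (N * τ)) + c₃ * (γ / d) * γ ^ 2 * (σ ^ 2 / τ)))
    (hu : u₀ ≤ 3 * χ + 2 * γ ^ 2 / d * ς) (hχ : χ ≤ X) (hΔ : Δ₀ ≤ Δ) :
    1 / (R : ℝ) * S ≤ sublinearRate
      (Δ * (100 * L + 1) + 3 * c₁ * X + 2 * c₁ / L ^ 2 + c₂ + c₃ + 1) σ l ς N τ R := by
  have hR' : (0 : ℝ) < R := by exact_mod_cast hR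
  have hτ' : (0 : ℝ) < τ := by exact_mod_cast hτ
  have hd0 : 0 < d := by linarith
  unfold sublinearRate
  rw [← hd]
  set A := (σ ^ 2 / (N * τ * R)) ^ (1 / 2 : ℝ) with hA
  set B := 1 / d ^ (1 / 3 : ℝ) * (σ / (√(τ : ℝ) * R)) ^ (2 / 3 : ℝ) with hB
  have hA0 : 0 ≤ A := by positivity
  have hB0 : 0 ≤ B := by positivity
  have hdR : 0 ≤ 1 / d / R := by positivity
  have hςR : 0 ≤ ς / R := by positivity
  have h1 : 1 / (R : ℝ) * S ≤ Δ₀ * (1 / (γ * R)) + c₁ * (1 / d / R) * u₀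
      + (c₂ * (γ * (σ ^ 2 / (N * τ))) + c₃ * (γ ^ 2 * (σ ^ 2 / τ) / d)) := by
    have h2 := mul_le_mul_of_nonneg_left hS (show 0 ≤ 1 / (γ * R) by positivity)
    have h3 : 1 / (γ * R) * (γ * S) = 1 / (R : ℝ) * S := by field_simp
    have h4 : 1 / (γ * R) * (Δ₀ + c₁ * (γ / d) * u₀
        + R * (c₂ * γ ^ 2 * (σ ^ 2 / (N * τ)) + c₃ * (γ / d) * γ ^ 2 * (σ ^ 2 / τ)))
        = Δ₀ * (1 / (γ * R)) + c₁ * (1 / d / R) * u₀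
          + (c₂ * (γ * (σ ^ 2 / (N * τ))) + c₃ * (γ ^ 2 * (σ ^ 2 / τ) / d)) := by
      rw [mul_add, mul_add]
      congr 1
      · congr 1
        · ring
        · field_simp
      · generalize σ ^ 2 / (N * τ) = v
        field_simp
    rw [h3, h4] at h2
    exact h2
  have t1 : Δ₀ * (1 / (γ * R)) ≤ Δ * (100 * L * (1 / d / R) + A + B) := by
    have h2 : 100 * L / (d * R) = 100 * L * (1 / d / R) := by field_simp
    calc Δ₀ * (1 / (γ * R)) ≤ Δ * (1 / (γ * R)) := by gcongr
      _ ≤ Δ * (100 * L / (d * R) + A + B) := by gcongr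
      _ = _ := by rw [h2]
  have t2 : c₁ * (1 / d / R) * u₀ ≤ 3 * c₁ * X * (1 / d / R) + 2 * c₁ / L ^ 2 * (ς / R) := by
    have h2 : γ ^ 2 * L ^ 2 ≤ d ^ 2 := by
      rw [← mul_pow]
      exact pow_le_pow_left₀ (by positivity) (by linarith) 2
    -- The initial dual error carries `γ²/d`, and `γ L ≤ d` turns the resulting `γ²/d²` into `1/L²`.
    -- Hence the heterogeneity is not multiplied by `1/d`.
    have h3 : c₁ * (1 / d / R) * (2 * γ ^ 2 / d * ς) ≤ 2 * c₁ / L ^ 2 * (ς / R) := by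
      have h4 : c₁ * (1 / d / R) * (2 * γ ^ 2 / d * ς)
        = 2 * c₁ / L ^ 2 * (ς / R) * (γ ^ 2 * L ^ 2 / d ^ 2) := by field_simp
      rw [h4]
      apply mul_le_of_le_one_right (by positivity)
      rw [div_le_one (by positivity)]
      exact h2
    calc c₁ * (1 / d / R) * u₀ ≤ c₁ * (1 / d / R) * (3 * X + 2 * γ ^ 2 / d * ς) := by
          apply mul_le_mul_of_nonneg_left (by linarith) (by positivity)
      _ ≤ _ := by linarith
  have t3 := mul_le_mul_of_nonneg_left hγ1 hc₂
  have t4 := mul_le_mul_of_nonneg_left hγ2 hc₃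
  set c₄ := 2 * c₁ / L ^ 2 with hc₄
  have hc₄0 : 0 ≤ c₄ := by positivity
  have hsplit : (1 / d + ς) / (R : ℝ) = 1 / d / R + ς / R := add_div _ _ _
  rw [hsplit]
  -- One constant serves all three terms of the rate; the superfluous products are nonnegative and
  -- are listed for `linarith`.
  have q1 : 0 ≤ Δ * L := by positivity
  have q2 : 0 ≤ c₁ * X := by positivity
  have m1 := mul_nonneg q1 hA0
  have m2 := mul_nonneg q1 hB0
  have m3 := mul_nonneg q1 hςR
  have m4 := mul_nonneg hΔ0 hdR
  have m5 := mul_nonneg hΔ0 hςR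
  have m6 := mul_nonneg q2 hA0
  have m7 := mul_nonneg q2 hB0
  have m8 := mul_nonneg q2 hςR
  have m9 := mul_nonneg hc₄0 hA0
  have m10 := mul_nonneg hc₄0 hB0
  have m11 := mul_nonneg hc₄0 hdR
  have m12 := mul_nonneg hc₂ hB0
  have m13 := mul_nonneg hc₂ hdR
  have m14 := mul_nonneg hc₂ hςR
  have m15 := mul_nonneg hc₃ hA0
  have m16 := mul_nonneg hc₃ hdR
  have m17 := mul_nonneg hc₃ hςR
  linarith

/-- The step size of the linear rate. -/
theorem exists_linear_stepSize {L μ d σ a ℓ : ℝ} {N τ R : ℕ} (hL : 0 < L) (hμ : 0 < μ)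
    (hd : 0 < d) (hN : 0 < N) (hτ : 0 < τ) (hR : 0 < R) (ha : 0 ≤ a)
    (hℓ : ℓ = Real.log (2 + N * τ * R * a / σ ^ 2)) :
    ∃ γ : ℝ, 0 < γ ∧ γ * L ≤ d / 100 ∧
      Real.exp (-(γ * μ / 2 * R)) * a
        ≤ Real.exp (-(μ / (200 * L) * d * R)) * a + 2 * ℓ * (σ ^ 2 / (τ * N * R)) ∧
      γ * (σ ^ 2 / (N * τ)) ≤ 2 / μ * (ℓ * (σ ^ 2 / (τ * N * R))) ∧
      γ ^ 2 * (σ ^ 2 / τ) / d ≤ 4 / μ ^ 2 * (ℓ ^ 2 * (σ ^ 2 / (d * τ * R ^ 2))) := by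
  have hN' : (0 : ℝ) < N := by exact_mod_cast hN
  have hτ' : (0 : ℝ) < τ := by exact_mod_cast hτ
  have hR' : (0 : ℝ) < R := by exact_mod_cast hR
  have hx0 : 0 ≤ N * τ * R * a / σ ^ 2 := by positivity
  have hℓ2 : 1 / 2 < ℓ := by
    have h1 : Real.log 2 ≤ ℓ := by
      rw [hℓ]
      exact Real.log_le_log (by norm_num) (by linarith)
    linarith [Real.log_two_gt_d9]
  have hv : 0 ≤ σ ^ 2 / (τ * N * R) := by positivity
  have hbig : Real.exp (-(d / (100 * L) * μ / 2 * R)) * a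
      ≤ Real.exp (-(μ / (200 * L) * d * R)) * a + 2 * ℓ * (σ ^ 2 / (τ * N * R)) := by
    have h1 : d / (100 * L) * μ / 2 * R = μ / (200 * L) * d * R := by field_simp; norm_num
    rw [h1]
    have : 0 ≤ 2 * ℓ * (σ ^ 2 / (τ * N * R)) := by positivity
    linarith
  have hbound : ∀ γ : ℝ, 0 < γ → γ ≤ 2 * ℓ / (μ * R) →
      γ * (σ ^ 2 / (N * τ)) ≤ 2 / μ * (ℓ * (σ ^ 2 / (τ * N * R))) ∧
      γ ^ 2 * (σ ^ 2 / τ) / d ≤ 4 / μ ^ 2 * (ℓ ^ 2 * (σ ^ 2 / (d * τ * R ^ 2))) := by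
    intro γ hγ hle
    constructor
    · calc γ * (σ ^ 2 / (N * τ)) ≤ 2 * ℓ / (μ * R) * (σ ^ 2 / (N * τ)) := by gcongr
        _ = _ := by field_simp
    · calc γ ^ 2 * (σ ^ 2 / τ) / d ≤ (2 * ℓ / (μ * R)) ^ 2 * (σ ^ 2 / τ) / d := by gcongr
        _ = _ := by field_simp; ring
  have hL100 : d / (100 * L) * L ≤ d / 100 := le_of_eq (by field_simp)
  -- Without noise the largest admissible step is taken. The quotient by `σ²` is then `0` by
  -- convention, so that `ℓ = log 2`.
  by_cases hσ : σ = 0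
  · refine ⟨d / (100 * L), by positivity, hL100, hbig, ?_, ?_⟩ <;> simp [hσ]
  -- In general `γ` is the minimum of the stability cap `d/(100 L)` and `2 ℓ/(μ R)`.
  by_cases hcase : d / (100 * L) ≤ 2 * ℓ / (μ * R)
  · exact ⟨d / (100 * L), by positivity, hL100, hbig, hbound _ (by positivity) hcase⟩
  rw [not_le] at hcase
  refine ⟨2 * ℓ / (μ * R), by positivity,
    (mul_le_mul_of_nonneg_right hcase.le hL.le).trans hL100, ?_, hbound _ (by positivity) le_rfl⟩
  -- With the second choice the decay factor is `exp (-ℓ)`, the inverse of the argument of the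
  -- logarithm, which brings `a` down to the noise level.
  have h1 : 2 * ℓ / (μ * R) * μ / 2 * R = ℓ := by field_simp
  have h2 : 0 < 2 + N * τ * R * a / σ ^ 2 := by linarith
  rw [h1, Real.exp_neg, hℓ, Real.exp_log h2, ← hℓ]
  have hσ2 : 0 < σ ^ 2 := by positivity
  have h3 : (2 + N * τ * R * a / σ ^ 2)⁻¹ * a ≤ σ ^ 2 / (τ * N * R) := by
    rw [inv_mul_le_iff₀ h2]
    have h4 : (2 + N * τ * R * a / σ ^ 2) * (σ ^ 2 / (τ * N * R))
        = 2 * (σ ^ 2 / (τ * N * R)) + a := by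
      field_simp
    rw [h4]
    linarith
  have h5 : σ ^ 2 / (τ * N * R) ≤ 2 * ℓ * (σ ^ 2 / (τ * N * R)) :=
    le_mul_of_one_le_left hv (by linarith)
  have h6 : 0 ≤ Real.exp (-(μ / (200 * L) * d * R)) * a := by positivity
  linarith

end StepSizes

/-! ### Geometric decay under strong convexity -/

section StronglyConvex

variable {ℋ : Type*} [NormedAddCommGroup ℋ] [InnerProductSpace ℝ ℋ] {N : ℕ}

/-- The linear rate in terms of the step size. -/
theorem Trajectory.strongly_convex_le {W : Matrix (Fin N) (Fin N) ℝ} {α L σ l μ χ ς a : ℝ} {τ : ℕ}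
    {X Y D : ℕ → Fin N → ℋ} {Φ g n : ℕ → ℕ → Fin N → ℋ} {b : Fin N → Fin N → ℝ} {w : Fin N → ℝ}
    (h : Trajectory W α L σ τ X Y D Φ g n) (hN : 0 < N) (hτ : 0 < τ)
    (hb : ModalBasis W l b w) (hl0 : 0 ≤ l) (hl : l < 1) (hW : W ∈ doublyStochastic ℝ (Fin N))
    (h0 : ∑ i, Y 0 i = 0) (hL : 0 < L) (hα : 0 < α) (hαL : α * τ * L ≤ (1 - l) / 100)
    {f : ℕ → Fin N → ℝ} {F : ℕ → ℝ} {xs : ℋ} (hFf : ∀ r, F r = 1 / (N : ℝ) * ∑ i, f r i)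
    (hF0 : ∀ r, 0 ≤ F r)
    (hf : ∀ r, ∀ t < τ, ∀ i, f r i ≤ inner ℝ (g r t i) (mean (X r) - xs)
      + L / 2 * ‖Φ r t i - mean (X r)‖ ^ 2)
    (hβ : ∀ r, ‖mean (D r)‖ ^ 2 ≤ 2 * L * F r)
    (hxs : ∀ r, ∀ t < τ, ∀ i, inner ℝ xs (n r t i) = 0)
    (hμ : 0 < μ) (hμL : μ ≤ L) (hquad : ∀ r, μ / 2 * ‖mean (X r) - xs‖ ^ 2 ≤ F r)
    (hχ : 0 ≤ χ) (hς : 0 ≤ ς)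
    (hu : networkError l (α * τ) b w (X 0) (Y 0) (D 0) ≤ 3 * χ + 2 * (α * τ) ^ 2 / (1 - l) * ς)
    (ha : a = ‖mean (X 0) - xs‖ ^ 2 + ς + χ) (R : ℕ) :
    ‖mean (X R) - xs‖ ^ 2 ≤ (30 + 1 / L ^ 2) * (Real.exp (-(α * τ * μ / 2 * R)) * a)
      + 6 / μ * (α * τ * (σ ^ 2 / (N * τ)))
      + 10000 * L / μ * ((α * τ) ^ 2 * (σ ^ 2 / τ) / (1 - l)) := by
  have hN' : (0 : ℝ) < N := by exact_mod_cast hN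
  have hτ' : (0 : ℝ) < τ := by exact_mod_cast hτ
  have hd0 : 0 < 1 - l := by linarith
  have hγ : 0 < α * τ := by positivity
  set γ := α * τ with hγdef
  set d := 1 - l with hd
  set ρ := γ * L / d with hρ
  have hρ0 : 0 ≤ ρ := by positivity
  have hρ1 : ρ ≤ 1 / 100 := by
    rw [hρ, div_le_iff₀ hd0]
    linarith
  have hγL : γ * L = ρ * d := by rw [hρ]; field_simp
  set U := fun r => networkError l γ b w (X r) (Y r) (D r)
  have hU0 : ∀ r, 0 ≤ U r := fun r => networkError_nonneg hb hl _ _ _ _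
  set ε := 3 * γ ^ 2 * (σ ^ 2 / (N * τ)) + 5000 * ρ * γ ^ 2 * (σ ^ 2 / τ) with hε
  set q := γ * μ / 2 with hq
  have hq0 : 0 < q := by positivity
  have hqL : q ≤ γ * L / 2 := by
    rw [hq]
    gcongr
  have hγL1 : γ * L ≤ 1 / 100 := by linarith
  have hrec : ∀ r, ‖mean (X (r + 1)) - xs‖ ^ 2 + 1000 * ρ * U (r + 1)
      ≤ (1 - q) * (‖mean (X r) - xs‖ ^ 2 + 1000 * ρ * U r) + ε := by
    intro r
    have h1 := h.convex_succ_le hN hτ hb hl0 hl hW h0 hL hα hαL hFf hF0 hf hβ hxs r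
    have h2 := mul_le_mul_of_nonneg_left (hquad r) hγ.le
    -- The surplus of `convex_succ_le` pays for the decay of the network part at rate `q`, since `q
    -- ≤ γ L / 2` and `ρ ≤ 1/100`; quadratic growth handles the distance.
    have h3 : q * (1000 * ρ * U r) ≤ 10 * (γ * L) * U r := by
      calc q * (1000 * ρ * U r) ≤ γ * L / 2 * (1000 * (1 / 100) * U r) := by
            have := hU0 r
            gcongr
        _ = 5 * (γ * L) * U r := by ring
        _ ≤ _ := by
            have := mul_nonneg (by positivity : 0 ≤ γ * L) (hU0 r)
            linarith
    change ‖mean (X (r + 1)) - xs‖ ^ 2 + 1000 * ρ * U (r + 1) ≤ ‖mean (X r) - xs‖ ^ 2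
      + 1000 * ρ * U r - γ * F r - 10 * (γ * L) * U r + 3 * γ ^ 2 * (σ ^ 2 / (N * τ))
      + 5000 * ρ * γ ^ 2 * (σ ^ 2 / τ) at h1
    rw [hε]
    have h4 : γ * (μ / 2 * ‖mean (X r) - xs‖ ^ 2) = q * ‖mean (X r) - xs‖ ^ 2 := by
      rw [hq]
      ring
    linarith
  have hgeo := le_of_geometric (Ψ := fun r => ‖mean (X r) - xs‖ ^ 2 + 1000 * ρ * U r) hq0
    (by linarith) (by positivity) hrec (by have := hU0 0; positivity) R
  have hε2 : ε / q = 6 / μ * (γ * (σ ^ 2 / (N * τ))) + 10000 * L / μ * (γ ^ 2 * (σ ^ 2 / τ) / d) := by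
    rw [hε, hq, hρ]
    generalize σ ^ 2 / (N * τ) = v
    field_simp
    ring
  have hinit : ‖mean (X 0) - xs‖ ^ 2 + 1000 * ρ * U 0 ≤ (30 + 1 / L ^ 2) * a := by
    have h1 : 1000 * ρ * U 0 ≤ 10 * (3 * χ + 2 * γ ^ 2 / d * ς) := by
      calc 1000 * ρ * U 0 ≤ 1000 * (1 / 100) * (3 * χ + 2 * γ ^ 2 / d * ς) := by
            have := hU0 0
            gcongr
        _ = _ := by ring
    have h2 : 20 * γ ^ 2 / d ≤ 1 / L ^ 2 := by
      rw [div_le_div_iff₀ hd0 (by positivity)]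
      have h3 : (γ * L) ^ 2 ≤ 1 / 100 * (d / 100) := by
        rw [sq]
        gcongr
      linarith
    have h4 := mul_le_mul_of_nonneg_right h2 hς
    have h5 : 10 * (2 * γ ^ 2 / d * ς) = 20 * γ ^ 2 / d * ς := by ring
    have h6 := sq_nonneg ‖mean (X 0) - xs‖
    have h7 : 0 ≤ 1 / L ^ 2 := by positivity
    have h8 := mul_nonneg h7 h6
    have h9 := mul_nonneg h7 hχ
    rw [ha]
    linarith
  have hlast : ‖mean (X R) - xs‖ ^ 2 ≤ ‖mean (X R) - xs‖ ^ 2 + 1000 * ρ * U R := by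
    have := hU0 R
    have : 0 ≤ 1000 * ρ * U R := by positivity
    linarith
  have hexp := mul_le_mul_of_nonneg_left hinit (Real.exp_pos (-(q * R))).le
  rw [hε2] at hgeo
  linarith

end StronglyConvex

theorem integrable_inner_of_memLp {Ω : Type*} [MeasurableSpace Ω] {P : Measure Ω} {E : Type*}
    [NormedAddCommGroup E] [InnerProductSpace ℝ E] {f g : Ω → E} (hf : MemLp f 2 P)
    (hg : MemLp g 2 P) : Integrable (fun ω => inner ℝ (f ω) (g ω)) P := by
  refine (L2.integrable_inner (𝕜 := ℝ) hf.toLp hg.toLp).congr ?_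
  filter_upwards [hf.coeFn_toLp, hg.coeFn_toLp] with ω h1 h2
  rw [h1, h2]

namespace Problem

variable {N m : ℕ} {p : Problem.{u} N m}

theorem Smooth.continuous_gradient {L : ℝ} (hp : p.Smooth L) (i : Fin N) :
    Continuous (gradient (p.localCost i)) := by
  have h : LipschitzWith (Real.toNNReal L) (gradient (p.localCost i)) := by
    refine LipschitzWith.of_dist_le' fun x y => ?_
    rw [dist_eq_norm, dist_eq_norm]
    exact (hp i).2 x y
  exact h.continuous

theorem measurable_stochGrad {Ω : Type v} [MeasurableSpace Ω] (i : Fin N) {z : Ω → Vec m}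
    {s : Ω → p.Ξ i} (hz : Measurable z) (hs : Measurable s) :
    Measurable fun ω => p.stochGrad i (z ω) (s ω) :=
  (p.measurable_gradient i).comp (hz.prodMk hs)

end Problem

/-! ### Measurability of the iterates, and orthogonality of the noise -/

namespace Input

variable {N m : ℕ} {A : Input N m} {p : Problem.{u} N m} {Ω : Type v}
  {ξ : ℕ → ℕ → (i : Fin N) → Ω → p.Ξ i}

theorem phi_succ (r t : ℕ) (i : Fin N) (ω : Ω) :
    A.phi p ξ r (t + 1) i ω = A.phi p ξ r t i ω
      - A.α • p.stochGrad i (A.phi p ξ r t i ω) (ξ r t i ω) - A.β • A.y p ξ r ω i := rfl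

theorem x_succ (r : ℕ) (i : Fin N) (ω : Ω) :
    A.x p ξ (r + 1) ω i = ∑ j, A.W i j • A.phi p ξ r A.τ j ω := rfl

theorem y_succ (r : ℕ) (i : Fin N) (ω : Ω) :
    A.y p ξ (r + 1) ω i = A.y p ξ r ω i + A.phi p ξ r A.τ i ω - A.x p ξ (r + 1) ω i := rfl

section Measurability

variable [MeasurableSpace Ω]

theorem measurable_phi_of_state {r t : ℕ} {i : Fin N} (hx : Measurable fun ω => A.x p ξ r ω i)
    (hy : Measurable fun ω => A.y p ξ r ω i) (hξ : ∀ s < t, Measurable (ξ r s i)) :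
    Measurable (A.phi p ξ r t i) := by
  induction t with
  | zero => exact hx
  | succ t ih =>
    have h := ih fun s hs => hξ s (hs.trans (Nat.lt_succ_self t))
    exact (h.sub ((Problem.measurable_stochGrad i h (hξ t (Nat.lt_succ_self t))).const_smul
      A.α)).sub (hy.const_smul A.β)

/-- The σ-algebra on `Ω` is arbitrary here. It is later taken to be the one generated by all samples
but one, which turns measurability into a statement about which samples an iterate depends on. -/
theorem measurable_state {r : ℕ} (hξ : ∀ k < r, ∀ t < A.τ, ∀ i, Measurable (ξ k t i)) (i : Fin N) :
    (Measurable fun ω => A.x p ξ r ω i) ∧ Measurable fun ω => A.y p ξ r ω i := by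
  induction r generalizing i with
  | zero => exact ⟨measurable_const, measurable_const⟩
  | succ r ih =>
    have ih' := ih fun k hk => hξ k (hk.trans (Nat.lt_succ_self r))
    have hphi : ∀ j, Measurable (A.phi p ξ r A.τ j) := fun j =>
      measurable_phi_of_state (ih' j).1 (ih' j).2 fun s hs => hξ r (Nat.lt_succ_self r) s hs j
    have hx : ∀ i, Measurable fun ω => A.x p ξ (r + 1) ω i := fun i => by
      simp_rw [x_succ]
      exact Finset.measurable_fun_sum _ fun j _ => (hphi j).const_smul (A.W i j)
    refine ⟨hx i, ?_⟩
    simp_rw [y_succ]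
    exact ((ih' i).2.add (hphi i)).sub (hx i)

/-- The local iterates are functions of the earlier samples. -/
theorem measurable_phi {r t : ℕ} (ht : t ≤ A.τ)
    (hξ : ∀ k, ∀ s < A.τ, k < r ∨ k = r ∧ s < t → ∀ i, Measurable (ξ k s i)) (i : Fin N) :
    Measurable (A.phi p ξ r t i) := by
  have h := fun i => measurable_state (fun k hk s hs i => hξ k s hs (Or.inl hk) i) i
  exact measurable_phi_of_state (h i).1 (h i).2 fun s hs =>
    hξ r s (hs.trans_le ht) (Or.inr ⟨rfl, hs⟩) i

theorem measurable_xbar {r : ℕ} (hx : ∀ i, Measurable fun ω => A.x p ξ r ω i) :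
    Measurable (A.xbar p ξ r) :=
  (Finset.measurable_fun_sum Finset.univ fun i _ => hx i).const_smul (1 / (N : ℝ))

theorem measurable_noise {L : ℝ} (hp : p.Smooth L) {r t : ℕ} {i : Fin N}
    (hphi : Measurable (A.phi p ξ r t i)) (hξ : Measurable (ξ r t i)) :
    Measurable (A.noise p ξ r t i) :=
  (Problem.measurable_stochGrad i hphi hξ).sub ((hp.continuous_gradient i).measurable.comp hphi)

end Measurability

/-- The σ-algebra generated by all the samples but the one with index `k₀`. -/
@[reducible] def otherSamples (A : Input N m) (p : Problem.{u} N m)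
    (ξ : ℕ → ℕ → (i : Fin N) → Ω → p.Ξ i) (k₀ : ℕ × Fin A.τ × Fin N) : MeasurableSpace Ω :=
  ⨆ k ∈ ({k₀}ᶜ : Set (ℕ × Fin A.τ × Fin N)),
    MeasurableSpace.comap (ξ k.1 k.2.1 k.2.2) inferInstance

theorem measurable_otherSamples {k₀ : ℕ × Fin A.τ × Fin N} {r t : ℕ} (ht : t < A.τ) {i : Fin N}
    (hne : (r, (⟨t, ht⟩ : Fin A.τ), i) ≠ k₀) : Measurable[otherSamples A p ξ k₀] (ξ r t i) := by
  rw [measurable_iff_comap_le]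
  exact le_iSup₂_of_le (f := fun k (_ : k ∈ ({k₀}ᶜ : Set (ℕ × Fin A.τ × Fin N))) =>
    MeasurableSpace.comap (ξ k.1 k.2.1 k.2.2) inferInstance) (r, ⟨t, ht⟩, i) hne le_rfl

theorem measurable_phi_otherSamples {r t : ℕ} (ht : t < A.τ) (i j : Fin N) :
    Measurable[otherSamples A p ξ (r, ⟨t, ht⟩, i)] (A.phi p ξ r t j) := by
  refine @measurable_phi N m A p Ω ξ (otherSamples A p ξ (r, ⟨t, ht⟩, i)) r t ht.le ?_ j
  intro k s hs hks j'
  refine measurable_otherSamples hs fun heq => ?_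
  simp only [Prod.mk.injEq, Fin.mk.injEq] at heq
  omega

theorem measurable_state_otherSamples {r t : ℕ} (ht : t < A.τ) (i j : Fin N) :
    Measurable[otherSamples A p ξ (r, ⟨t, ht⟩, i)] (fun ω => A.x p ξ r ω j) ∧
      Measurable[otherSamples A p ξ (r, ⟨t, ht⟩, i)] (fun ω => A.y p ξ r ω j) := by
  refine @measurable_state N m A p Ω ξ (otherSamples A p ξ (r, ⟨t, ht⟩, i)) r ?_ j
  intro k hk s hs j'
  refine measurable_otherSamples hs fun heq => ?_
  simp only [Prod.mk.injEq, Fin.mk.injEq] at heq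
  omega

/-- The noise of an earlier step, or of another node at the same step, does not use the sample left
out. -/
theorem measurable_noise_otherSamples {L : ℝ} (hp : p.Smooth L) {r t s : ℕ} (ht : t < A.τ)
    (hst : s ≤ t) {i j : Fin N} (hne : (t, i) ≠ (s, j)) :
    Measurable[otherSamples A p ξ (r, ⟨t, ht⟩, i)] (A.noise p ξ r s j) := by
  refine @measurable_noise N m A p Ω ξ (otherSamples A p ξ (r, ⟨t, ht⟩, i)) L hp r s j ?_ ?_
  · refine @measurable_phi N m A p Ω ξ (otherSamples A p ξ (r, ⟨t, ht⟩, i)) r s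
      (hst.trans ht.le) ?_ j
    intro k s' hs hks j'
    refine measurable_otherSamples hs fun heq => ?_
    simp only [Prod.mk.injEq, Fin.mk.injEq] at heq
    omega
  · refine measurable_otherSamples (hst.trans_lt ht) fun heq => hne ?_
    simp only [Prod.mk.injEq, Fin.mk.injEq, true_and] at heq
    rw [heq.1, heq.2]

theorem measurable_phi_history {r t : ℕ} (ht : t ≤ A.τ) (i : Fin N) :
    Measurable[A.history p ξ r t] (A.phi p ξ r t i) := by
  rw [measurable_iff_comap_le]
  exact le_iSup₂_of_le (f := fun (k : ℕ × ℕ) (_ : k.2 ≤ A.τ ∧ (k.1 < r ∨ k.1 = r ∧ k.2 ≤ t)) =>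
    ⨆ j : Fin N, MeasurableSpace.comap (A.phi p ξ k.1 k.2 j) inferInstance) (r, t)
    ⟨ht, Or.inr ⟨rfl, le_rfl⟩⟩ (le_iSup (fun j : Fin N =>
      MeasurableSpace.comap (A.phi p ξ r t j) inferInstance) i)

variable [mΩ : MeasurableSpace Ω] {P : Measure Ω} [IsProbabilityMeasure P] {σ L : ℝ}

namespace NoiseAssumption

omit [IsProbabilityMeasure P] in
theorem measurable_phi (h : A.NoiseAssumption p ξ P σ) (r : ℕ) {t : ℕ} (ht : t ≤ A.τ) (i : Fin N) :
    Measurable (A.phi p ξ r t i) :=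
  Input.measurable_phi ht (fun k s hs _ j => h.measurable k s hs j) i

omit [IsProbabilityMeasure P] in
theorem history_le (h : A.NoiseAssumption p ξ P σ) (r t : ℕ) : A.history p ξ r t ≤ mΩ :=
  iSup₂_le fun k hk => iSup_le fun j => (h.measurable_phi k.1 hk.1 j).comap_le

/-- Conditional unbiasedness is tested on events determined by the current local iterate, which
belong to the history; independence supplies the rest. -/
theorem setIntegral_noise (h : A.NoiseAssumption p ξ P σ) (r : ℕ) {t : ℕ} (ht : t < A.τ)
    (i : Fin N) {B : Set (Vec m)} (hB : MeasurableSet B) :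
    ∫ ω in A.phi p ξ r t i ⁻¹' B, A.noise p ξ r t i ω ∂P = 0 := by
  rw [← setIntegral_condExp (h.history_le r t) ((h.memLp r t ht i).integrable one_le_two)
    (measurable_phi_history ht.le i hB)]
  rw [integral_congr_ae (ae_restrict_of_ae (h.unbiased r t ht i))]
  simp

theorem integral_norm_noise_sq_le (h : A.NoiseAssumption p ξ P σ) (r : ℕ) {t : ℕ} (ht : t < A.τ)
    (i : Fin N) : ∫ ω, ‖A.noise p ξ r t i ω‖ ^ 2 ∂P ≤ σ ^ 2 := by
  rw [← integral_condExp (h.history_le r t)]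
  calc _ ≤ ∫ _, σ ^ 2 ∂P :=
        integral_mono_ae integrable_condExp (integrable_const _) (h.variance r t ht i)
    _ = σ ^ 2 := by simp

omit [IsProbabilityMeasure P] in
-- Mutual independence lets the samples be grouped into one sample and all the others.
theorem indepFun_of_otherSamples (h : A.NoiseAssumption p ξ P σ) {r t : ℕ} (ht : t < A.τ)
    {i : Fin N} {β : Type*} [MeasurableSpace β] {V : Ω → β}
    (hV : Measurable[otherSamples A p ξ (r, ⟨t, ht⟩, i)] V) : IndepFun V (ξ r t i) P := by
  set M : ℕ × Fin A.τ × Fin N → MeasurableSpace Ω := fun k =>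
    MeasurableSpace.comap (ξ k.1 k.2.1 k.2.2) (inferInstance : MeasurableSpace (p.Ξ k.2.2)) with hM
  have hind : iIndep M P := h.indep
  have hle : ∀ k, M k ≤ mΩ := fun k => (h.measurable k.1 k.2.1 k.2.1.2 k.2.2).comap_le
  have h1 := indep_iSup_of_disjoint hle hind
    (S := {(r, ⟨t, ht⟩, i)}ᶜ) (T := {(r, ⟨t, ht⟩, i)}) disjoint_compl_left
  rw [iSup_singleton] at h1
  rw [IndepFun_iff_Indep]
  exact indep_of_indep_of_le_left h1 hV.comap_le

omit [IsProbabilityMeasure P] in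
theorem otherSamples_le (h : A.NoiseAssumption p ξ P σ) (k₀ : ℕ × Fin A.τ × Fin N) :
    otherSamples A p ξ k₀ ≤ mΩ :=
  iSup₂_le fun k _ => (h.measurable k.1 k.2.1 k.2.1.2 k.2.2).comap_le

theorem map_prodMk (h : A.NoiseAssumption p ξ P σ) {r t : ℕ} (ht : t < A.τ)
    {i : Fin N} {β : Type*} [MeasurableSpace β] {V : Ω → β}
    (hV : Measurable[otherSamples A p ξ (r, ⟨t, ht⟩, i)] V) :
    P.map (fun ω => (V ω, ξ r t i ω)) = (P.map V).prod (p.law i) := by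
  rw [← h.map_eq r t ht i]
  exact (indepFun_iff_map_prod_eq_prod_map_map
    (hV.mono (h.otherSamples_le _) le_rfl).aemeasurable (h.measurable r t ht i).aemeasurable).1
    (h.indepFun_of_otherSamples ht hV)

/-- The stochastic gradient is unbiased at almost every value of the local iterate. -/
theorem ae_integral_eq_zero (h : A.NoiseAssumption p ξ P σ) (hp : p.Smooth L) {r t : ℕ}
    (ht : t < A.τ) (i : Fin N) :
    ∀ᵐ z ∂(P.map (A.phi p ξ r t i)),
      Integrable (fun s => p.stochGrad i z s - gradient (p.localCost i) z) (p.law i) ∧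
      ∫ s, (p.stochGrad i z s - gradient (p.localCost i) z) ∂(p.law i) = 0 := by
  set H : Vec m × p.Ξ i → Vec m :=
    fun q => p.stochGrad i q.1 q.2 - gradient (p.localCost i) q.1 with hH
  have hHm : Measurable H := (Problem.measurable_stochGrad i measurable_fst measurable_snd).sub
    ((hp.continuous_gradient i).measurable.comp measurable_fst)
  have hφ := h.measurable_phi r ht.le i
  have hpair : Measurable fun ω => (A.phi p ξ r t i ω, ξ r t i ω) :=
    hφ.prodMk (h.measurable r t ht i)
  have hmap := h.map_prodMk ht (measurable_phi_otherSamples (p := p) (ξ := ξ) (r := r) ht i i)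
  have : IsProbabilityMeasure (P.map (A.phi p ξ r t i)) :=
    Measure.isProbabilityMeasure_map hφ.aemeasurable
  have hint : Integrable H ((P.map (A.phi p ξ r t i)).prod (p.law i)) := by
    rw [← hmap, integrable_map_measure hHm.aestronglyMeasurable hpair.aemeasurable]
    exact (h.memLp r t ht i).integrable one_le_two
  -- By Fubini, the integral over `B` of the expected gradient error at a fixed point is the
  -- integral of the noise over the event that the iterate lies in `B`. It vanishes for every `B`,
  -- hence so does the integrand almost everywhere.
  have hzero := hint.integral_prod_left.ae_eq_zero_of_forall_setIntegral_eq_zero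
    (fun B hB _ => by
      have h1 : ∫ z in B, ∫ s, H (z, s) ∂(p.law i) ∂(P.map (A.phi p ξ r t i))
          = ∫ q in B ×ˢ Set.univ, H q ∂((P.map (A.phi p ξ r t i)).prod (p.law i)) := by
        rw [setIntegral_prod _ hint.integrableOn]
        simp
      rw [h1, ← hmap, setIntegral_map (hB.prod MeasurableSet.univ) hHm.aestronglyMeasurable
        hpair.aemeasurable]
      have h2 : (fun ω => (A.phi p ξ r t i ω, ξ r t i ω)) ⁻¹' (B ×ˢ Set.univ)
          = A.phi p ξ r t i ⁻¹' B := by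
        ext ω
        simp
      rw [h2]
      exact h.setIntegral_noise r ht i hB)
  filter_upwards [hint.prod_right_ae, hzero] with z hz1 hz2 using ⟨hz1, hz2⟩

/-- The noise is orthogonal to every square-integrable function of the other samples. -/
theorem integral_inner_noise (h : A.NoiseAssumption p ξ P σ) (hp : p.Smooth L) {r t : ℕ}
    (ht : t < A.τ) {i : Fin N} {ψ : Ω → Vec m} (hψ2 : MemLp ψ 2 P)
    (hψ : Measurable[otherSamples A p ξ (r, ⟨t, ht⟩, i)] ψ) :
    ∫ ω, inner ℝ (ψ ω) (A.noise p ξ r t i ω) ∂P = 0 := by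
  -- The local iterate and `ψ` jointly depend on the other samples only, so the pair is independent
  -- of the current sample. Integrating over that sample first, with both frozen, gives zero by
  -- `ae_integral_eq_zero`.
  set V : Ω → Vec m × Vec m := fun ω => (A.phi p ξ r t i ω, ψ ω) with hV
  have hVm : Measurable[otherSamples A p ξ (r, ⟨t, ht⟩, i)] V :=
    (measurable_phi_otherSamples ht i i).prodMk hψ
  have hVm' : Measurable V := hVm.mono (h.otherSamples_le _) le_rfl
  have hpair : Measurable fun ω => (V ω, ξ r t i ω) := hVm'.prodMk (h.measurable r t ht i)
  have hmap := h.map_prodMk ht hVm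
  set H : (Vec m × Vec m) × p.Ξ i → ℝ := fun q =>
    inner ℝ q.1.2 (p.stochGrad i q.1.1 q.2 - gradient (p.localCost i) q.1.1) with hH
  have hHm : Measurable H := by
    have h1 : Measurable fun q : (Vec m × Vec m) × p.Ξ i =>
        p.stochGrad i q.1.1 q.2 - gradient (p.localCost i) q.1.1 :=
      (Problem.measurable_stochGrad i measurable_fst.fst measurable_snd).sub
        ((hp.continuous_gradient i).measurable.comp measurable_fst.fst)
    exact Measurable.inner measurable_fst.snd h1
  have : IsProbabilityMeasure (P.map V) := Measure.isProbabilityMeasure_map hVm'.aemeasurable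
  have hint : Integrable H ((P.map V).prod (p.law i)) := by
    rw [← hmap, integrable_map_measure hHm.aestronglyMeasurable hpair.aemeasurable]
    exact integrable_inner_of_memLp hψ2 (h.memLp r t ht i)
  have hae : ∀ᵐ q ∂(P.map V),
      Integrable (fun s => p.stochGrad i q.1 s - gradient (p.localCost i) q.1) (p.law i) ∧
      ∫ s, (p.stochGrad i q.1 s - gradient (p.localCost i) q.1) ∂(p.law i) = 0 := by
    have h1 := h.ae_integral_eq_zero hp (r := r) ht i
    have h2 : A.phi p ξ r t i = Prod.fst ∘ V := rfl
    rw [h2, ← Measure.map_map measurable_fst hVm'] at h1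
    exact ae_of_ae_map measurable_fst.aemeasurable h1
  calc ∫ ω, inner ℝ (ψ ω) (A.noise p ξ r t i ω) ∂P = ∫ ω, H (V ω, ξ r t i ω) ∂P := rfl
    _ = ∫ q, H q ∂((P.map V).prod (p.law i)) := by
      rw [← hmap, integral_map hpair.aemeasurable hHm.aestronglyMeasurable]
    _ = ∫ q, ∫ s, H (q, s) ∂(p.law i) ∂(P.map V) := integral_prod _ hint
    _ = ∫ _, 0 ∂(P.map V) := by
      refine integral_congr_ae ?_
      filter_upwards [hae] with q hq
      simp only [hH]
      rw [integral_inner hq.1, hq.2, inner_zero_right]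
    _ = 0 := by simp

end NoiseAssumption

end Input

/-! ### Square-integrable random vectors as elements of `L²` -/

section Lift

theorem avg_comp_eq {Ω : Type*} {N m : ℕ} (f : Fin N → Ω → Vec m) :
    (fun ω => avg fun i => f i ω) = (1 / (N : ℝ)) • ∑ i, f i := by
  funext ω
  rw [avg.eq_def, Pi.smul_apply, Finset.sum_apply]

variable {Ω : Type*} [MeasurableSpace Ω] {P : Measure Ω} {E : Type*} [NormedAddCommGroup E]

open Classical in
/-- The class in `L²` of a square-integrable random vector (zero for other functions). -/
noncomputable def toL2 (P : Measure Ω) (f : Ω → E) : Lp E 2 P :=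
  if h : MemLp f 2 P then h.toLp f else 0

theorem toL2_eq {f : Ω → E} (hf : MemLp f 2 P) : toL2 P f = hf.toLp f := dif_pos hf

theorem coeFn_toL2 {f : Ω → E} (hf : MemLp f 2 P) : toL2 P f =ᵐ[P] f := by
  rw [toL2_eq hf]
  exact hf.coeFn_toLp

theorem toL2_add {f g : Ω → E} (hf : MemLp f 2 P) (hg : MemLp g 2 P) :
    toL2 P (f + g) = toL2 P f + toL2 P g := by
  rw [toL2_eq hf, toL2_eq hg, ← MemLp.toLp_add hf hg, toL2_eq (hf.add hg)]

theorem toL2_sub {f g : Ω → E} (hf : MemLp f 2 P) (hg : MemLp g 2 P) :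
    toL2 P (f - g) = toL2 P f - toL2 P g := by
  rw [toL2_eq hf, toL2_eq hg, ← MemLp.toLp_sub hf hg, toL2_eq (hf.sub hg)]

theorem norm_toL2_le {f g : Ω → E} (hf : MemLp f 2 P) (hg : MemLp g 2 P) {L : ℝ}
    (h : ∀ ω, ‖f ω‖ ≤ L * ‖g ω‖) : ‖toL2 P f‖ ≤ L * ‖toL2 P g‖ := by
  refine Lp.norm_le_mul_norm_of_ae_le_mul ?_
  filter_upwards [coeFn_toL2 hf, coeFn_toL2 hg] with ω h1 h2
  rw [h1, h2]
  exact h ω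

theorem toL2_sum {ι : Type*} {s : Finset ι} {f : ι → Ω → E} (hf : ∀ i ∈ s, MemLp (f i) 2 P) :
    toL2 P (∑ i ∈ s, f i) = ∑ i ∈ s, toL2 P (f i) := by
  classical
  induction s using Finset.induction_on with
  | empty =>
    have h : MemLp (0 : Ω → E) 2 P := MemLp.zero
    rw [Finset.sum_empty, Finset.sum_empty, toL2_eq h, MemLp.toLp_zero]
  | insert a s ha ih =>
    have h1 := fun i hi => hf i (Finset.mem_insert_of_mem hi)
    rw [Finset.sum_insert ha, Finset.sum_insert ha,
      toL2_add (hf a (Finset.mem_insert_self a s)) (memLp_finsetSum' s h1), ih h1]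

variable [InnerProductSpace ℝ E]

theorem toL2_smul {f : Ω → E} (hf : MemLp f 2 P) (c : ℝ) : toL2 P (c • f) = c • toL2 P f := by
  rw [toL2_eq hf, ← MemLp.toLp_const_smul c hf, toL2_eq (hf.const_smul c)]

theorem inner_toL2 {f g : Ω → E} (hf : MemLp f 2 P) (hg : MemLp g 2 P) :
    inner ℝ (toL2 P f) (toL2 P g) = ∫ ω, inner ℝ (f ω) (g ω) ∂P := by
  rw [L2.inner_def]
  refine integral_congr_ae ?_
  filter_upwards [coeFn_toL2 hf, coeFn_toL2 hg] with ω h1 h2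
  rw [h1, h2]

theorem norm_toL2_sq {f : Ω → E} (hf : MemLp f 2 P) :
    ‖toL2 P f‖ ^ 2 = ∫ ω, ‖f ω‖ ^ 2 ∂P := by
  rw [← real_inner_self_eq_norm_sq, inner_toL2 hf hf]
  simp_rw [real_inner_self_eq_norm_sq]

theorem norm_toL2_const_sq [IsProbabilityMeasure P] (c : E) :
    ‖toL2 P (fun _ => c)‖ ^ 2 = ‖c‖ ^ 2 := by
  rw [norm_toL2_sq (memLp_const c)]
  simp

theorem memLp_avg {N m : ℕ} {f : Fin N → Ω → Vec m} (hf : ∀ i, MemLp (f i) 2 P) :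
    MemLp (fun ω => avg fun i => f i ω) 2 P := by
  rw [avg_comp_eq]
  exact (memLp_finsetSum' Finset.univ fun i _ => hf i).const_smul (1 / (N : ℝ))

theorem toL2_avg {N m : ℕ} {f : Fin N → Ω → Vec m} (hf : ∀ i, MemLp (f i) 2 P) :
    toL2 P (fun ω => avg fun i => f i ω) = mean fun i => toL2 P (f i) := by
  have h1 := toL2_sum (P := P) (f := f) (s := Finset.univ) fun i _ => hf i
  have h2 := toL2_smul (P := P) (f := ∑ i, f i) (memLp_finsetSum' Finset.univ fun i _ => hf i)
    (1 / (N : ℝ))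
  rw [h1] at h2
  rw [avg_comp_eq]
  exact h2

theorem memLp_gradient_comp {m : ℕ} [IsFiniteMeasure P] {f : Vec m → ℝ} {L : ℝ}
    (hc : Continuous (gradient f)) (hL : ∀ y z, ‖gradient f y - gradient f z‖ ≤ L * ‖y - z‖)
    {X : Ω → Vec m} (hX : MemLp X 2 P) : MemLp (fun ω => gradient f (X ω)) 2 P := by
  have h1 : MemLp (fun ω => gradient f (X ω) - gradient f 0) 2 P := by
    refine hX.of_le_mul (c := L) ?_ (Filter.Eventually.of_forall fun ω => ?_)
    · exact (hc.comp_aestronglyMeasurable hX.1).sub aestronglyMeasurable_const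
    · simpa using hL (X ω) 0
  have h2 := h1.add (memLp_const (gradient f 0))
  have h3 : (fun ω => gradient f (X ω))
      = (fun ω => gradient f (X ω) - gradient f 0) + fun _ => gradient f 0 := by
    funext ω
    simp
  rw [h3]
  exact h2

/-- The descent lemma for `f` and for `-f` bounds `|f|` by a quadratic polynomial in the norm. -/
theorem integrable_comp_of_smooth {m : ℕ} [IsFiniteMeasure P] {f : Vec m → ℝ} {L : ℝ}
    (hf : Differentiable ℝ f) (hL : ∀ y z, ‖gradient f y - gradient f z‖ ≤ L * ‖y - z‖)
    {X : Ω → Vec m} (hX : MemLp X 2 P) : Integrable (fun ω => f (X ω)) P := by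
  have hneg : ∀ y, gradient (fun z => -f z) y = -gradient f y := fun y => by
    refine HasGradientAt.gradient ?_
    rw [hasGradientAt_iff_hasFDerivAt, map_neg]
    have h := (hf y).hasGradientAt
    rw [hasGradientAt_iff_hasFDerivAt] at h
    exact h.neg
  have h0 : ∀ y, |f y| ≤ |f 0| + ‖gradient f 0‖ * ‖y‖ + L / 2 * ‖y‖ ^ 2 := by
    intro y
    have h1 := descent_lemma hf hL 0 y
    have h2 := descent_lemma (f := fun z => -f z) hf.neg (L := L) (fun y z => by
      rw [hneg, hneg, ← norm_neg]
      simpa [sub_eq_add_neg, add_comm] using hL y z) 0 y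
    rw [hneg, sub_zero, inner_neg_left] at h2
    rw [sub_zero] at h1
    have h3 := abs_le.1 (abs_real_inner_le_norm (gradient f 0) y)
    have h4 := abs_le.1 (le_refl |f 0|)
    exact abs_le.2 ⟨by linarith, by linarith⟩
  have hint : Integrable (fun ω => |f 0| + ‖gradient f 0‖ * ‖X ω‖ + L / 2 * ‖X ω‖ ^ 2) P :=
    ((integrable_const _).add ((hX.integrable one_le_two).norm.const_mul _)).add
      (hX.integrable_norm_pow two_ne_zero |>.const_mul _)
  refine hint.mono' (hf.continuous.comp_aestronglyMeasurable hX.1)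
    (Filter.Eventually.of_forall fun ω => h0 (X ω))

end Lift

/-! ### The iterates as a trajectory in `L²` -/

namespace Input

namespace NoiseAssumption

variable {N m : ℕ} {A : Input N m} {p : Problem.{u} N m} {Ω : Type v}
  {ξ : ℕ → ℕ → (i : Fin N) → Ω → p.Ξ i} [mΩ : MeasurableSpace Ω] {P : Measure Ω}
  [IsProbabilityMeasure P] {σ L : ℝ}

theorem memLp_gradient (hp : p.Smooth L) (i : Fin N) {X : Ω → Vec m} (hX : MemLp X 2 P) :
    MemLp (fun ω => gradient (p.localCost i) (X ω)) 2 P :=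
  memLp_gradient_comp (hp.continuous_gradient i) (hp i).2 hX

omit mΩ in
theorem phi_succ_eq (r t : ℕ) (i : Fin N) :
    A.phi p ξ r (t + 1) i = A.phi p ξ r t i
      - A.α • ((fun ω => gradient (p.localCost i) (A.phi p ξ r t i ω)) + A.noise p ξ r t i)
      - A.β • (fun ω => A.y p ξ r ω i) := by
  funext ω
  simp only [Pi.sub_apply, Pi.smul_apply, Pi.add_apply]
  rw [phi_succ, noise, add_sub_cancel]

omit mΩ in
theorem x_succ_eq (r : ℕ) (i : Fin N) :
    (fun ω => A.x p ξ (r + 1) ω i) = ∑ j, A.W i j • A.phi p ξ r A.τ j := by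
  funext ω
  simp only [Finset.sum_apply, Pi.smul_apply]
  rfl

theorem memLp_phi_of_state (h : A.NoiseAssumption p ξ P σ) (hp : p.Smooth L) {r : ℕ} {i : Fin N}
    (hx : MemLp (fun ω => A.x p ξ r ω i) 2 P) (hy : MemLp (fun ω => A.y p ξ r ω i) 2 P) {t : ℕ}
    (ht : t ≤ A.τ) : MemLp (A.phi p ξ r t i) 2 P := by
  induction t with
  | zero => exact hx
  | succ t ih =>
    have h1 := ih (Nat.le_of_succ_le ht)
    have h2 := (h1.sub (((memLp_gradient hp i h1).add (h.memLp r t ht i)).const_smul A.α)).sub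
      (hy.const_smul A.β)
    rwa [phi_succ_eq]

theorem memLp_state (h : A.NoiseAssumption p ξ P σ) (hp : p.Smooth L) (r : ℕ) (i : Fin N) :
    MemLp (fun ω => A.x p ξ r ω i) 2 P ∧ MemLp (fun ω => A.y p ξ r ω i) 2 P := by
  induction r generalizing i with
  | zero => exact ⟨memLp_const (A.x₀ i), memLp_const (A.y₀ i)⟩
  | succ r ih =>
    have hphi : ∀ j, MemLp (A.phi p ξ r A.τ j) 2 P := fun j =>
      h.memLp_phi_of_state hp (ih j).1 (ih j).2 le_rfl
    have hx : ∀ i, MemLp (fun ω => A.x p ξ (r + 1) ω i) 2 P := fun i => by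
      rw [x_succ_eq]
      exact memLp_finsetSum' Finset.univ fun j _ => (hphi j).const_smul (A.W i j)
    exact ⟨hx i, ((ih i).2.add (hphi i)).sub (hx i)⟩

theorem memLp_phi (h : A.NoiseAssumption p ξ P σ) (hp : p.Smooth L) (r : ℕ) {t : ℕ}
    (ht : t ≤ A.τ) (i : Fin N) : MemLp (A.phi p ξ r t i) 2 P :=
  h.memLp_phi_of_state hp (h.memLp_state hp r i).1 (h.memLp_state hp r i).2 ht

theorem memLp_xbar (h : A.NoiseAssumption p ξ P σ) (hp : p.Smooth L) (r : ℕ) :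
    MemLp (A.xbar p ξ r) 2 P :=
  memLp_avg fun i => (h.memLp_state hp r i).1

theorem toL2_xbar (h : A.NoiseAssumption p ξ P σ) (hp : p.Smooth L) (r : ℕ) :
    toL2 P (A.xbar p ξ r) = mean fun i => toL2 P fun ω => A.x p ξ r ω i :=
  toL2_avg fun i => (h.memLp_state hp r i).1

theorem inner_toL2_noise (h : A.NoiseAssumption p ξ P σ) (hp : p.Smooth L) {r t : ℕ}
    (ht : t < A.τ) {i : Fin N} {ψ : Ω → Vec m} (hψ2 : MemLp ψ 2 P)
    (hψ : Measurable[otherSamples A p ξ (r, ⟨t, ht⟩, i)] ψ) :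
    inner ℝ (toL2 P ψ) (toL2 P (A.noise p ξ r t i)) = 0 := by
  rw [inner_toL2 hψ2 (h.memLp r t ht i)]
  exact h.integral_inner_noise hp ht hψ2 hψ

omit mΩ in
theorem measurable_xbar_otherSamples {r t : ℕ} (ht : t < A.τ) (i : Fin N) :
    Measurable[otherSamples A p ξ (r, ⟨t, ht⟩, i)] (A.xbar p ξ r) :=
  @measurable_xbar N m A p Ω ξ (otherSamples A p ξ (r, ⟨t, ht⟩, i)) r
    fun j => (measurable_state_otherSamples ht i j).1

/-- The iterates of Local Exact-Diffusion form a trajectory in the space of square-integrable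
random vectors. -/
theorem trajectory (h : A.NoiseAssumption p ξ P σ) (hp : p.Smooth L) (hβ : A.β = 1 / (A.τ : ℝ)) :
    Trajectory A.W A.α L σ A.τ
      (fun r i => toL2 P fun ω => A.x p ξ r ω i)
      (fun r i => toL2 P fun ω => A.y p ξ r ω i)
      (fun r i => toL2 P fun ω => gradient (p.localCost i) (A.xbar p ξ r ω))
      (fun r t i => toL2 P (A.phi p ξ r t i))
      (fun r t i => toL2 P fun ω => gradient (p.localCost i) (A.phi p ξ r t i ω))
      (fun r t i => toL2 P (A.noise p ξ r t i)) where
  phi_zero r i := rfl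
  phi_succ r t ht i := by
    have h1 := h.memLp_phi hp r ht.le i
    have hy := (h.memLp_state hp r i).2
    have hg := memLp_gradient hp i h1
    have hn := h.memLp r t ht i
    rw [phi_succ_eq, toL2_sub (h1.sub ((hg.add hn).const_smul A.α)) (hy.const_smul A.β), toL2_smul hy,
      toL2_sub h1 ((hg.add hn).const_smul A.α), toL2_smul (hg.add hn), toL2_add hg hn, hβ]
  X_succ r i := by
    have h1 := fun j => h.memLp_phi hp r le_rfl j
    rw [x_succ_eq, toL2_sum fun j _ => (h1 j).const_smul (A.W i j)]
    exact Finset.sum_congr rfl fun j _ => toL2_smul (h1 j) _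
  Y_succ r i := by
    have h1 := h.memLp_phi hp r le_rfl i
    have hy := (h.memLp_state hp r i).2
    rw [← toL2_add hy h1, ← toL2_sub (hy.add h1) (h.memLp_state hp (r + 1) i).1]
    rfl
  dist_g r t ht i := by
    have h1 := h.memLp_phi hp r ht.le i
    have hx := h.memLp_xbar hp r
    rw [← h.toL2_xbar hp, ← toL2_sub h1 hx,
      ← toL2_sub (memLp_gradient hp i h1) (memLp_gradient hp i hx)]
    exact norm_toL2_le ((memLp_gradient hp i h1).sub (memLp_gradient hp i hx)) (h1.sub hx)
      fun ω => (hp i).2 _ _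
  dist_D r i := by
    have h1 := h.memLp_xbar hp (r + 1)
    have hx := h.memLp_xbar hp r
    rw [← h.toL2_xbar hp, ← h.toL2_xbar hp, ← toL2_sub h1 hx,
      ← toL2_sub (memLp_gradient hp i h1) (memLp_gradient hp i hx)]
    exact norm_toL2_le ((memLp_gradient hp i h1).sub (memLp_gradient hp i hx)) (h1.sub hx)
      fun ω => (hp i).2 _ _
  norm_n r t ht i := by
    rw [norm_toL2_sq (h.memLp r t ht i)]
    exact h.integral_norm_noise_sq_le r ht i
  inner_n r t ht s hs i j hne := by
    -- The noise of the later step is tested against that of the earlier one; at equal steps the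
    -- nodes differ, so the samples do too.
    rcases le_total s t with hst | hst
    · rw [real_inner_comm]
      exact h.inner_toL2_noise hp ht (h.memLp r s hs j) (measurable_noise_otherSamples hp ht hst hne)
    · exact h.inner_toL2_noise hp hs (h.memLp r t ht i)
        (measurable_noise_otherSamples hp hs hst hne.symm)
  inner_X r t ht i j := h.inner_toL2_noise hp ht (h.memLp_state hp r j).1
    (measurable_state_otherSamples ht i j).1
  inner_Y r t ht i j := h.inner_toL2_noise hp ht (h.memLp_state hp r j).2
    (measurable_state_otherSamples ht i j).2
  inner_D r t ht i j := h.inner_toL2_noise hp ht (memLp_gradient hp j (h.memLp_xbar hp r))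
    ((hp.continuous_gradient j).measurable.comp (measurable_xbar_otherSamples ht i))

end NoiseAssumption

end Input

theorem sum_initialDual_eq_zero {N m : ℕ} {W : Matrix (Fin N) (Fin N) ℝ} {x₀ y₀ : Fin N → Vec m}
    (hW : W ∈ doublyStochastic ℝ (Fin N)) (h : InitialDual W x₀ y₀) : ∑ i, y₀ i = 0 := by
  rcases h with h | h
  · simp_rw [h]
    rw [Finset.sum_sub_distrib, Finset.sum_comm]
    simp_rw [← Finset.sum_smul, sum_col_of_mem_doublyStochastic hW, one_smul]
    exact sub_self _
  · simp [h]

theorem disagreementSq_nonneg {N m : ℕ} (x₀ : Fin N → Vec m) : 0 ≤ disagreementSq x₀ := by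
  unfold disagreementSq
  positivity

theorem Problem.heterogeneitySq_nonneg {N m : ℕ} (p : Problem.{u} N m) (x₀ : Fin N → Vec m) :
    0 ≤ p.heterogeneitySq x₀ := by
  unfold Problem.heterogeneitySq
  positivity

/-! ### Expectations as `L²` norms and inner products -/

namespace Input

namespace NoiseAssumption

variable {N m : ℕ} {A : Input N m} {p : Problem.{u} N m} {Ω : Type v}
  {ξ : ℕ → ℕ → (i : Fin N) → Ω → p.Ξ i} [mΩ : MeasurableSpace Ω] {P : Measure Ω}
  [IsProbabilityMeasure P] {σ L : ℝ}

omit mΩ in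
theorem xbar_zero (ω : Ω) : A.xbar p ξ 0 ω = avg A.x₀ := rfl

theorem mean_gradient_xbar (h : A.NoiseAssumption p ξ P σ) (hp : p.Smooth L) (r : ℕ) :
    (mean fun i => toL2 P fun ω => gradient (p.localCost i) (A.xbar p ξ r ω))
      = toL2 P fun ω => gradient p.cost (A.xbar p ξ r ω) := by
  rw [← toL2_avg fun i => memLp_gradient hp i (h.memLp_xbar hp r)]
  simp_rw [p.gradient_cost hp]

theorem memLp_gradient_cost (h : A.NoiseAssumption p ξ P σ) (hp : p.Smooth L) (r : ℕ) :
    MemLp (fun ω => gradient p.cost (A.xbar p ξ r ω)) 2 P := by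
  simp_rw [p.gradient_cost hp]
  exact memLp_avg fun i => memLp_gradient hp i (h.memLp_xbar hp r)

theorem integrable_cost (h : A.NoiseAssumption p ξ P σ) (hN : 0 < N) (hp : p.Smooth L) (r : ℕ) :
    Integrable (fun ω => p.cost (A.xbar p ξ r ω)) P :=
  integrable_comp_of_smooth (p.differentiable_cost hp) (p.lipschitz_gradient_cost hN hp)
    (h.memLp_xbar hp r)

theorem integrable_stationarity (h : A.NoiseAssumption p ξ P σ) (hp : p.Smooth L) (r : ℕ) :
    Integrable (A.stationarity p ξ r) P := by
  refine ((h.memLp_gradient_cost hp r).integrable_norm_pow two_ne_zero).add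
    ((integrable_finsetSum _ fun t ht => ?_).const_mul _)
  exact (memLp_avg fun i => memLp_gradient hp i
    (h.memLp_phi hp r (Finset.mem_range.1 ht).le i)).integrable_norm_pow two_ne_zero

theorem integral_stationarity (h : A.NoiseAssumption p ξ P σ) (hp : p.Smooth L) (r : ℕ) :
    ∫ ω, A.stationarity p ξ r ω ∂P
      = ‖mean fun i => toL2 P fun ω => gradient (p.localCost i) (A.xbar p ξ r ω)‖ ^ 2
        + 1 / (A.τ : ℝ) * ∑ t ∈ Finset.range A.τ,
          ‖mean fun i => toL2 P fun ω => gradient (p.localCost i) (A.phi p ξ r t i ω)‖ ^ 2 := by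
  have hg : ∀ t ∈ Finset.range A.τ, ∀ i,
      MemLp (fun ω => gradient (p.localCost i) (A.phi p ξ r t i ω)) 2 P := fun t ht i =>
    memLp_gradient hp i (h.memLp_phi hp r (Finset.mem_range.1 ht).le i)
  have hint := fun t ht => (memLp_avg (hg t ht)).integrable_norm_pow two_ne_zero
  rw [h.mean_gradient_xbar hp, norm_toL2_sq (h.memLp_gradient_cost hp r)]
  unfold stationarity
  rw [integral_add ((h.memLp_gradient_cost hp r).integrable_norm_pow two_ne_zero)
    ((integrable_finsetSum _ hint).const_mul _), integral_const_mul, integral_finsetSum _ hint]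
  congr 2
  refine Finset.sum_congr rfl fun t ht => ?_
  rw [← toL2_avg (hg t ht), norm_toL2_sq (memLp_avg (hg t ht))]

theorem sum_toL2_y_zero (P : Measure Ω) [IsProbabilityMeasure P] (hW : WeightAssumption A.W)
    (hinit : InitialDual A.W A.x₀ A.y₀) : ∑ i, toL2 P (fun ω => A.y p ξ 0 ω i) = 0 := by
  have h1 : ∀ i, MemLp (fun ω => A.y p ξ 0 ω i) 2 P := fun i => memLp_const (A.y₀ i)
  have h2 : ∑ i, (fun ω => A.y p ξ 0 ω i) = fun _ => (0 : Vec m) := by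
    funext ω
    rw [Finset.sum_apply]
    exact sum_initialDual_eq_zero hW.doublyStochastic hinit
  rw [← toL2_sum fun i _ => h1 i, h2, toL2_eq (memLp_const 0)]
  exact MemLp.toLp_zero _

/-- The initial data are deterministic, so the `L²` norms in the general bound reduce to Euclidean
ones. -/
theorem networkError_zero_le (h : A.NoiseAssumption p ξ P σ) (hN : 0 < N) (hp : p.Smooth L)
    (hinit : InitialDual A.W A.x₀ A.y₀) {l : ℝ} (hl : l < 1) {b : Fin N → Fin N → ℝ}
    {w : Fin N → ℝ} (hb : ModalBasis A.W l b w) (γ : ℝ) :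
    networkError l γ b w (fun i => toL2 P fun ω => A.x p ξ 0 ω i)
        (fun i => toL2 P fun ω => A.y p ξ 0 ω i)
        (fun i => toL2 P fun ω => gradient (p.localCost i) (A.xbar p ξ 0 ω))
      ≤ 3 * disagreementSq A.x₀ + 2 * γ ^ 2 / (1 - l) * p.heterogeneitySq A.x₀ := by
  have hX := fun i => (h.memLp_state hp 0 i).1
  have hY : (∀ i, (toL2 P fun ω => A.y p ξ 0 ω i) = (toL2 P fun ω => A.x p ξ 0 ω i)
      - ∑ j, A.W i j • toL2 P fun ω => A.x p ξ 0 ω j) ∨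
      ∀ i, (toL2 P fun ω => A.y p ξ 0 ω i) = 0 := by
    rcases hinit with hi | hi
    · refine Or.inl fun i => ?_
      have h1 : ∀ j ∈ (Finset.univ : Finset (Fin N)),
          MemLp (A.W i j • fun ω => A.x p ξ 0 ω j) 2 P := fun j _ => (hX j).const_smul (A.W i j)
      have h2 : ∑ j, A.W i j • (toL2 P fun ω => A.x p ξ 0 ω j)
          = ∑ j, toL2 P (A.W i j • fun ω => A.x p ξ 0 ω j) :=
        Finset.sum_congr rfl fun j _ => (toL2_smul (hX j) _).symm
      rw [h2, ← toL2_sum h1, ← toL2_sub (hX i) (memLp_finsetSum' _ h1)]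
      congr 1
      funext ω
      rw [Pi.sub_apply, Finset.sum_apply]
      exact hi i
    · refine Or.inr fun i => ?_
      have h1 : (fun ω => A.y p ξ 0 ω i) = fun _ => (0 : Vec m) := funext fun ω => hi i
      rw [h1, toL2_eq (memLp_const 0)]
      exact MemLp.toLp_zero _
  refine (Trajectory.networkError_init_le hN hb hl γ hY).trans (le_of_eq ?_)
  have hD := fun i => memLp_gradient hp i (h.memLp_xbar hp 0)
  have e1 : ∀ i, ‖(toL2 P fun ω => A.x p ξ 0 ω i) - mean fun j => toL2 P fun ω => A.x p ξ 0 ω j‖ ^ 2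
      = ‖A.x₀ i - avg A.x₀‖ ^ 2 := fun i => by
    have h1 : (fun ω => A.x p ξ 0 ω i) - A.xbar p ξ 0 = fun _ => A.x₀ i - avg A.x₀ := rfl
    rw [← h.toL2_xbar hp, ← toL2_sub (hX i) (h.memLp_xbar hp 0), h1, norm_toL2_const_sq]
  have e2 : ∀ i, ‖(toL2 P fun ω => gradient (p.localCost i) (A.xbar p ξ 0 ω))
      - mean fun j => toL2 P fun ω => gradient (p.localCost j) (A.xbar p ξ 0 ω)‖ ^ 2
      = ‖gradient (p.localCost i) (avg A.x₀) - gradient p.cost (avg A.x₀)‖ ^ 2 := fun i => by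
    have h1 : (fun ω => gradient (p.localCost i) (A.xbar p ξ 0 ω))
        - (fun ω => gradient p.cost (A.xbar p ξ 0 ω))
        = fun _ => gradient (p.localCost i) (avg A.x₀) - gradient p.cost (avg A.x₀) := rfl
    rw [h.mean_gradient_xbar hp, ← toL2_sub (hD i) (h.memLp_gradient_cost hp 0), h1,
      norm_toL2_const_sq]
  simp_rw [e1, e2]
  rfl

theorem integral_cost_succ_le (h : A.NoiseAssumption p ξ P σ) (hN : 0 < N) (hp : p.Smooth L)
    (r : ℕ) :
    ∫ ω, p.cost (A.xbar p ξ (r + 1) ω) ∂P ≤ ∫ ω, p.cost (A.xbar p ξ r ω) ∂P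
      + inner ℝ (toL2 P fun ω => gradient p.cost (A.xbar p ξ r ω))
          (toL2 P (A.xbar p ξ (r + 1)) - toL2 P (A.xbar p ξ r))
      + L / 2 * ‖toL2 P (A.xbar p ξ (r + 1)) - toL2 P (A.xbar p ξ r)‖ ^ 2 := by
  have hg := h.memLp_gradient_cost hp r
  have hx := (h.memLp_xbar hp (r + 1)).sub (h.memLp_xbar hp r)
  have hc := h.integrable_cost hN hp r
  have hi := integrable_inner_of_memLp hg hx
  have hn := (hx.integrable_norm_pow two_ne_zero).const_mul (L / 2)
  have hci : Integrable (fun ω => p.cost (A.xbar p ξ r ω)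
      + inner ℝ (gradient p.cost (A.xbar p ξ r ω)) ((A.xbar p ξ (r + 1) - A.xbar p ξ r) ω)) P :=
    hc.add hi
  rw [← toL2_sub (h.memLp_xbar hp (r + 1)) (h.memLp_xbar hp r), inner_toL2 hg hx, norm_toL2_sq hx,
    ← integral_const_mul, ← integral_add hc hi, ← integral_add hci hn]
  exact integral_mono (h.integrable_cost hN hp (r + 1)) (hci.add hn) fun ω =>
    descent_lemma (p.differentiable_cost hp) (p.lipschitz_gradient_cost hN hp) _ _

/-- The expected suboptimality of a local cost at the average iterate. -/
theorem integral_localCost_sub_le (h : A.NoiseAssumption p ξ P σ) (hp : p.Smooth L)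
    (hc : ∀ i, ConvexOn ℝ Set.univ (p.localCost i)) (xs : Vec m) (r : ℕ) {t : ℕ} (ht : t < A.τ)
    (i : Fin N) :
    ∫ ω, (p.localCost i (A.xbar p ξ r ω) - p.localCost i xs) ∂P
      ≤ inner ℝ (toL2 P fun ω => gradient (p.localCost i) (A.phi p ξ r t i ω))
          (toL2 P (A.xbar p ξ r) - toL2 P fun _ => xs)
        + L / 2 * ‖toL2 P (A.phi p ξ r t i) - toL2 P (A.xbar p ξ r)‖ ^ 2 := by
  have hφ := h.memLp_phi hp r ht.le i
  have hx := h.memLp_xbar hp r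
  have hg := memLp_gradient hp i hφ
  have hxs := hx.sub (memLp_const (μ := P) (p := 2) xs)
  have hi := integrable_inner_of_memLp hg hxs
  have hn := ((hφ.sub hx).integrable_norm_pow two_ne_zero).const_mul (L / 2)
  rw [← toL2_sub hx (memLp_const xs), ← toL2_sub hφ hx, inner_toL2 hg hxs,
    norm_toL2_sq (hφ.sub hx), ← integral_const_mul, ← integral_add hi hn]
  refine integral_mono ((integrable_comp_of_smooth (hp i).1 (hp i).2 hx).sub (integrable_const _))
    (hi.add hn) fun ω => ?_
  -- Smoothness compares the average iterate with the local iterate, and convexity compares the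
  -- local iterate with `xs`. Subtracting leaves the gradient at the local iterate paired with `x̄ -
  -- xs`.
  have h1 := descent_lemma (hp i).1 (hp i).2 (A.phi p ξ r t i ω) (A.xbar p ξ r ω)
  have h2 := convex_gradient_ineq (hp i).1 (hc i) (A.phi p ξ r t i ω) xs
  simp only [Pi.sub_apply]
  rw [norm_sub_rev] at h1
  have h3 : inner ℝ (gradient (p.localCost i) (A.phi p ξ r t i ω)) (A.xbar p ξ r ω - xs)
      = inner ℝ (gradient (p.localCost i) (A.phi p ξ r t i ω)) (A.xbar p ξ r ω - A.phi p ξ r t i ω)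
        - inner ℝ (gradient (p.localCost i) (A.phi p ξ r t i ω)) (xs - A.phi p ξ r t i ω) := by
    rw [← inner_sub_right]
    congr 1
    abel
  rw [h3]
  linarith

theorem integrable_cost_sub (h : A.NoiseAssumption p ξ P σ) (hN : 0 < N) (hp : p.Smooth L)
    (xs : Vec m) (r : ℕ) : Integrable (fun ω => p.cost (A.xbar p ξ r ω) - p.cost xs) P :=
  (h.integrable_cost hN hp r).sub (integrable_const _)

theorem integral_cost_sub_eq (h : A.NoiseAssumption p ξ P σ) (hp : p.Smooth L) (xs : Vec m)
    (r : ℕ) : ∫ ω, (p.cost (A.xbar p ξ r ω) - p.cost xs) ∂P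
      = 1 / (N : ℝ) * ∑ i, ∫ ω, (p.localCost i (A.xbar p ξ r ω) - p.localCost i xs) ∂P := by
  have hloc : ∀ i ∈ (Finset.univ : Finset (Fin N)),
      Integrable (fun ω => p.localCost i (A.xbar p ξ r ω) - p.localCost i xs) P := fun i _ =>
    (integrable_comp_of_smooth (hp i).1 (hp i).2 (h.memLp_xbar hp r)).sub (integrable_const _)
  rw [← integral_finsetSum _ hloc, ← integral_const_mul]
  refine integral_congr_ae (Filter.Eventually.of_forall fun ω => ?_)
  simp only [Problem.cost, Finset.sum_sub_distrib, mul_sub]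

theorem norm_mean_gradient_sq_le (h : A.NoiseAssumption p ξ P σ) (hN : 0 < N) (hL : 0 < L)
    (hp : p.Smooth L) {xs : Vec m} (hmin : ∀ x, p.cost xs ≤ p.cost x) (r : ℕ) :
    ‖mean fun i => toL2 P fun ω => gradient (p.localCost i) (A.xbar p ξ r ω)‖ ^ 2
      ≤ 2 * L * ∫ ω, (p.cost (A.xbar p ξ r ω) - p.cost xs) ∂P := by
  rw [h.mean_gradient_xbar hp, norm_toL2_sq (h.memLp_gradient_cost hp r), ← integral_const_mul]
  exact integral_mono ((h.memLp_gradient_cost hp r).integrable_norm_pow two_ne_zero)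
    ((h.integrable_cost_sub hN hp xs r).const_mul _) fun ω =>
      norm_gradient_sq_le hL (p.differentiable_cost hp) (p.lipschitz_gradient_cost hN hp) hmin _

theorem norm_mean_sub_eq (h : A.NoiseAssumption p ξ P σ) (hp : p.Smooth L) (xs : Vec m) (r : ℕ) :
    ‖(mean fun i => toL2 P fun ω => A.x p ξ r ω i) - toL2 P fun _ => xs‖ ^ 2
      = ∫ ω, ‖A.xbar p ξ r ω - xs‖ ^ 2 ∂P := by
  rw [← h.toL2_xbar hp, ← toL2_sub (h.memLp_xbar hp r) (memLp_const xs),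
    norm_toL2_sq ((h.memLp_xbar hp r).sub (memLp_const xs))]
  rfl

theorem norm_mean_sub_zero (h : A.NoiseAssumption p ξ P σ) (hp : p.Smooth L) (xs : Vec m) :
    ‖(mean fun i => toL2 P fun ω => A.x p ξ 0 ω i) - toL2 P fun _ => xs‖ ^ 2
      = ‖avg A.x₀ - xs‖ ^ 2 := by
  rw [h.norm_mean_sub_eq hp]
  simp [xbar_zero]

end NoiseAssumption

end Input

/-! ### The three estimates in expectation, for a given step size -/

namespace Input.NoiseAssumption

variable {N m : ℕ} {A : Input N m} {p : Problem.{u} N m} {Ω : Type v}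
  {ξ : ℕ → ℕ → (i : Fin N) → Ω → p.Ξ i} [MeasurableSpace Ω] {P : Measure Ω}
  [IsProbabilityMeasure P] {σ L γ : ℝ}

/-- The sum of the expected stationarity measures, in terms of the effective step size `γ`. -/
theorem sum_integral_stationarity_le (h : A.NoiseAssumption p ξ P σ) (hN : 0 < N) (hτ : 0 < A.τ)
    (hβ : A.β = 1 / (A.τ : ℝ)) (hW : WeightAssumption A.W) (hinit : InitialDual A.W A.x₀ A.y₀)
    (hL : 0 < L) (hp : p.Smooth L) (hα : 0 < A.α) (hγ : A.α * A.τ = γ)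
    (hγL : γ * L ≤ (1 - mixingRate A.W) / 100) (hbdd : BddBelow (Set.range p.cost)) (R : ℕ) :
    ∃ u₀, u₀ ≤ 3 * disagreementSq A.x₀
        + 2 * γ ^ 2 / (1 - mixingRate A.W) * p.heterogeneitySq A.x₀ ∧
      γ * ∑ r ∈ Finset.range R, ∫ ω, A.stationarity p ξ r ω ∂P
        ≤ 4 * (p.cost (avg A.x₀) - ⨅ x, p.cost x)
          + 1024 * L ^ 2 * (γ / (1 - mixingRate A.W)) * u₀
          + R * (8 * L * γ ^ 2 * (σ ^ 2 / (N * A.τ))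
            + 3200 * L ^ 2 * (γ / (1 - mixingRate A.W)) * γ ^ 2 * (σ ^ 2 / A.τ)) := by
  obtain ⟨hl, b, w, hb⟩ := hW.exists_modalBasis hN
  -- The witness is the initial network error; the existential keeps the eigenbasis out of the
  -- conclusion.
  refine ⟨_, h.networkError_zero_le hN hp hinit hl hb γ, ?_⟩
  have hinf : ∀ x, (⨅ x, p.cost x) ≤ p.cost x := fun x => ciInf_le hbdd x
  have hsum := (h.trajectory hp hβ).nonconvex_sum_le hN hτ hb (norm_nonneg _) hl
    hW.doublyStochastic (sum_toL2_y_zero P hW hinit) hL hα (by rw [hγ]; exact hγL)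
    (F := fun r => ∫ ω, p.cost (A.xbar p ξ r ω) ∂P) (c := ⨅ x, p.cost x)
    (fun r => by
      have h1 := integral_mono (integrable_const (⨅ x, p.cost x)) (h.integrable_cost hN hp r)
        fun ω => hinf _
      simpa using h1)
    (fun r => by
      have h1 := h.integral_cost_succ_le hN hp r
      rwa [h.toL2_xbar hp, h.toL2_xbar hp, ← h.mean_gradient_xbar hp] at h1) R
  simp only [hγ, ← h.integral_stationarity hp, xbar_zero, integral_const, probReal_univ,
    one_smul] at hsum
  simp only [xbar_zero]
  have e : γ * L / (1 - mixingRate A.W) = L * (γ / (1 - mixingRate A.W)) := by ring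
  rw [e] at hsum
  linarith

/-- The descent of the squared distance to a minimizer in the convex case. -/
theorem sum_integral_cost_sub_le (h : A.NoiseAssumption p ξ P σ) (hN : 0 < N) (hτ : 0 < A.τ)
    (hβ : A.β = 1 / (A.τ : ℝ)) (hW : WeightAssumption A.W) (hinit : InitialDual A.W A.x₀ A.y₀)
    (hL : 0 < L) (hp : p.Smooth L) (hα : 0 < A.α) (hγ : A.α * A.τ = γ)
    (hγL : γ * L ≤ (1 - mixingRate A.W) / 100) (hc : ∀ i, ConvexOn ℝ Set.univ (p.localCost i))
    {xs : Vec m} (hmin : ∀ x, p.cost xs ≤ p.cost x) (R : ℕ) :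
    ∃ u₀, u₀ ≤ 3 * disagreementSq A.x₀
        + 2 * γ ^ 2 / (1 - mixingRate A.W) * p.heterogeneitySq A.x₀ ∧
      γ * ∑ r ∈ Finset.range R, ∫ ω, (p.cost (A.xbar p ξ r ω) - p.cost xs) ∂P
        ≤ ‖avg A.x₀ - xs‖ ^ 2 + 1000 * L * (γ / (1 - mixingRate A.W)) * u₀
          + R * (3 * γ ^ 2 * (σ ^ 2 / (N * A.τ))
            + 5000 * L * (γ / (1 - mixingRate A.W)) * γ ^ 2 * (σ ^ 2 / A.τ)) := by
  obtain ⟨hl, b, w, hb⟩ := hW.exists_modalBasis hN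
  have hd : 0 < 1 - mixingRate A.W := by linarith
  have hγ0 : 0 < γ := by rw [← hγ]; positivity
  refine ⟨_, h.networkError_zero_le hN hp hinit hl hb γ, ?_⟩
  have hstep := fun r => (h.trajectory hp hβ).convex_succ_le hN hτ hb (norm_nonneg _) hl
    hW.doublyStochastic (sum_toL2_y_zero P hW hinit) hL hα (by rw [hγ]; exact hγL)
    (F := fun r => ∫ ω, (p.cost (A.xbar p ξ r ω) - p.cost xs) ∂P)
    (xs := toL2 P fun _ => xs)
    (h.integral_cost_sub_eq hp xs) (fun r => integral_nonneg fun ω => sub_nonneg.2 (hmin _))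
    (fun r t ht i => by
      have h1 := h.integral_localCost_sub_le hp hc xs r ht i
      rwa [h.toL2_xbar hp] at h1)
    (h.norm_mean_gradient_sq_le hN hL hp hmin)
    (fun r t ht i => h.inner_toL2_noise hp ht (memLp_const xs) measurable_const) r
  simp only [hγ] at hstep
  set U := fun r => networkError (mixingRate A.W) γ b w (fun i => toL2 P fun ω => A.x p ξ r ω i)
    (fun i => toL2 P fun ω => A.y p ξ r ω i)
    (fun i => toL2 P fun ω => gradient (p.localCost i) (A.xbar p ξ r ω))
  have hU0 : ∀ r, 0 ≤ U r := fun r => Trajectory.networkError_nonneg hb hl _ _ _ _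
  have hsum := sum_le_of_descent (R := R) (c := γ)
    (ε := 3 * γ ^ 2 * (σ ^ 2 / (N * A.τ))
      + 5000 * (γ * L / (1 - mixingRate A.W)) * γ ^ 2 * (σ ^ 2 / A.τ))
    (Ψ := fun r => ‖(mean fun i => toL2 P fun ω => A.x p ξ r ω i) - toL2 P fun _ => xs‖ ^ 2
      + 1000 * (γ * L / (1 - mixingRate A.W)) * U r)
    (E := fun r => ∫ ω, (p.cost (A.xbar p ξ r ω) - p.cost xs) ∂P) (fun r => by
      -- Without strong convexity the surplus decrease of the network error is simply discarded.
      have h1 : _ ≤ _ - 10 * (γ * L) * U r + _ + _ := hstep r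
      have h2 : 0 ≤ 10 * (γ * L) * U r := mul_nonneg (by positivity) (hU0 r)
      linarith)
  have hlast := add_nonneg
    (sq_nonneg ‖(mean fun i => toL2 P fun ω => A.x p ξ R ω i) - toL2 P fun _ => xs‖)
    (mul_nonneg (show 0 ≤ 1000 * (γ * L / (1 - mixingRate A.W)) by positivity) (hU0 R))
  simp only [h.norm_mean_sub_zero hp xs] at hsum
  change _ ≤ ‖avg A.x₀ - xs‖ ^ 2 + 1000 * L * (γ / (1 - mixingRate A.W)) * U 0 + _
  have e : γ * L / (1 - mixingRate A.W) = L * (γ / (1 - mixingRate A.W)) := by ring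
  rw [e] at hsum hlast
  linarith

/-- The linear convergence, up to the noise level, of the squared distance to the minimizer. -/
theorem integral_norm_xbar_sub_sq_le {μ : ℝ} (h : A.NoiseAssumption p ξ P σ) (hN : 0 < N)
    (hτ : 0 < A.τ) (hβ : A.β = 1 / (A.τ : ℝ)) (hW : WeightAssumption A.W)
    (hinit : InitialDual A.W A.x₀ A.y₀) (hL : 0 < L) (hp : p.Smooth L) (hα : 0 < A.α)
    (hγ : A.α * A.τ = γ) (hγL : γ * L ≤ (1 - mixingRate A.W) / 100) (hμ : 0 < μ) (hμL : μ ≤ L)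
    (hsc : ∀ i, StrongConvexOn Set.univ μ (p.localCost i))
    {xs : Vec m} (hmin : ∀ x, p.cost xs ≤ p.cost x) (R : ℕ) :
    ∫ ω, ‖A.xbar p ξ R ω - xs‖ ^ 2 ∂P ≤ (30 + 1 / L ^ 2) * (Real.exp (-(γ * μ / 2 * R))
        * (‖avg A.x₀ - xs‖ ^ 2 + p.heterogeneitySq A.x₀ + disagreementSq A.x₀))
      + 6 / μ * (γ * (σ ^ 2 / (N * A.τ)))
      + 10000 * L / μ * (γ ^ 2 * (σ ^ 2 / A.τ) / (1 - mixingRate A.W)) := by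
  obtain ⟨hl, b, w, hb⟩ := hW.exists_modalBasis hN
  have hmain := (h.trajectory hp hβ).strongly_convex_le hN hτ hb (norm_nonneg _) hl
    hW.doublyStochastic (sum_toL2_y_zero P hW hinit) hL hα (by rw [hγ]; exact hγL)
    (F := fun r => ∫ ω, (p.cost (A.xbar p ξ r ω) - p.cost xs) ∂P)
    (xs := toL2 P fun _ => xs)
    (h.integral_cost_sub_eq hp xs) (fun r => integral_nonneg fun ω => sub_nonneg.2 (hmin _))
    (fun r t ht i => by
      have h1 := h.integral_localCost_sub_le hp (Problem.convexOn_localCost hμ hsc) xs r ht i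
      rwa [h.toL2_xbar hp] at h1)
    (h.norm_mean_gradient_sq_le hN hL hp hmin)
    (fun r t ht i => h.inner_toL2_noise hp ht (memLp_const xs) measurable_const) hμ hμL
    (fun r => by
      rw [h.norm_mean_sub_eq hp, ← integral_const_mul]
      exact integral_mono ((((h.memLp_xbar hp r).sub (memLp_const xs)).integrable_norm_pow
        two_ne_zero).const_mul _) (h.integrable_cost_sub hN hp xs r)
        fun ω => StrongConvexOn.quadratic_growth (p.strongConvexOn_cost hN hsc) hmin _)
    (disagreementSq_nonneg A.x₀) (p.heterogeneitySq_nonneg A.x₀)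
    (h.networkError_zero_le hN hp hinit hl hb _) (by rw [h.norm_mean_sub_zero hp]) R
  rwa [hγ, h.norm_mean_sub_eq hp] at hmain

end Input.NoiseAssumption

/-! ### The convergence rates -/

theorem nonconvex_rate :
    (∀ L Δ X : ℝ, 0 < L → ∃ C : ℝ, 0 < C ∧
      ∀ (N m τ R : ℕ) (W : Matrix (Fin N) (Fin N) ℝ) (p : LED.Problem.{u} N m)
        (x₀ y₀ : Fin N → LED.Vec m) (σ : ℝ),
        0 < N → 0 < τ → 0 < R → 0 ≤ σ →
        LED.WeightAssumption W → LED.InitialDual W x₀ y₀ → p.Smooth L →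
        BddBelow (Set.range p.cost) →
        p.cost (LED.avg x₀) - ⨅ x, p.cost x ≤ Δ → LED.disagreementSq x₀ ≤ X →
        ∃ α : ℝ, 0 < α ∧
          ∀ (Ω : Type v) [MeasurableSpace Ω] (P : Measure Ω) [IsProbabilityMeasure P]
            (ξ : ℕ → ℕ → (i : Fin N) → Ω → p.Ξ i) (A : LED.Input N m),
            A = ⟨W, α, 1 / (τ : ℝ), τ, x₀, y₀⟩ →
            A.NoiseAssumption p ξ P σ →
            (∀ r < R, Integrable (A.stationarity p ξ r) P) ∧
            (1 / (R : ℝ)) * ∑ r ∈ Finset.range R, ∫ ω, A.stationarity p ξ r ω ∂P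
              ≤ LED.sublinearRate C σ (LED.mixingRate W) (p.heterogeneitySq x₀) N τ R) := by
  intro L Δ X hL
  -- The numbers `1024`, `8` and `3200` are four times those of `nonconvex_recursion`, because the
  -- descent there carries `γ/4`. Absolute values keep the constant positive for arbitrary real `Δ`
  -- and `X`.
  refine ⟨4 * |Δ| * (100 * L + 1) + 3 * (1024 * L ^ 2) * |X| + 2 * (1024 * L ^ 2) / L ^ 2 + 8 * L
    + 3200 * L ^ 2 + 1, by positivity, ?_⟩
  intro N m τ R W p x₀ y₀ σ hN hτ hR hσ hW hinit hp hbdd hΔ hX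
  obtain ⟨hl, -⟩ := hW.exists_modalBasis hN
  have hτ' : (0 : ℝ) < τ := by exact_mod_cast hτ
  -- The step size is fixed before the probability space is introduced, so it cannot depend on the
  -- samples.
  obtain ⟨γ, hγ, hγL, hγR, hγ1, hγ2⟩ := exists_sublinear_stepSize hL (sub_pos.2 hl) hσ hN hτ hR
  refine ⟨γ / τ, by positivity, ?_⟩
  intro Ω _ P _ ξ A hA h
  subst hA
  refine ⟨fun r _ => h.integrable_stationarity hp r, ?_⟩
  obtain ⟨u₀, hu, hsum⟩ := h.sum_integral_stationarity_le hN hτ rfl hW hinit hL hp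
    (show 0 < γ / τ by positivity) (div_mul_cancel₀ γ hτ'.ne') hγL hbdd R
  exact average_le_sublinearRate (c₁ := 1024 * L ^ 2) (c₂ := 8 * L) (c₃ := 3200 * L ^ 2)
    (Δ₀ := 4 * (p.cost (avg x₀) - ⨅ x, p.cost x)) (Δ := 4 * |Δ|) (X := |X|) hL hl rfl hR hτ
    (by positivity) (by positivity) (by positivity) (p.heterogeneitySq_nonneg x₀) (by positivity)
    (abs_nonneg X) hγ hγL hσ hγR hγ1 hγ2 hsum hu (hX.trans (le_abs_self X))
    (by linarith [le_abs_self Δ])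

theorem convex_rate :
    (∀ L D X : ℝ, 0 < L → ∃ C : ℝ, 0 < C ∧
      ∀ (N m τ R : ℕ) (W : Matrix (Fin N) (Fin N) ℝ) (p : LED.Problem.{u} N m)
        (x₀ y₀ : Fin N → LED.Vec m) (σ : ℝ) (xs : LED.Vec m),
        0 < N → 0 < τ → 0 < R → 0 ≤ σ →
        LED.WeightAssumption W → LED.InitialDual W x₀ y₀ → p.Smooth L →
        (∀ i, ConvexOn ℝ Set.univ (p.localCost i)) → (∀ x, p.cost xs ≤ p.cost x) →
        ‖LED.avg x₀ - xs‖ ^ 2 ≤ D → LED.disagreementSq x₀ ≤ X →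
        ∃ α : ℝ, 0 < α ∧
          ∀ (Ω : Type v) [MeasurableSpace Ω] (P : Measure Ω) [IsProbabilityMeasure P]
            (ξ : ℕ → ℕ → (i : Fin N) → Ω → p.Ξ i) (A : LED.Input N m),
            A = ⟨W, α, 1 / (τ : ℝ), τ, x₀, y₀⟩ →
            A.NoiseAssumption p ξ P σ →
            (∀ r < R, Integrable (fun ω => p.cost (A.xbar p ξ r ω) - p.cost xs) P) ∧
            (1 / (R : ℝ)) * ∑ r ∈ Finset.range R,
                ∫ ω, (p.cost (A.xbar p ξ r ω) - p.cost xs) ∂P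
              ≤ LED.sublinearRate C σ (LED.mixingRate W) (p.heterogeneitySq x₀) N τ R) := by
  intro L D X hL
  refine ⟨|D| * (100 * L + 1) + 3 * (1000 * L) * |X| + 2 * (1000 * L) / L ^ 2 + 3
    + 5000 * L + 1, by positivity, ?_⟩
  intro N m τ R W p x₀ y₀ σ xs hN hτ hR hσ hW hinit hp hc hmin hD hX
  obtain ⟨hl, -⟩ := hW.exists_modalBasis hN
  have hτ' : (0 : ℝ) < τ := by exact_mod_cast hτ
  obtain ⟨γ, hγ, hγL, hγR, hγ1, hγ2⟩ := exists_sublinear_stepSize hL (sub_pos.2 hl) hσ hN hτ hR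
  refine ⟨γ / τ, by positivity, ?_⟩
  intro Ω _ P _ ξ A hA h
  subst hA
  refine ⟨fun r _ => h.integrable_cost_sub hN hp xs r, ?_⟩
  obtain ⟨u₀, hu, hsum⟩ := h.sum_integral_cost_sub_le hN hτ rfl hW hinit hL hp
    (show 0 < γ / τ by positivity) (div_mul_cancel₀ γ hτ'.ne') hγL hc hmin R
  exact average_le_sublinearRate (c₁ := 1000 * L) (c₂ := 3) (c₃ := 5000 * L)
    (Δ₀ := ‖avg x₀ - xs‖ ^ 2) (Δ := |D|) (X := |X|) hL hl rfl hR hτ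
    (by positivity) (by positivity) (by positivity) (p.heterogeneitySq_nonneg x₀) (by positivity)
    (abs_nonneg X) hγ hγL hσ hγR hγ1 hγ2 hsum hu (hX.trans (le_abs_self X))
    (hD.trans (le_abs_self D))

theorem strongly_convex_rate :
    (∀ L μ : ℝ, 0 < μ → μ ≤ L → ∃ C c : ℝ, 0 < C ∧ 0 < c ∧
      ∀ (N m τ R : ℕ) (W : Matrix (Fin N) (Fin N) ℝ) (p : LED.Problem.{u} N m)
        (x₀ y₀ : Fin N → LED.Vec m) (σ : ℝ) (xs : LED.Vec m),
        0 < N → 0 < τ → 0 < R → 0 ≤ σ →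
        LED.WeightAssumption W → LED.InitialDual W x₀ y₀ → p.Smooth L →
        (∀ i, StrongConvexOn Set.univ μ (p.localCost i)) → (∀ x, p.cost xs ≤ p.cost x) →
        ∃ α : ℝ, 0 < α ∧
          ∀ (Ω : Type v) [MeasurableSpace Ω] (P : Measure Ω) [IsProbabilityMeasure P]
            (ξ : ℕ → ℕ → (i : Fin N) → Ω → p.Ξ i) (A : LED.Input N m) (a₀ ℓ : ℝ),
            A = ⟨W, α, 1 / (τ : ℝ), τ, x₀, y₀⟩ →
            A.NoiseAssumption p ξ P σ →
            a₀ = ‖LED.avg x₀ - xs‖ ^ 2 + p.heterogeneitySq x₀ + LED.disagreementSq x₀ →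
            ℓ = Real.log (2 + N * τ * R * a₀ / σ ^ 2) →
            Integrable (fun ω => ‖A.xbar p ξ R ω - xs‖ ^ 2) P ∧
            ∫ ω, ‖A.xbar p ξ R ω - xs‖ ^ 2 ∂P
              ≤ C * ℓ * (σ ^ 2 / (τ * N * R))
                + C * ℓ ^ 2 * (σ ^ 2 / ((1 - LED.mixingRate W) * τ * R ^ 2))
                + C * Real.exp (-(c * (1 - LED.mixingRate W) * R)) * a₀) := by
  intro L μ hμ hμL
  have hL : 0 < L := hμ.trans_le hμL
  -- The three summands dominate the initial Lyapunov value with its noise remainder, then `6/μ *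
  -- 2/μ`, then `10000 L/μ * 4/μ²`. The rate constant is `γ μ / (2 d)` at the largest step `γ =
  -- d/(100 L)`.
  refine ⟨3 * (30 + 1 / L ^ 2) + 12 / μ ^ 2 + 40000 * L / μ ^ 3, μ / (200 * L), by positivity,
    by positivity, ?_⟩
  intro N m τ R W p x₀ y₀ σ xs hN hτ hR hσ hW hinit hp hsc hmin
  obtain ⟨hl, -⟩ := hW.exists_modalBasis hN
  have hd : 0 < 1 - mixingRate W := by linarith
  have hτ' : (0 : ℝ) < τ := by exact_mod_cast hτ
  have hς := p.heterogeneitySq_nonneg x₀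
  have hχ := disagreementSq_nonneg x₀
  obtain ⟨γ, hγ, hγL, hγ0, hγ1, hγ2⟩ := exists_linear_stepSize (σ := σ) (d := 1 - mixingRate W)
    (a := ‖avg x₀ - xs‖ ^ 2 + p.heterogeneitySq x₀ + disagreementSq x₀) hL hμ hd hN hτ hR
    (by positivity) rfl
  refine ⟨γ / τ, by positivity, ?_⟩
  intro Ω _ P _ ξ A a₀ ℓ hA h ha₀ hℓ
  subst hA
  refine ⟨((h.memLp_xbar hp R).sub (memLp_const xs)).integrable_norm_pow two_ne_zero, ?_⟩
  have hmain := h.integral_norm_xbar_sub_sq_le hN hτ rfl hW hinit hL hp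
    (show 0 < γ / τ by positivity) (div_mul_cancel₀ γ hτ'.ne') hγL hμ hμL hsc hmin R
  refine hmain.trans ?_
  have ha0 : 0 ≤ a₀ := by rw [ha₀]; positivity
  simp only [← ha₀]
  rw [← ha₀, ← hℓ] at hγ0 hγ1 hγ2
  have hℓ0 : 0 ≤ ℓ := by
    rw [hℓ]
    have : 0 ≤ N * τ * R * a₀ / σ ^ 2 := by positivity
    exact Real.log_nonneg (by linarith)
  set V := σ ^ 2 / (τ * N * R)
  set Q := σ ^ 2 / ((1 - mixingRate W) * τ * R ^ 2)
  have hV : 0 ≤ ℓ * V := by positivity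
  have hQ : 0 ≤ ℓ ^ 2 * Q := by positivity
  set T := Real.exp (-(μ / (200 * L) * (1 - mixingRate W) * R)) * a₀ with hT
  have hT0 : 0 ≤ T := by positivity
  set K := 30 + 1 / L ^ 2
  have hK : 0 ≤ K := by positivity
  have t1 := mul_le_mul_of_nonneg_left hγ0 hK
  have t2 := mul_le_mul_of_nonneg_left hγ1 (show 0 ≤ 6 / μ by positivity)
  have t3 := mul_le_mul_of_nonneg_left hγ2 (show 0 ≤ 10000 * L / μ by positivity)
  have e2 : 6 / μ * (2 / μ * (ℓ * V)) = 12 / μ ^ 2 * (ℓ * V) := by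
    field_simp
    ring
  have e3 : 10000 * L / μ * (4 / μ ^ 2 * (ℓ ^ 2 * Q)) = 40000 * L / μ ^ 3 * (ℓ ^ 2 * Q) := by
    field_simp
    ring
  rw [e2] at t2
  rw [e3] at t3
  set c₂ := 12 / μ ^ 2
  set c₃ := 40000 * L / μ ^ 3
  have hc₂ : 0 ≤ c₂ := by positivity
  have hc₃ : 0 ≤ c₃ := by positivity
  have m1 := mul_nonneg hK hV
  have m2 := mul_nonneg hK hQ
  have m3 := mul_nonneg hK hT0
  have m4 := mul_nonneg hc₂ hQ
  have m5 := mul_nonneg hc₂ hT0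
  have m6 := mul_nonneg hc₃ hV
  have m7 := mul_nonneg hc₃ hT0
  rw [mul_assoc (3 * K + c₂ + c₃) (Real.exp _) a₀, ← hT]
  linarith

end LED

theorem corollary2 :
    -- nonconvex case
    (∀ L Δ X : ℝ, 0 < L → ∃ C : ℝ, 0 < C ∧
      ∀ (N m τ R : ℕ) (W : Matrix (Fin N) (Fin N) ℝ) (p : LED.Problem.{u} N m)
        (x₀ y₀ : Fin N → LED.Vec m) (σ : ℝ),
        0 < N → 0 < τ → 0 < R → 0 ≤ σ →
        LED.WeightAssumption W → LED.InitialDual W x₀ y₀ → p.Smooth L →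
        BddBelow (Set.range p.cost) →
        p.cost (LED.avg x₀) - ⨅ x, p.cost x ≤ Δ → LED.disagreementSq x₀ ≤ X →
        ∃ α : ℝ, 0 < α ∧
          ∀ (Ω : Type v) [MeasurableSpace Ω] (P : Measure Ω) [IsProbabilityMeasure P]
            (ξ : ℕ → ℕ → (i : Fin N) → Ω → p.Ξ i) (A : LED.Input N m),
            A = ⟨W, α, 1 / (τ : ℝ), τ, x₀, y₀⟩ →
            A.NoiseAssumption p ξ P σ →
            (∀ r < R, Integrable (A.stationarity p ξ r) P) ∧
            (1 / (R : ℝ)) * ∑ r ∈ Finset.range R, ∫ ω, A.stationarity p ξ r ω ∂P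
              ≤ LED.sublinearRate C σ (LED.mixingRate W) (p.heterogeneitySq x₀) N τ R) ∧
    -- convex case
    (∀ L D X : ℝ, 0 < L → ∃ C : ℝ, 0 < C ∧
      ∀ (N m τ R : ℕ) (W : Matrix (Fin N) (Fin N) ℝ) (p : LED.Problem.{u} N m)
        (x₀ y₀ : Fin N → LED.Vec m) (σ : ℝ) (xs : LED.Vec m),
        0 < N → 0 < τ → 0 < R → 0 ≤ σ →
        LED.WeightAssumption W → LED.InitialDual W x₀ y₀ → p.Smooth L →
        (∀ i, ConvexOn ℝ Set.univ (p.localCost i)) → (∀ x, p.cost xs ≤ p.cost x) →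
        ‖LED.avg x₀ - xs‖ ^ 2 ≤ D → LED.disagreementSq x₀ ≤ X →
        ∃ α : ℝ, 0 < α ∧
          ∀ (Ω : Type v) [MeasurableSpace Ω] (P : Measure Ω) [IsProbabilityMeasure P]
            (ξ : ℕ → ℕ → (i : Fin N) → Ω → p.Ξ i) (A : LED.Input N m),
            A = ⟨W, α, 1 / (τ : ℝ), τ, x₀, y₀⟩ →
            A.NoiseAssumption p ξ P σ →
            (∀ r < R, Integrable (fun ω => p.cost (A.xbar p ξ r ω) - p.cost xs) P) ∧
            (1 / (R : ℝ)) * ∑ r ∈ Finset.range R,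
                ∫ ω, (p.cost (A.xbar p ξ r ω) - p.cost xs) ∂P
              ≤ LED.sublinearRate C σ (LED.mixingRate W) (p.heterogeneitySq x₀) N τ R) ∧
    -- strongly convex case
    (∀ L μ : ℝ, 0 < μ → μ ≤ L → ∃ C c : ℝ, 0 < C ∧ 0 < c ∧
      ∀ (N m τ R : ℕ) (W : Matrix (Fin N) (Fin N) ℝ) (p : LED.Problem.{u} N m)
        (x₀ y₀ : Fin N → LED.Vec m) (σ : ℝ) (xs : LED.Vec m),
        0 < N → 0 < τ → 0 < R → 0 ≤ σ →
        LED.WeightAssumption W → LED.InitialDual W x₀ y₀ → p.Smooth L →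
        (∀ i, StrongConvexOn Set.univ μ (p.localCost i)) → (∀ x, p.cost xs ≤ p.cost x) →
        ∃ α : ℝ, 0 < α ∧
          ∀ (Ω : Type v) [MeasurableSpace Ω] (P : Measure Ω) [IsProbabilityMeasure P]
            (ξ : ℕ → ℕ → (i : Fin N) → Ω → p.Ξ i) (A : LED.Input N m) (a₀ ℓ : ℝ),
            A = ⟨W, α, 1 / (τ : ℝ), τ, x₀, y₀⟩ →
            A.NoiseAssumption p ξ P σ →
            a₀ = ‖LED.avg x₀ - xs‖ ^ 2 + p.heterogeneitySq x₀ + LED.disagreementSq x₀ →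
            ℓ = Real.log (2 + N * τ * R * a₀ / σ ^ 2) →
            Integrable (fun ω => ‖A.xbar p ξ R ω - xs‖ ^ 2) P ∧
            ∫ ω, ‖A.xbar p ξ R ω - xs‖ ^ 2 ∂P
              ≤ C * ℓ * (σ ^ 2 / (τ * N * R))
                + C * ℓ ^ 2 * (σ ^ 2 / ((1 - LED.mixingRate W) * τ * R ^ 2))
                + C * Real.exp (-(c * (1 - LED.mixingRate W) * R)) * a₀) :=
  ⟨LED.nonconvex_rate, LED.convex_rate, LED.strongly_convex_rate⟩
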